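/- Let $M$ be a closed oriented Riemannian spin manifold of dimension $n=2m\ge 2$ with $n\equiv 0$ or $4 \pmod 8$ (that is, of $KO$-dimension $0$ or $4$). Let $\gamma^0,\dots,\gamma^{n-1}$ be selfadjoint complex $2^m\times 2^m$ matrices with $\gamma^a\gamma^b+\gamma^b\gamma^a=2\delta^{ab}$, let $\gamma=-(-i)^m\gamma^0\cdots\gamma^{n-1}$ be the grading, and let $J$ be the real structure: the antiunitary operator on $L^2(M,S)$ acting fibrewise as a constant unitary matrix composed with complex conjugation, such that $J\gamma^a=-\gamma^aJ$ for all $a$. Let $\slashed\partial=-i\sum_a\gamma^a\nabla^S_{e_a}$ be the Dirac operator of the spin (Levi-Civita) connection, written in local oriented orthonormal frames $(e_a)$, regarded as the closed operator on $L^2(M,S)$ whose graph is the closure of its graph on smooth spinors. Let $\mathcal A=C^\infty(M)\otimes\mathbb C^2$, whose elements are the pairs $a=(f,g)$ of smooth complex functions on $M$, with componentwise operations and $a^*=(\bar f,\bar g)$, represented on $L^2(M,S)$ by $\pi(f,g)=\tfrac{1+\gamma}{2}f+\tfrac{1-\gamma}{2}g$, with twist $\rho(f,g)=(g,f)$. Put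 $a^+=\rho(a)^*$ on $\mathcal A$. For a bounded operator $\mathcal O$ on $L^2(M,S)$, let $\mathcal O^\dagger$ be its adjoint and $\mathcal O^+=(\gamma^0\mathcal O\gamma^0)^\dagger$. Here $\gamma^0$ acts on spinors written in a measurable orthonormal (spin) frame of $M$. Let $\mathrm{Ad}(a)=\pi(a)\,J\,\pi(a)\,J^{-1}$. An element $u\in\mathcal A$ is unitary if $u^*u=uu^*=1$, and $\rho$-unitary if $u^+u=uu^+=1$. A twisted one-form is a finite sum $A=\sum_i\pi(a_i)[\slashed\partial,b_i]_\rho$ with $a_i,b_i\in\mathcal A$, where $[\slashed\partial,b]_\rho$ is the bounded operator $\slashed\partial\,\pi(b)-\pi(\rho(b))\,\slashed\partial$. A twisted fluctuation (of $\slashed\partial$) is an operator of the form $\slashed\partial+A+JAJ^{-1}$, with $A$ a twisted one-form such that this operator is selfadjoint. Then, for every $a=(f,g)\in\mathcal A$: 1. $\mathrm{Ad}(a)\,\slashed\partial\,\mathrm{Ad}(a)^+$ is a twisted fluctuation if and only if $a$ is unitary; 2. $\mathrm{Ad}(a)\,\slashed\partial\,\mathrm{Ad}(a)^\dagger$ is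 a twisted fluctuation if and only if $a=u\,u_\rho$ for some unitary $u\in\mathcal A$ and some $\rho$-unitary $u_\rho\in\mathcal A$. (The products of operators are taken on their natural domains.) -/

import Mathlib

open MeasureTheory Bundle
open scoped Manifold ContDiff Matrix ENNReal

noncomputable section

namespace TwistedDirac

/-! ### Euclidean Dirac matrices in dimension `2m` -/

/-- The coordinate space `ℝ^{2m}`. -/
abbrev Coord (m : ℕ) := EuclideanSpace ℝ (Fin (2 * m))

/-- The fibre `ℂ^{2^m}` of the spinor bundle. -/
abbrev Spinor (m : ℕ) := EuclideanSpace ℂ (Fin (2 ^ m))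

abbrev SpinorMatrix (m : ℕ) := Matrix (Fin (2 ^ m)) (Fin (2 ^ m)) ℂ

/-- A set of `2m` selfadjoint euclidean Dirac matrices of size `2^m`, together with the matrix `C` of
the charge conjugation `v ↦ C conj(v)`, the antiunitary map (unique up to a phase) that anticommutes with
every Dirac matrix. -/
structure DiracMatrices (m : ℕ) where
  gamma : Fin (2 * m) → SpinorMatrix m
  gamma_hermitian : ∀ a, (gamma a).IsHermitian
  gamma_clifford : ∀ a b,
    gamma a * gamma b + gamma b * gamma a = if a = b then (2 : SpinorMatrix m) else 0
  chargeConj : SpinorMatrix m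
  chargeConj_unitary : chargeConj ∈ Matrix.unitaryGroup (Fin (2 ^ m)) ℂ
  chargeConj_gamma : ∀ a, chargeConj * (gamma a).map star = -(gamma a * chargeConj)

namespace DiracMatrices

variable {m : ℕ} (Δ : DiracMatrices m)

/-- Clifford multiplication `∑ v_a γ^a` by a vector of `ℝ^{2m}`. -/
def clifford (v : Coord m) : SpinorMatrix m := ∑ a, (v a : ℂ) • Δ.gamma a

/-- The group `Spin(2m)` in the spin representation: the products of an even number of
unit vectors. -/
def spinMatrices : Submonoid (SpinorMatrix m) :=
  Submonoid.closure
    {L | ∃ v w : Coord m, ‖v‖ = 1 ∧ ‖w‖ = 1 ∧ L = Δ.clifford v * Δ.clifford w}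

/-- The grading `γ = -(-i)^m γ^0 γ^1 ⋯ γ^{2m-1}`. -/
def grading : SpinorMatrix m := (-(-Complex.I) ^ m) • (List.ofFn Δ.gamma).prod

end DiracMatrices

/-- A matrix acting on the spinor fibre. -/
def act {m : ℕ} (A : SpinorMatrix m) : Spinor m →L[ℂ] Spinor m :=
  Matrix.toEuclideanCLM (n := Fin (2 ^ m)) (𝕜 := ℂ) A

/-- Complex conjugation of the components of a spinor. -/
def conjSpinor (m : ℕ) : Spinor m →SL[starRingEnd ℂ] Spinor m :=
  LinearMap.mkContinuous
    { toFun := fun v => WithLp.toLp 2 (fun k => starRingEnd ℂ (v k))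
      map_add' := fun v w => by ext k; simp
      map_smul' := fun c v => by ext k; simp } 1
    (fun v => by simp [EuclideanSpace.norm_eq])

theorem conjSpinor_conjSpinor {m : ℕ} (v : Spinor m) : conjSpinor m (conjSpinor m v) = v := by
  ext k
  simp [conjSpinor]

theorem act_left_inv {m : ℕ} (Δ : DiracMatrices m) (v : Spinor m) :
    act Δ.chargeConjᴴ (act Δ.chargeConj v) = v := by
  have h : Δ.chargeConjᴴ * Δ.chargeConj = 1 := Matrix.mem_unitaryGroup_iff'.1 Δ.chargeConj_unitary
  rw [act, act, ← mul_apply_eq_comp, ← map_mul, h, map_one]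
  rfl

theorem act_right_inv {m : ℕ} (Δ : DiracMatrices m) (v : Spinor m) :
    act Δ.chargeConj (act Δ.chargeConjᴴ v) = v := by
  have h : Δ.chargeConj * Δ.chargeConjᴴ = 1 := Matrix.mem_unitaryGroup_iff.1 Δ.chargeConj_unitary
  rw [act, act, ← mul_apply_eq_comp, ← map_mul, h, map_one]
  rfl

/-! ### Spin structures -/

section Manifold

variable {m : ℕ} (M : Type*) [TopologicalSpace M] [ChartedSpace (Coord m) M]

/-- Smooth Riemannian metrics on `M`. -/
abbrev Metric [IsManifold (𝓡 (2 * m)) ∞ M] :=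
  ContMDiffRiemannianMetric (𝓡 (2 * m)) ∞ (Coord m) (fun x : M => TangentSpace (𝓡 (2 * m)) x)

variable {M} [IsManifold (𝓡 (2 * m)) ∞ M]

/-- A spin structure on `(M, g)`, given over a countable cover by charts with smooth orthonormal
frames `e_i` : a smooth `Spin(2m)`-valued cocycle `λ_ij` that lifts the changes of frames, i.e.
`λ_ij γ^a λ_ij⁻¹ = ∑_b g(e_{i,b}, e_{j,a}) γ^b`. (In particular the frames define an orientation.)
A spinor is a family of functions `ψ_i` on the `i`-th domain with `ψ_i = λ_ij ψ_j`. -/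
structure SpinStructure (Δ : DiracMatrices m) (g : Metric (m := m) M) where
  chart : ℕ → OpenPartialHomeomorph M (Coord m)
  chart_mem : ∀ i, chart i ∈ IsManifold.maximalAtlas (𝓡 (2 * m)) ∞ M
  cover : ∀ x, ∃ i, x ∈ (chart i).source
  frame : ℕ → Fin (2 * m) → (x : M) → TangentSpace (𝓡 (2 * m)) x
  frame_smooth : ∀ i a, ContMDiffOn (𝓡 (2 * m)) (𝓡 (2 * m)).tangent ∞
    (fun x => (⟨x, frame i a x⟩ : TangentBundle (𝓡 (2 * m)) M)) (chart i).source
  frame_orthonormal : ∀ i, ∀ x ∈ (chart i).source, ∀ a b,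
    g.inner x (frame i a x) (frame i b x) = if a = b then 1 else 0
  trans : ℕ → ℕ → M → SpinorMatrix m
  trans_spin : ∀ i j, ∀ x ∈ (chart i).source ∩ (chart j).source,
    trans i j x ∈ Δ.spinMatrices
  trans_smooth : ∀ i j k l, ContMDiffOn (𝓡 (2 * m)) 𝓘(ℝ, ℂ) ∞ (fun x => trans i j x k l)
    ((chart i).source ∩ (chart j).source)
  trans_cocycle : ∀ i j k, ∀ x ∈ (chart i).source ∩ (chart j).source ∩ (chart k).source,
    trans i j x * trans j k x = trans i k x
  trans_frame : ∀ i j, ∀ x ∈ (chart i).source ∩ (chart j).source, ∀ a,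
    trans i j x * Δ.gamma a =
      (∑ b, (g.inner x (frame i b x) (frame j a x) : ℂ) • Δ.gamma b) * trans i j x

/-- The algebra `C^∞(M)` of smooth complex functions. -/
def smoothFunctions (m : ℕ) (M : Type*) [TopologicalSpace M] [ChartedSpace (Coord m) M] :
    StarSubalgebra ℂ (M → ℂ) where
  carrier := {f | ContMDiff (𝓡 (2 * m)) 𝓘(ℝ, ℂ) ∞ f}
  mul_mem' := fun {f h} hf hh => by
    have := (contDiff_mul (𝕜 := ℝ) (𝔸 := ℂ) (n := ∞)).contMDiff.comp (hf.prodMk_space hh)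
    exact this
  add_mem' := fun {f h} hf hh => hf.add hh
  algebraMap_mem' := fun _ => contMDiff_const
  star_mem' := fun {f} hf =>
    (Complex.conjCLE.toContinuousLinearMap.contDiff (n := ∞)).contMDiff.comp hf

/-- The algebra `C^∞(M) ⊗ ℂ²` of pairs `(f, g)`, with its componentwise operations and star. -/
abbrev Alg (m : ℕ) (M : Type*) [TopologicalSpace M] [ChartedSpace (Coord m) M] :=
  smoothFunctions m M × smoothFunctions m M

/-- The twist `ρ(f, g) = (g, f)`. -/
def rho (a : Alg m M) : Alg m M := (a.2, a.1)

/-- The involution `a⁺ = ρ(a)^*`. -/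
def plus (a : Alg m M) : Alg m M := star (rho a)

/-- The unitary elements: `u^* u = u u^* = 1`. -/
def unitaries (m : ℕ) (M : Type*) [TopologicalSpace M] [ChartedSpace (Coord m) M] :
    Set (Alg m M) :=
  {u | star u * u = 1 ∧ u * star u = 1}

/-- The twisted unitary elements: `u⁺ u = u u⁺ = 1`. -/
def twistedUnitaries (m : ℕ) (M : Type*) [TopologicalSpace M] [ChartedSpace (Coord m) M] :
    Set (Alg m M) :=
  {u | plus u * u = 1 ∧ u * plus u = 1}

namespace SpinStructure

variable {Δ : DiracMatrices m} {g : Metric (m := m) M} (S : SpinStructure Δ g)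

/-! ### Spinors and the Dirac operator on smooth spinors -/

open Classical in
/-- The preferred frame at `x`: the first one in the list that is defined at `x`. -/
def idx (x : M) : ℕ := Nat.find (S.cover x)

/-- Sections of the spinor bundle are written in the preferred frames, as functions
`M → ℂ^{2^m}`; `rep ψ i` is the section `ψ` in the `i`-th frame. -/
def rep (ψ : M → Spinor m) (i : ℕ) (y : M) : Spinor m := act (S.trans i (S.idx y) y) (ψ y)

def IsSmoothSpinor (ψ : M → Spinor m) : Prop :=
  ∀ i, ContMDiffOn (𝓡 (2 * m)) 𝓘(ℝ, Spinor m) ∞ (S.rep ψ i) (S.chart i).source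

/-- `g([e_a, e_b], e_c)` for the `i`-th frame. -/
def bracketCoeff (i : ℕ) (a b c : Fin (2 * m)) (x : M) : ℝ :=
  g.inner x (VectorField.mlieBracket (𝓡 (2 * m)) (S.frame i a) (S.frame i b) x) (S.frame i c x)

/-- The Levi-Civita coefficients `Γ_{ab}^c = g(∇_{e_a} e_b, e_c)` in the `i`-th (orthonormal) frame,
by the Koszul formula. -/
def christoffel (i : ℕ) (a b c : Fin (2 * m)) (x : M) : ℝ :=
  (1 / 2) * (S.bracketCoeff i a b c x - S.bracketCoeff i b c a x + S.bracketCoeff i c a b x)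

/-- The spin connection `∇_{e_a} ψ = e_a(ψ_i) - (1/4) ∑_{b,c} Γ_{ab}^c γ^b γ^c ψ_i` in the `i`-th
frame, at a point of its domain. The sign is the one for `γ^b γ^c + γ^c γ^b = 2 δ^{bc}`:
it makes `[∇_{e_a}, γ^b] = ∑_c Γ_{ab}^c γ^c`. -/
def spinConnection (i : ℕ) (a : Fin (2 * m)) (ψ : M → Spinor m) (x : M) : Spinor m :=
  (show Spinor m from mfderiv (𝓡 (2 * m)) 𝓘(ℝ, Spinor m) (S.rep ψ i) x (S.frame i a x)) -
    act ((1 / 4 : ℂ) • ∑ b, ∑ c, (S.christoffel i a b c x : ℂ) • (Δ.gamma b * Δ.gamma c))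
      (S.rep ψ i x)

/-- The Dirac operator `-i ∑_a γ^a ∇_{e_a}` on smooth spinors, in the preferred frames. -/
def diracSection (ψ : M → Spinor m) (x : M) : Spinor m :=
  (-Complex.I) • ∑ a, act (Δ.gamma a) (S.spinConnection (S.idx x) a ψ x)

/-! ### The Hilbert space of square integrable spinors -/

variable [MeasurableSpace M]

/-- `√det(g_{μν})` at the point of coordinates `y` in the `i`-th chart. -/
def volumeDensity (i : ℕ) (y : Coord m) : ℝ :=
  Real.sqrt (Matrix.det (Matrix.of fun μ ν : Fin (2 * m) =>
    g.inner ((S.chart i).symm y)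
      (mfderiv 𝓘(ℝ, Coord m) (𝓡 (2 * m)) (S.chart i).symm y (EuclideanSpace.single μ (1 : ℝ)))
      (mfderiv 𝓘(ℝ, Coord m) (𝓡 (2 * m)) (S.chart i).symm y (EuclideanSpace.single ν (1 : ℝ)))))

/-- The Riemannian volume measure, `√det(g_{μν}) dx` in every chart: `M` is the disjoint
union of the sets `{x | idx x = i}`, each contained in the domain of the `i`-th chart. -/
def vol : Measure M :=
  Measure.sum fun i =>
    (((volume : Measure (Coord m)).restrict (S.chart i '' {x | S.idx x = i})).withDensity
      (fun y => ENNReal.ofReal (S.volumeDensity i y))).map (S.chart i).symm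

/-- The Hilbert space `L²(M, S)`. As the transition matrices are unitary, it is the space
of square integrable functions `M → ℂ^{2^m}`, spinors being written in the preferred frames. -/
abbrev Hilb := Lp (Spinor m) 2 S.vol

/-- A constant matrix as an operator on `L²(M, S)`. -/
def constOp (A : SpinorMatrix m) : S.Hilb →L[ℂ] S.Hilb := (act A).compLpL 2 S.vol

/-- The operator of the first Dirac matrix `γ^0`: Clifford multiplication by the first vector of the
preferred frame. -/
def gammaZero [NeZero m] : S.Hilb →L[ℂ] S.Hilb := S.constOp (Δ.gamma 0)

/-- The real structure `(Jψ)(x) = C conj(ψ(x))`, an antilinear bijection of `L²(M, S)`, together with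
its inverse `(J⁻¹ψ)(x) = conj(C^† ψ(x))`. -/
def realStructure : S.Hilb ≃SL[starRingEnd ℂ] S.Hilb :=
  ContinuousLinearEquiv.equivOfInverse
    (((act Δ.chargeConj).comp (conjSpinor m)).compLpL 2 S.vol)
    (((conjSpinor m).comp (act Δ.chargeConjᴴ)).compLpL 2 S.vol)
    (fun ψ => by
      refine Lp.ext ?_
      filter_upwards [ContinuousLinearMap.coeFn_compLpL (μ := S.vol) (p := 2)
          ((conjSpinor m).comp (act Δ.chargeConjᴴ))
          (((act Δ.chargeConj).comp (conjSpinor m)).compLpL 2 S.vol ψ),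
        ContinuousLinearMap.coeFn_compLpL (μ := S.vol) (p := 2)
          ((act Δ.chargeConj).comp (conjSpinor m)) ψ] with x h1 h2
      rw [h1, h2]
      simp only [ContinuousLinearMap.comp_apply]
      rw [act_left_inv Δ, conjSpinor_conjSpinor])
    (fun ψ => by
      refine Lp.ext ?_
      filter_upwards [ContinuousLinearMap.coeFn_compLpL (μ := S.vol) (p := 2)
          ((act Δ.chargeConj).comp (conjSpinor m))
          (((conjSpinor m).comp (act Δ.chargeConjᴴ)).compLpL 2 S.vol ψ),
        ContinuousLinearMap.coeFn_compLpL (μ := S.vol) (p := 2)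
          ((conjSpinor m).comp (act Δ.chargeConjᴴ)) ψ] with x h1 h2
      rw [h1, h2]
      simp only [ContinuousLinearMap.comp_apply]
      rw [conjSpinor_conjSpinor, act_right_inv Δ])

/-- The conjugate `J T J⁻¹` of a bounded operator. -/
def conjJ (T : S.Hilb →L[ℂ] S.Hilb) : S.Hilb →L[ℂ] S.Hilb :=
  (S.realStructure : S.Hilb →SL[starRingEnd ℂ] S.Hilb).comp
    (T.comp (S.realStructure.symm : S.Hilb →SL[starRingEnd ℂ] S.Hilb))

/-! ### The minimally twisted spectral triple -/

variable [BorelSpace M] [CompactSpace M]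

theorem memLp_top (f : smoothFunctions m M) : MemLp (f : M → ℂ) ∞ S.vol := by
  have hc : Continuous (f : M → ℂ) := ContMDiff.continuous f.2
  obtain ⟨K, hK⟩ := (isCompact_range hc).isBounded.exists_norm_le
  exact memLp_top_of_bound hc.aestronglyMeasurable K
    (Filter.Eventually.of_forall fun x => hK _ (Set.mem_range_self x))

/-- The representation `π₀` of `C^∞(M)` on `L²(M, S)` by multiplication. -/
def mulOp (f : smoothFunctions m M) : S.Hilb →L[ℂ] S.Hilb :=
  (ContinuousLinearMap.lsmul ℂ ℂ : ℂ →L[ℂ] Spinor m →L[ℂ] Spinor m).holderL S.vol ∞ 2 2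
    (S.memLp_top f).toLp

/-- The representation `π(f, g) = (1 + γ)/2 π₀(f) + (1 - γ)/2 π₀(g)` of `C^∞(M) ⊗ ℂ²`. -/
def pi (a : Alg m M) : S.Hilb →L[ℂ] S.Hilb :=
  S.constOp ((1 / 2 : ℂ) • (1 + Δ.grading)) ∘L S.mulOp a.1 +
    S.constOp ((1 / 2 : ℂ) • (1 - Δ.grading)) ∘L S.mulOp a.2

/-- `Ad(a) = a J a J⁻¹`. -/
def Ad (a : Alg m M) : S.Hilb →L[ℂ] S.Hilb := S.pi a ∘L S.conjJ (S.pi a)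

/-- The twisted adjoint `O⁺ = ρ(O)^†`, where `ρ(O) = γ^0 O γ^0`. -/
def plusOp [NeZero m] (O : S.Hilb →L[ℂ] S.Hilb) : S.Hilb →L[ℂ] S.Hilb :=
  ContinuousLinearMap.adjoint (S.gammaZero ∘L O ∘L S.gammaZero)

/-- The Dirac operator as an unbounded operator on `L²(M, S)`: the closure of its restriction to
smooth spinors (the closure is taken on graphs). -/
def dirac : S.Hilb →ₗ.[ℂ] S.Hilb :=
  (Submodule.span ℂ {p : S.Hilb × S.Hilb | ∃ ψ : M → Spinor m, S.IsSmoothSpinor ψ ∧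
    p.1 =ᵐ[S.vol] ψ ∧ p.2 =ᵐ[S.vol] S.diracSection ψ}).topologicalClosure.toLinearPMap

/-- The bounded operator `X` is the twisted commutator `[D, b]_ρ = D b - ρ(b) D` of the Dirac
operator (which, the domain of `D` being dense, determines `X`). -/
def IsTwistedCommutator (b : Alg m M) (X : S.Hilb →L[ℂ] S.Hilb) : Prop :=
  ∀ ψ : S.dirac.domain, ∃ h : S.pi b ψ ∈ S.dirac.domain,
    X ψ = S.dirac ⟨S.pi b ψ, h⟩ - S.pi (rho b) (S.dirac ψ)

/-- The twisted one-forms: the finite sums `∑ a_i [D, b_i]_ρ`. -/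
def twistedOneForms : Set (S.Hilb →L[ℂ] S.Hilb) :=
  {A | ∃ (N : ℕ) (a b : Fin N → Alg m M) (X : Fin N → (S.Hilb →L[ℂ] S.Hilb)),
    (∀ i, S.IsTwistedCommutator (b i) (X i)) ∧ A = ∑ i, S.pi (a i) ∘L X i}

/-- `D_A = D + A + J A J⁻¹`, on the domain of `D` (`ε' = 1`, i.e. `J D = D J`, since `J`
anticommutes with the Dirac matrices). -/
def twistedDirac (A : S.Hilb →L[ℂ] S.Hilb) : S.Hilb →ₗ.[ℂ] S.Hilb :=
  ((A + S.conjJ A : S.Hilb →L[ℂ] S.Hilb) : S.Hilb →ₗ[ℂ] S.Hilb) +ᵥ S.dirac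

/-- `T` is a twisted fluctuation of the Dirac operator: `T = D + A + J A J⁻¹` for a twisted one-form
`A` such that this operator is selfadjoint. -/
def IsTwistedFluctuation (T : S.Hilb →ₗ.[ℂ] S.Hilb) : Prop :=
  ∃ A ∈ S.twistedOneForms, IsSelfAdjoint (S.twistedDirac A) ∧ T = S.twistedDirac A

/-- The operator `L D R` for bounded `L` and `R`, on its natural domain `{ψ | R ψ ∈ dom D}`. -/
def sandwich (L R : S.Hilb →L[ℂ] S.Hilb) : S.Hilb →ₗ.[ℂ] S.Hilb where
  domain := S.dirac.domain.comap (R : S.Hilb →ₗ[ℂ] S.Hilb)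
  toFun :=
    { toFun := fun ψ => L (S.dirac ⟨R ψ, ψ.2⟩)
      map_add' := fun ψ φ => by
        rw [← map_add, ← LinearPMap.map_add]
        congr 2
        ext1
        simp
      map_smul' := fun c ψ => by
        rw [RingHom.id_apply, ← map_smul, ← LinearPMap.map_smul]
        congr 2
        ext1
        simp }

end SpinStructure

end Manifold

end TwistedDirac

end

/-! For even `m` the grading is selfadjoint and commutes with `J`, so `J π(a) J⁻¹ = π(a*)` and
`Ad(a) = π(h)` with `h = a a*`, whose entries `|f|²` and `|g|²` are nonnegative. Hence `Ad(a)† =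
π(h)`, while `Ad(a)⁺ = π(ρ(h))` because `γ⁰` exchanges the two chiralities. Both questions are about
an operator `π(l) D π(r)`.

The twisted Leibniz rule `D π(r) = π(ρ(r)) D + [D, r]_ρ`, whose last term is bounded, turns this
operator into `π(l ρ(r)) D` plus a bounded operator. A twisted fluctuation is `D` plus a bounded
operator, so `π(l ρ(r) - 1) D` must be bounded. As `D` is truly of first order, this forces `l ρ(r)
= 1` (`eq_zero_of_pi_dirac_bounded`, `mul_rho_eq_one_of_sandwich_eq`): commuting `D` past `exp(i t
k)` produces a term linear in `t`, and Clifford multiplication by `dk` squares to `|dk|²` up to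
sign, which is invertible where `dk ≠ 0`.

With `Ad(a)⁺` the condition reads `h² = 1`, that is `h = 1` by positivity, and then the operator is
`D` itself. With `Ad(a)†` it reads `h ρ(h) = 1`, that is `|f| |g| = 1`, which is equivalent to the
factorization with `u = (f |g|, g |f|)` and `u_ρ = (|f|, |g|)`. In that case `π(h) D π(h) = D + π(h)
[D, h]_ρ`, and half of the last term is a one-form `A` with `J A J⁻¹ = A`
(`isTwistedFluctuation_sandwich`).

A fluctuation also has to be selfadjoint, which takes most of the work: the closure of the Dirac
operator on smooth spinors is selfadjoint (`isSelfAdjoint_vadd_dirac`). Symmetry is integration by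
parts in charts (`integral_locDirac_symm`), glued by a partition of unity. Maximality says that
every weak solution of `D ψ = η` lies in the closed graph (`mem_diracGraph_of_weak`). After
localization to a chart this is Friedrichs' argument: the mollified spinors have bounded images
under `D`, because the variation `O(ε)` of the coefficients compensates the derivative of the
mollifier. Bounded images and weak convergence are enough, since a closed subspace is weakly closed
(`mem_of_weak_limit`).

Spinors are written in preferred frames that jump from point to point, so everything local rests on
covariance under changes of frame. It follows from two uniqueness statements: the torsion-free
metric connection is unique (`frameGamma_gauge`), and its lift to spinors is unique because a matrix
that commutes with all `γ^a`, is skew and commutes with the charge conjugation vanishes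
(`spinGen_gauge`). -/

noncomputable section

namespace TwistedDirac

/-! ### Dirac matrices: irreducibility, grading, spin group and spin Lie algebra. -/

namespace DiracMatrices

variable {m : ℕ} (Δ : DiracMatrices m)

theorem eq_zero_of_eq_neg {X : SpinorMatrix m} (h : X = -X) : X = 0 := by
  ext i j
  exact self_eq_neg.1 (congrFun (congrFun h i) j)

theorem gamma_mul_self (a : Fin (2 * m)) : Δ.gamma a * Δ.gamma a = 1 := by
  have h := Δ.gamma_clifford a a
  rw [if_pos rfl, ← two_mul] at h
  have h2 : (2 : SpinorMatrix m) = (2 : ℂ) • 1 := by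
    rw [ofNat_smul_eq_nsmul, nsmul_one]; rfl
  rw [h2, smul_one_mul] at h
  exact smul_right_injective _ (two_ne_zero' ℂ) h

theorem gamma_anticomm {a b : Fin (2 * m)} (h : a ≠ b) :
    Δ.gamma a * Δ.gamma b = -(Δ.gamma b * Δ.gamma a) := by
  have := Δ.gamma_clifford a b
  rw [if_neg h] at this
  exact eq_neg_of_add_eq_zero_left this

theorem gamma_conjTranspose (a : Fin (2 * m)) : (Δ.gamma a)ᴴ = Δ.gamma a := Δ.gamma_hermitian a

theorem gamma_mul_prod (a : Fin (2 * m)) (l : List (Fin (2 * m))) :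
    Δ.gamma a * (l.map Δ.gamma).prod =
      (-1 : ℂ) ^ (l.countP (fun b => decide (b ≠ a))) • ((l.map Δ.gamma).prod * Δ.gamma a) := by
  induction l with
  | nil => simp
  | cons b l ih =>
    rw [List.map_cons, List.prod_cons, List.countP_cons]
    by_cases h : b = a
    · subst h
      rw [mul_assoc _ _ (Δ.gamma b), ih]
      simp
    · rw [← mul_assoc, Δ.gamma_anticomm (Ne.symm h), neg_mul, mul_assoc, ih]
      simp [h, pow_succ, mul_assoc]

theorem prod_conjTranspose_mul (l : List (Fin (2 * m))) :
    ((l.map Δ.gamma).prod)ᴴ * (l.map Δ.gamma).prod = 1 := by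
  induction l with
  | nil => simp
  | cons b l ih =>
    rw [List.map_cons, List.prod_cons, Matrix.conjTranspose_mul, gamma_conjTranspose,
      mul_assoc, ← mul_assoc (Δ.gamma b), gamma_mul_self, one_mul, ih]

/-- A basis of the Clifford algebra. -/
def gammaProd (I : Finset (Fin (2 * m))) : SpinorMatrix m := (I.toList.map Δ.gamma).prod

theorem gamma_mul_gammaProd (a : Fin (2 * m)) (I : Finset (Fin (2 * m))) :
    Δ.gamma a * Δ.gammaProd I =
      (-1 : ℂ) ^ (I.erase a).card • (Δ.gammaProd I * Δ.gamma a) := by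
  rw [gammaProd, gamma_mul_prod]
  congr 2
  rw [List.countP_eq_length_filter, ← Finset.filter_ne', ← Finset.length_toList]
  refine List.Perm.length_eq ((List.perm_ext_iff_of_nodup
    (List.Nodup.filter _ (Finset.nodup_toList _)) (Finset.nodup_toList _)).2 ?_)
  simp

/-- The matrix `γ^a` passes through `γ^I` with the sign `(-1)^|I \ {a}|`, so some `γ^a`
distinguishes two different products. If no `a` did, then either `|I| + |K|` is even and membership
in `I` and `K` agrees for all `a`, or it is odd and `K` is the complement of `I`. The second case is
absurd since `|I| + |Iᶜ| = 2m` is even. -/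
theorem exists_odd_card_erase_add {I K : Finset (Fin (2 * m))} (h : I ≠ K) :
    ∃ a, Odd ((I.erase a).card + (K.erase a).card) := by
  by_contra! hc
  have key : ∀ a, Even (I.card + K.card + (if a ∈ I then 1 else 0) + (if a ∈ K then 1 else 0)) := by
    intro a
    have h1 := hc a
    rw [Nat.not_odd_iff_even] at h1
    have e1 : ∀ L : Finset (Fin (2 * m)),
        L.card = (L.erase a).card + (if a ∈ L then 1 else 0) := by
      intro L
      split_ifs with hL
      · exact (Finset.card_erase_add_one hL).symm
      · rw [Finset.erase_eq_of_notMem hL, add_zero]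
    have := e1 I
    have := e1 K
    rw [Nat.even_iff] at h1 ⊢
    split_ifs at * <;> omega
  by_cases hp : Even (I.card + K.card)
  · apply h
    ext a
    have h1 := key a
    rw [Nat.even_iff] at h1 hp
    by_cases hI : a ∈ I <;> by_cases hK : a ∈ K <;> simp [hI, hK] at h1 ⊢ <;> omega
  · have hcompl : K = Iᶜ := by
      ext a
      have h1 := key a
      rw [Nat.even_iff] at h1 hp
      rw [Finset.mem_compl]
      by_cases hI : a ∈ I <;> by_cases hK : a ∈ K <;> simp [hI, hK] at h1 ⊢ <;> omega
    apply hp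
    have := Finset.card_add_card_compl I
    rw [hcompl, this]
    simp

/-- Conjugation by an involution `γ^a` with opposite signs on the two products changes the sign of
the trace and preserves it. -/
theorem trace_gammaProd (I K : Finset (Fin (2 * m))) :
    ((Δ.gammaProd I)ᴴ * Δ.gammaProd K).trace = if I = K then (2 : ℂ) ^ m else 0 := by
  split_ifs with h
  · rw [h, gammaProd, prod_conjTranspose_mul]
    simp [Matrix.trace_one]
  · obtain ⟨a, ha⟩ := exists_odd_card_erase_add h
    have h1 : Δ.gamma a * (Δ.gammaProd I)ᴴ * Δ.gammaProd K * Δ.gamma a =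
        -((Δ.gammaProd I)ᴴ * Δ.gammaProd K) := by
      have e1 := congrArg Matrix.conjTranspose (Δ.gamma_mul_gammaProd a I)
      have e2 := Δ.gamma_mul_gammaProd a K
      rw [Matrix.conjTranspose_smul, Matrix.conjTranspose_mul, Matrix.conjTranspose_mul,
        gamma_conjTranspose] at e1
      have e3 : Δ.gammaProd K * Δ.gamma a = (-1 : ℂ) ^ (K.erase a).card •
          (Δ.gamma a * Δ.gammaProd K) := by
        rw [e2, smul_smul, ← mul_pow]
        simp
      have e4 : Δ.gamma a * (Δ.gammaProd I)ᴴ = (-1 : ℂ) ^ (I.erase a).card •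
          ((Δ.gammaProd I)ᴴ * Δ.gamma a) := by
        rw [e1, smul_smul, star_pow, star_neg, star_one, ← mul_pow]
        simp
      rw [mul_assoc, e3, e4, smul_mul_smul_comm, ← pow_add, Odd.neg_one_pow ha, neg_one_smul,
        mul_assoc, ← mul_assoc (Δ.gamma a), gamma_mul_self, one_mul]
    have h2 := congrArg Matrix.trace h1
    rw [mul_assoc, mul_assoc, ← mul_assoc (Δ.gammaProd I)ᴴ, Matrix.trace_mul_comm, mul_assoc,
      gamma_mul_self, mul_one, Matrix.trace_neg] at h2
    exact self_eq_neg.1 h2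

/-- Trace orthogonality makes the `2^(2m)` products linearly independent, and `2^(2m)` is the
dimension of the space of `2^m × 2^m` matrices. -/
theorem span_gammaProd : Submodule.span ℂ (Set.range Δ.gammaProd) = ⊤ := by
  have hli : LinearIndependent ℂ Δ.gammaProd := by
    rw [Fintype.linearIndependent_iff]
    intro c hc I
    have h1 : ((Δ.gammaProd I)ᴴ * ∑ K, c K • Δ.gammaProd K).trace = 0 := by rw [hc]; simp
    rw [Finset.mul_sum, Matrix.trace_sum] at h1
    simp only [mul_smul_comm, Matrix.trace_smul, trace_gammaProd] at h1
    simpa using h1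
  refine hli.span_eq_top_of_card_eq_finrank' ?_
  rw [Module.finrank_matrix]
  simp [← pow_add, ← two_mul]

/-- The Dirac matrices act irreducibly. -/
theorem exists_scalar_of_commute {X : SpinorMatrix m} (h : ∀ a, X * Δ.gamma a = Δ.gamma a * X) :
    ∃ c : ℂ, X = c • 1 := by
  have hall : ∀ Y : SpinorMatrix m, Commute X Y := by
    intro Y
    have hY : Y ∈ Submodule.span ℂ (Set.range Δ.gammaProd) := by rw [span_gammaProd]; trivial
    induction hY using Submodule.span_induction with
    | mem Y hY =>
      obtain ⟨I, rfl⟩ := hY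
      refine Commute.list_prod_right _ _ ?_
      intro y hy
      obtain ⟨a, -, rfl⟩ := List.mem_map.1 hy
      exact h a
    | zero => exact Commute.zero_right _
    | add _ _ _ _ h1 h2 => exact h1.add_right h2
    | smul c _ _ h1 => exact h1.smul_right c
  obtain ⟨c, hc⟩ := Matrix.mem_range_scalar_of_commute_single (M := X)
    (fun i j _ => (hall (Matrix.single i j 1)).symm)
  exact ⟨c, by rw [← hc, Matrix.smul_one_eq_diagonal]; rfl⟩

theorem chargeConj_mul_star : Δ.chargeConj * Δ.chargeConjᴴ = 1 :=
  Matrix.mem_unitaryGroup_iff.1 Δ.chargeConj_unitary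

/-- By irreducibility `X` is a scalar `c`. Skewness makes `c` imaginary, and commuting with the
antiunitary charge conjugation makes it real. This replaces any explicit description of the spin Lie
algebra. -/
theorem eq_zero_of_commute {X : SpinorMatrix m} (h : ∀ a, X * Δ.gamma a = Δ.gamma a * X)
    (hskew : Xᴴ = -X) (hreal : Δ.chargeConj * X.map star = X * Δ.chargeConj) : X = 0 := by
  obtain ⟨c, rfl⟩ := Δ.exists_scalar_of_commute h
  have h1 : star c = -c := by
    have := congrFun (congrFun hskew 0) 0
    simpa using this
  have h2 : (c • (1 : SpinorMatrix m)).map star = star c • 1 := by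
    ext i j
    by_cases hij : i = j <;> simp [hij]
  rw [h2, h1, smul_one_mul, neg_smul, Matrix.mul_neg, mul_smul_comm, mul_one] at hreal
  have h3 : c • Δ.chargeConj = 0 := eq_zero_of_eq_neg hreal.symm
  rw [← Δ.chargeConj_mul_star, ← smul_mul_assoc, h3, zero_mul]

/-! ### The grading -/

theorem grading_eq : Δ.grading = (-(-Complex.I) ^ m) • ((List.finRange (2 * m)).map Δ.gamma).prod := by
  rw [grading, List.ofFn_eq_map]

theorem gamma_grading (a : Fin (2 * m)) : Δ.gamma a * Δ.grading = -(Δ.grading * Δ.gamma a) := by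
  have hc : (List.finRange (2 * m)).countP (fun b => decide (b ≠ a)) = 2 * m - 1 := by
    have h1 := List.length_eq_countP_add_countP (fun b => decide (b = a)) (l := List.finRange (2 * m))
    have h2 : (List.finRange (2 * m)).countP (fun b => decide (b = a)) = 1 := by
      have := List.count_eq_one_of_mem (List.nodup_finRange (2 * m)) (List.mem_finRange a)
      rw [← this, List.count]
      congr 1
    rw [h2, List.length_finRange] at h1
    have h3 : (List.finRange (2 * m)).countP (fun b => decide (b ≠ a)) =
      (List.finRange (2 * m)).countP (fun b => decide (¬ (decide (b = a)) = true)) := by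
      congr 1; ext b; simp
    omega
  have hodd : Odd (2 * m - 1) := by
    have := a.isLt
    exact ⟨m - 1, by omega⟩
  rw [grading_eq, mul_smul_comm, gamma_mul_prod, hc, hodd.neg_one_pow, neg_one_smul, smul_neg,
    smul_mul_assoc]

/-- Taking adjoints reverses the order of the factors, and reversing `k` distinct anticommuting
factors takes `k(k-1)/2` transpositions. -/
theorem conjTranspose_prod (l : List (Fin (2 * m))) (hl : l.Nodup) :
    ((l.map Δ.gamma).prod)ᴴ =
      (-1 : ℂ) ^ (l.length * (l.length - 1) / 2) • (l.map Δ.gamma).prod := by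
  induction l with
  | nil => simp
  | cons b l ih =>
    rw [List.nodup_cons] at hl
    have hcount : l.countP (fun c => decide (c ≠ b)) = l.length := by
      rw [List.countP_eq_length]
      intro c hc
      simpa using fun h : c = b => hl.1 (h ▸ hc)
    rw [List.map_cons, List.prod_cons, Matrix.conjTranspose_mul, gamma_conjTranspose, ih hl.2,
      gamma_mul_prod, hcount, smul_mul_assoc, smul_smul, ← pow_add]
    congr 1
    have h4 : (l.length + 1) * l.length / 2 = l.length * (l.length - 1) / 2 + l.length := by
      have h5 : (l.length + 1) * l.length = l.length * (l.length - 1) + l.length * 2 := by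
        rcases l.length with _ | k
        · simp
        · simp; ring
      rw [h5, Nat.add_mul_div_right _ _ (by norm_num)]
    rw [List.length_cons, Nat.add_sub_cancel, h4, add_assoc, pow_add, ← two_mul, pow_mul _ 2]
    simp

variable {Δ} in
-- This is where the `KO`-dimension enters: for `n ≡ 0, 4 (mod 8)` the number `m` is even and the
-- prefactor of the grading is a real sign.
theorem neg_I_pow_real (hm : Even m) : star (-(-Complex.I) ^ m) = -(-Complex.I) ^ m ∧
    (-(-Complex.I) ^ m) * (-(-Complex.I) ^ m) = 1 := by
  obtain ⟨k, rfl⟩ := hm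
  have h : (-Complex.I) ^ (k + k) = (-1) ^ k := by
    rw [← two_mul, pow_mul]; simp
  rw [h]
  refine ⟨by simp, ?_⟩
  rw [neg_mul_neg, ← mul_pow]
  simp

theorem grading_conjTranspose (hm : Even m) : Δ.gradingᴴ = Δ.grading := by
  rw [grading_eq, Matrix.conjTranspose_smul, (neg_I_pow_real hm).1,
    conjTranspose_prod _ _ (List.nodup_finRange _), List.length_finRange]
  have : Even (2 * m * (2 * m - 1) / 2) := by
    rw [mul_assoc, Nat.mul_div_cancel_left _ (by norm_num)]
    exact hm.mul_right _
  rw [this.neg_one_pow, one_smul]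

theorem grading_mul_self (hm : Even m) : Δ.grading * Δ.grading = 1 := by
  nth_rw 1 [← Δ.grading_conjTranspose hm]
  rw [grading_eq, Matrix.conjTranspose_smul, (neg_I_pow_real hm).1, smul_mul_smul_comm,
    (neg_I_pow_real hm).2, prod_conjTranspose_mul, one_smul]

theorem map_star_mul (A B : SpinorMatrix m) : (A * B).map star = A.map star * B.map star := by
  ext i j
  simp [Matrix.mul_apply]

theorem map_star_add (A B : SpinorMatrix m) : (A + B).map star = A.map star + B.map star := by
  ext i j; simp

theorem map_star_sub (A B : SpinorMatrix m) : (A - B).map star = A.map star - B.map star := by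
  ext i j; simp

theorem map_star_smul (c : ℂ) (A : SpinorMatrix m) : (c • A).map star = star c • A.map star := by
  ext i j; simp

theorem map_star_one : (1 : SpinorMatrix m).map star = 1 := by
  ext i j; by_cases h : i = j <;> simp [Matrix.one_apply, h]

theorem star_ofReal (x : ℝ) : star (x : ℂ) = x := Complex.conj_ofReal x

theorem map_star_sum {ι : Type*} (s : Finset ι) (A : ι → SpinorMatrix m) :
    (∑ k ∈ s, A k).map star = ∑ k ∈ s, (A k).map star := by
  ext i j; simp [Matrix.sum_apply]

theorem chargeConj_prod (l : List (Fin (2 * m))) :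
    Δ.chargeConj * ((l.map Δ.gamma).prod).map star =
      (-1 : ℂ) ^ l.length • ((l.map Δ.gamma).prod * Δ.chargeConj) := by
  induction l with
  | nil => ext i j; simp [Matrix.mul_apply, Matrix.one_apply, apply_ite]
  | cons b l ih =>
    rw [List.map_cons, List.prod_cons, map_star_mul, ← mul_assoc, Δ.chargeConj_gamma, neg_mul,
      mul_assoc, ih, mul_smul_comm, List.length_cons, pow_succ, mul_neg_one, neg_smul, mul_assoc]

/-- The `2m` signs from anticommuting with the factors cancel, and the prefactor is real, so complex
conjugation does not affect it. -/
theorem chargeConj_grading (hm : Even m) :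
    Δ.chargeConj * Δ.grading.map star = Δ.grading * Δ.chargeConj := by
  rw [grading_eq]
  have : ((-(-Complex.I) ^ m) • ((List.finRange (2 * m)).map Δ.gamma).prod).map star =
      (-(-Complex.I) ^ m) • (((List.finRange (2 * m)).map Δ.gamma).prod).map star := by
    ext i j
    rw [Matrix.map_apply, Matrix.smul_apply, smul_eq_mul, star_mul', (neg_I_pow_real hm).1]
    rfl
  rw [this, mul_smul_comm, chargeConj_prod, List.length_finRange, smul_mul_assoc]
  simp

/-- The matrix `(1 + γ)/2 s + (1 - γ)/2 t`. -/
def chiral (s t : ℂ) : SpinorMatrix m :=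
  s • ((1 / 2 : ℂ) • (1 + Δ.grading)) + t • ((1 / 2 : ℂ) • (1 - Δ.grading))

theorem chiral_eq (s t : ℂ) :
    Δ.chiral s t = ((s + t) / 2) • 1 + ((s - t) / 2) • Δ.grading := by
  rw [chiral]; module

theorem chiral_mul (hm : Even m) (s t s' t' : ℂ) :
    Δ.chiral s t * Δ.chiral s' t' = Δ.chiral (s * s') (t * t') := by
  simp only [chiral_eq, add_mul, mul_add, smul_mul_smul_comm, mul_one, one_mul,
    Δ.grading_mul_self hm]
  module

theorem chiral_one : Δ.chiral 1 1 = 1 := by rw [chiral_eq]; norm_num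

theorem chiral_self (s : ℂ) : Δ.chiral s s = s • 1 := by
  rw [chiral_eq]; simp

theorem chiral_conjTranspose (hm : Even m) (s t : ℂ) :
    (Δ.chiral s t)ᴴ = Δ.chiral (star s) (star t) := by
  simp [chiral_eq, Δ.grading_conjTranspose hm, Matrix.conjTranspose_add,
    Matrix.conjTranspose_smul]

/-- A Dirac matrix exchanges the eigenspaces of the grading. This is the matrix form of the twist
`ρ`, and the reason why twisted commutators with `D` are bounded. -/
theorem gamma_chiral (a : Fin (2 * m)) (s t : ℂ) :
    Δ.gamma a * Δ.chiral s t = Δ.chiral t s * Δ.gamma a := by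
  rw [chiral_eq, chiral_eq, mul_add, add_mul, mul_smul_comm, mul_smul_comm, gamma_grading,
    smul_mul_assoc, smul_mul_assoc, mul_one, one_mul]
  module

theorem chargeConj_chiral (hm : Even m) (s t : ℂ) :
    Δ.chargeConj * (Δ.chiral s t).map star = Δ.chiral (star s) (star t) * Δ.chargeConj := by
  have : (Δ.chiral s t).map star =
      (star ((s + t) / 2)) • (1 : SpinorMatrix m) + (star ((s - t) / 2)) • Δ.grading.map star := by
    rw [chiral_eq, map_star_add, map_star_smul, map_star_smul, map_star_one]
  rw [this, mul_add, mul_smul_comm, mul_smul_comm, Δ.chargeConj_grading hm, chiral_eq]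
  simp [add_mul]

theorem chiral_eq_zero [NeZero m] (hm : Even m) {s t : ℂ} (h : Δ.chiral s t = 0) :
    s = 0 ∧ t = 0 := by
  have h1 : Δ.chiral t s = 0 := by
    have h2 := Δ.gamma_chiral 0 s t
    rw [h, mul_zero] at h2
    rw [← mul_one (Δ.chiral t s), ← Δ.gamma_mul_self 0, ← mul_assoc, ← h2, zero_mul]
  have h2 : s + t = 0 := by
    have h3 : Δ.chiral s t + Δ.chiral t s = (s + t) • 1 := by
      rw [chiral_eq, chiral_eq]; module
    rw [h, h1, add_zero] at h3
    have := congrFun (congrFun h3 0) 0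
    simpa using this.symm
  have h4 : s - t = 0 := by
    rw [chiral_eq, h2, zero_div, zero_smul, zero_add] at h
    have h3 := congrArg (fun X => X * Δ.grading) h
    simp only [smul_mul_assoc, Δ.grading_mul_self hm, zero_mul] at h3
    have := congrFun (congrFun h3 0) 0
    simpa using this
  constructor
  · linear_combination (h4 + h2) / 2
  · linear_combination (h2 - h4) / 2

/-! ### The spin group -/

theorem clifford_conjTranspose (v : Coord m) : (Δ.clifford v)ᴴ = Δ.clifford v := by
  simp [clifford, Matrix.conjTranspose_sum, Matrix.conjTranspose_smul, gamma_conjTranspose]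

/-- Symmetrizing the double sum leaves only the Clifford relations. The coefficients are complex,
hence a sum of `c a ^ 2` without absolute values. -/
theorem sum_smul_gamma_sq (c : Fin (2 * m) → ℂ) :
    (∑ a, c a • Δ.gamma a) * ∑ a, c a • Δ.gamma a = (∑ a, c a ^ 2) • 1 := by
  have h1 : (2 : ℂ) • ((∑ a, c a • Δ.gamma a) * ∑ a, c a • Δ.gamma a) =
      (2 : ℂ) • ((∑ a, c a ^ 2) • 1) := by
    calc _ = ∑ a, ∑ b, (c a * c b) • (Δ.gamma a * Δ.gamma b) +
          ∑ b, ∑ a, (c a * c b) • (Δ.gamma a * Δ.gamma b) := by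
          rw [Finset.sum_comm (γ := Fin (2 * m)) (f := fun b a => (c a * c b) • (Δ.gamma a * Δ.gamma b)),
            two_smul]
          simp only [Finset.sum_mul_sum, smul_mul_smul_comm]
      _ = ∑ a, ∑ b, (c a * c b) • (if a = b then (2 : SpinorMatrix m) else 0) := by
          simp only [← Finset.sum_add_distrib]
          refine Finset.sum_congr rfl fun a _ => Finset.sum_congr rfl fun b _ => ?_
          rw [← Δ.gamma_clifford, smul_add, mul_comm (c b)]
      _ = _ := by
          have h2 : (2 : SpinorMatrix m) = (2 : ℂ) • 1 := by
            rw [ofNat_smul_eq_nsmul, nsmul_one]; rfl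
          simp only [smul_ite, smul_zero, Finset.sum_ite_eq, Finset.mem_univ, if_true, h2,
            smul_smul, ← Finset.sum_smul, Finset.mul_sum]
          congr 1
          exact Finset.sum_congr rfl fun a _ => by ring
  exact smul_right_injective _ (two_ne_zero' ℂ) h1

theorem clifford_sq {v : Coord m} (hv : ‖v‖ = 1) : Δ.clifford v * Δ.clifford v = 1 := by
  rw [clifford, sum_smul_gamma_sq]
  have : ∑ a, (v a) ^ 2 = 1 := by
    rw [← EuclideanSpace.real_norm_sq_eq, hv, one_pow]
  have h2 : ∑ a, (v a : ℂ) ^ 2 = 1 := by exact_mod_cast this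
  rw [h2, one_smul]

theorem clifford_grading (v : Coord m) :
    Δ.clifford v * Δ.grading = -(Δ.grading * Δ.clifford v) := by
  simp [clifford, Finset.sum_mul, Finset.mul_sum, gamma_grading]

theorem chargeConj_clifford (v : Coord m) :
    Δ.chargeConj * (Δ.clifford v).map star = -(Δ.clifford v * Δ.chargeConj) := by
  simp only [clifford, map_star_sum, map_star_smul, Finset.sum_mul, Finset.mul_sum,
    mul_smul_comm, chargeConj_gamma, smul_mul_assoc, star_ofReal, smul_neg, Finset.sum_neg_distrib]

variable {Δ} in
theorem spin_induction {P : SpinorMatrix m → Prop} (h1 : P 1)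
    (h2 : ∀ v w : Coord m, ‖v‖ = 1 → ‖w‖ = 1 → P (Δ.clifford v * Δ.clifford w))
    (h3 : ∀ A B, P A → P B → P (A * B)) {L : SpinorMatrix m} (hL : L ∈ Δ.spinMatrices) : P L := by
  induction hL using Submonoid.closure_induction with
  | mem L hL => obtain ⟨v, w, hv, hw, rfl⟩ := hL; exact h2 v w hv hw
  | one => exact h1
  | mul A B _ _ hA hB => exact h3 A B hA hB

variable {Δ} in
theorem spin_conjTranspose_mul {L : SpinorMatrix m} (hL : L ∈ Δ.spinMatrices) : Lᴴ * L = 1 := by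
  refine spin_induction (P := fun L => Lᴴ * L = 1) (by simp) ?_ ?_ hL
  · intro v w hv hw
    rw [Matrix.conjTranspose_mul, clifford_conjTranspose, clifford_conjTranspose, mul_assoc,
      ← mul_assoc (Δ.clifford v), clifford_sq Δ hv, one_mul, clifford_sq Δ hw]
  · intro A B hA hB
    rw [Matrix.conjTranspose_mul, mul_assoc, ← mul_assoc Aᴴ, hA, one_mul, hB]

variable {Δ} in
theorem spin_grading {L : SpinorMatrix m} (hL : L ∈ Δ.spinMatrices) :
    L * Δ.grading = Δ.grading * L := by
  refine spin_induction (P := fun L => L * Δ.grading = Δ.grading * L) (by simp) ?_ ?_ hL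
  · intro v w hv hw
    rw [mul_assoc, clifford_grading, mul_neg, ← mul_assoc, clifford_grading, neg_mul, neg_neg,
      mul_assoc]
  · intro A B hA hB
    rw [mul_assoc, hB, ← mul_assoc, hA, mul_assoc]

variable {Δ} in
-- Each vector contributes a sign, and spin matrices are products of an even number of vectors.
theorem spin_chargeConj {L : SpinorMatrix m} (hL : L ∈ Δ.spinMatrices) :
    Δ.chargeConj * L.map star = L * Δ.chargeConj := by
  refine spin_induction (P := fun L => Δ.chargeConj * L.map star = L * Δ.chargeConj)
    (by ext i j; simp [Matrix.mul_apply, Matrix.one_apply, apply_ite]) ?_ ?_ hL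
  · intro v w hv hw
    rw [map_star_mul, ← mul_assoc, chargeConj_clifford, neg_mul, mul_assoc, chargeConj_clifford,
      mul_neg, neg_neg, mul_assoc]
  · intro A B hA hB
    rw [map_star_mul, ← mul_assoc, hA, mul_assoc, hB, mul_assoc]

variable {Δ} in
theorem spin_chiral {L : SpinorMatrix m} (hL : L ∈ Δ.spinMatrices) (s t : ℂ) :
    L * Δ.chiral s t = Δ.chiral s t * L := by
  simp [chiral_eq, mul_add, add_mul, spin_grading hL]

/-! ### The Lie algebra of the spin group -/

/-- The element `(1/4) ∑ Γ_{bc} γ^b γ^c` of the spin Lie algebra. -/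
def spinGen (G : Fin (2 * m) → Fin (2 * m) → ℝ) : SpinorMatrix m :=
  (1 / 4 : ℂ) • ∑ b, ∑ c, (G b c : ℂ) • (Δ.gamma b * Δ.gamma c)

variable {G : Fin (2 * m) → Fin (2 * m) → ℝ}

/-- The adjoint action of the generator on vectors is the infinitesimal rotation of coefficients
`G`. This makes the spin connection compatible with Clifford multiplication. -/
theorem spinGen_comm_gamma (hG : ∀ b c, G b c = -G c b) (d : Fin (2 * m)) :
    Δ.spinGen G * Δ.gamma d - Δ.gamma d * Δ.spinGen G = -∑ c, (G d c : ℂ) • Δ.gamma c := by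
  have h2 : (2 : SpinorMatrix m) = (2 : ℂ) • 1 := by
    rw [ofNat_smul_eq_nsmul, nsmul_one]; rfl
  have h1 : ∀ b c, Δ.gamma b * Δ.gamma c * Δ.gamma d - Δ.gamma d * (Δ.gamma b * Δ.gamma c) =
      (if c = d then (2 : ℂ) • Δ.gamma b else 0) - (if b = d then (2 : ℂ) • Δ.gamma c else 0) := by
    intro b c
    have e1 := congrArg (fun X => Δ.gamma b * X) (Δ.gamma_clifford c d)
    have e2 := congrArg (fun X => X * Δ.gamma c) (Δ.gamma_clifford b d)
    simp only [mul_add, add_mul, mul_ite, ite_mul, h2, mul_smul_comm, smul_mul_assoc, mul_one,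
      one_mul, mul_zero, zero_mul] at e1 e2
    rw [← e1, ← e2]
    noncomm_ring
  rw [spinGen, smul_mul_assoc, mul_smul_comm, ← smul_sub, Finset.sum_mul, Finset.mul_sum,
    ← Finset.sum_sub_distrib]
  simp only [Finset.sum_mul, Finset.mul_sum, ← Finset.sum_sub_distrib, smul_mul_assoc,
    mul_smul_comm, ← smul_sub, h1]
  simp only [smul_sub, Finset.sum_sub_distrib, smul_ite, smul_zero, Finset.sum_ite_eq',
    Finset.mem_univ, if_true]
  rw [Finset.sum_comm (γ := Fin (2 * m)) (f := fun b c => if b = d then _ else _)]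
  simp only [Finset.sum_ite_eq', Finset.mem_univ, if_true]
  rw [← smul_sub, ← Finset.sum_sub_distrib, Finset.smul_sum, ← Finset.sum_neg_distrib]
  refine Finset.sum_congr rfl fun c _ => ?_
  rw [hG c d]
  push_cast
  module

theorem spinGen_conjTranspose (hG : ∀ b c, G b c = -G c b) :
    (Δ.spinGen G)ᴴ = -Δ.spinGen G := by
  rw [spinGen, Matrix.conjTranspose_smul, Matrix.conjTranspose_sum, ← smul_neg,
    ← Finset.sum_neg_distrib]
  simp only [Matrix.conjTranspose_sum, Matrix.conjTranspose_smul, Matrix.conjTranspose_mul,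
    gamma_conjTranspose, ← Finset.sum_neg_distrib]
  congr 1
  · simp
  rw [Finset.sum_comm]
  refine Finset.sum_congr rfl fun b _ => Finset.sum_congr rfl fun c _ => ?_
  rw [hG c b]
  simp

theorem spinGen_chargeConj :
    Δ.chargeConj * (Δ.spinGen G).map star = Δ.spinGen G * Δ.chargeConj := by
  have h1 : (Δ.spinGen G).map star =
      (1 / 4 : ℂ) • ∑ b, ∑ c, (G b c : ℂ) • ((Δ.gamma b * Δ.gamma c).map star) := by
    simp only [spinGen, map_star_sum, map_star_smul, star_ofReal]
    congr 1
    simp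
  have h2 : ∀ b c, Δ.chargeConj * ((Δ.gamma b * Δ.gamma c).map star) =
      Δ.gamma b * Δ.gamma c * Δ.chargeConj := by
    intro b c
    rw [map_star_mul, ← mul_assoc, chargeConj_gamma, neg_mul, mul_assoc, chargeConj_gamma, mul_neg,
      neg_neg, mul_assoc]
  rw [h1, spinGen]
  simp only [mul_smul_comm, Finset.mul_sum, h2, smul_mul_assoc, Finset.sum_mul]

theorem spinGen_grading : Δ.spinGen G * Δ.grading = Δ.grading * Δ.spinGen G := by
  have h2 : ∀ b c, Δ.gamma b * Δ.gamma c * Δ.grading = Δ.grading * (Δ.gamma b * Δ.gamma c) := by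
    intro b c
    rw [mul_assoc, gamma_grading, mul_neg, ← mul_assoc, gamma_grading, neg_mul, neg_neg, mul_assoc]
  rw [spinGen]
  simp only [mul_smul_comm, Finset.mul_sum, h2, smul_mul_assoc, Finset.sum_mul]

theorem spinGen_chiral (s t : ℂ) : Δ.spinGen G * Δ.chiral s t = Δ.chiral s t * Δ.spinGen G := by
  simp [chiral_eq, mul_add, add_mul, spinGen_grading]

/-- The change of the spin connection under a change of frame. -/
theorem spinGen_gauge {L L' : SpinorMatrix m} {R R' Gi Gj : Fin (2 * m) → Fin (2 * m) → ℝ}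
    (hGi : ∀ b c, Gi b c = -Gi c b) (hGj : ∀ b c, Gj b c = -Gj c b)
    (hL : Lᴴ * L = 1) (hL' : L'ᴴ * L + Lᴴ * L' = 0)
    (hC : Δ.chargeConj * L.map star = L * Δ.chargeConj)
    (hC' : Δ.chargeConj * L'.map star = L' * Δ.chargeConj)
    (hR : ∀ b, L * Δ.gamma b = (∑ c, (R c b : ℂ) • Δ.gamma c) * L)
    (hR' : ∀ b, L' * Δ.gamma b = (∑ c, (R' c b : ℂ) • Δ.gamma c) * L +
      (∑ c, (R c b : ℂ) • Δ.gamma c) * L')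
    (hG : ∀ b d, R' d b + ∑ c, R c b * Gi c d = ∑ c, R d c * Gj b c) :
    L' - Δ.spinGen Gi * L = -(L * Δ.spinGen Gj) := by
  have hL2 : L * Lᴴ = 1 := mul_eq_one_comm.1 hL
  -- `Z` is the defect of the gauge formula. It intertwines the Dirac matrices in the same way as
  -- `L`, so `Lᴴ * Z` commutes with all of them. It is also skew and compatible with the charge
  -- conjugation, hence zero.
  set Z : SpinorMatrix m := L' - Δ.spinGen Gi * L + L * Δ.spinGen Gj with hZ
  have hZγ : ∀ b, Z * Δ.gamma b = (∑ c, (R c b : ℂ) • Δ.gamma c) * Z := by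
    intro b
    have e1 : Δ.spinGen Gi * (∑ c, (R c b : ℂ) • Δ.gamma c) =
        (∑ c, (R c b : ℂ) • Δ.gamma c) * Δ.spinGen Gi -
          ∑ d, ((∑ c, R c b * Gi c d : ℝ) : ℂ) • Δ.gamma d := by
      have : ∀ c, Δ.spinGen Gi * Δ.gamma c = Δ.gamma c * Δ.spinGen Gi +
          -∑ d, (Gi c d : ℂ) • Δ.gamma d := fun c => by
        rw [← Δ.spinGen_comm_gamma hGi]; abel
      simp only [Finset.mul_sum, mul_smul_comm, this, Finset.sum_mul, smul_add,
        Finset.sum_add_distrib, smul_mul_assoc, smul_neg, Finset.smul_sum, smul_smul,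
        Finset.sum_neg_distrib]
      rw [Finset.sum_comm, sub_eq_add_neg]
      simp [Finset.sum_smul]
    have e2 : L * (∑ d, (Gj b d : ℂ) • Δ.gamma d) =
        (∑ d, ((∑ c, R d c * Gj b c : ℝ) : ℂ) • Δ.gamma d) * L := by
      simp only [Finset.mul_sum, mul_smul_comm, hR]
      simp only [← smul_mul_assoc, ← Finset.sum_mul, Finset.smul_sum, smul_smul]
      rw [Finset.sum_comm]
      congr 1
      refine Finset.sum_congr rfl fun d _ => ?_
      rw [← Finset.sum_smul]
      congr 1
      push_cast
      exact Finset.sum_congr rfl fun _ _ => mul_comm _ _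
    have e3 : Δ.spinGen Gj * Δ.gamma b = Δ.gamma b * Δ.spinGen Gj +
        -∑ d, (Gj b d : ℂ) • Δ.gamma d := by
      rw [← Δ.spinGen_comm_gamma hGj]; abel
    have e4 : ∑ d, ((∑ c, R d c * Gj b c : ℝ) : ℂ) • Δ.gamma d =
        (∑ c, (R' c b : ℂ) • Δ.gamma c) + ∑ d, ((∑ c, R c b * Gi c d : ℝ) : ℂ) • Δ.gamma d := by
      rw [← Finset.sum_add_distrib]
      refine Finset.sum_congr rfl fun d _ => ?_
      rw [← hG b d, ← add_smul]
      push_cast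
      rfl
    have e5 : Z * Δ.gamma b = L' * Δ.gamma b - Δ.spinGen Gi * (L * Δ.gamma b) +
        L * (Δ.spinGen Gj * Δ.gamma b) := by rw [hZ]; noncomm_ring
    rw [e5, hR', hR, e3, ← mul_assoc (Δ.spinGen Gi), e1, mul_add, mul_neg, e2, e4,
      ← mul_assoc L, hR, hZ]
    noncomm_ring
  have hRs : ∀ b, Lᴴ * (∑ c, (R c b : ℂ) • Δ.gamma c) = Δ.gamma b * Lᴴ := by
    intro b
    have := congrArg (fun X => Lᴴ * X * Lᴴ) (hR b)
    rw [← mul_assoc, hL, one_mul, mul_assoc, mul_assoc, hL2, mul_one] at this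
    exact this.symm
  have hX : Lᴴ * Z = 0 := by
    refine Δ.eq_zero_of_commute (fun a => ?_) ?_ ?_
    · rw [mul_assoc, hZγ, ← mul_assoc, hRs, mul_assoc]
    · have e1 : Lᴴ * Z = Lᴴ * L' - Lᴴ * Δ.spinGen Gi * L + Δ.spinGen Gj := by
        rw [hZ, mul_add, mul_sub, ← mul_assoc, ← mul_assoc, hL, one_mul]
      rw [e1]
      simp only [Matrix.conjTranspose_add, Matrix.conjTranspose_sub, Matrix.conjTranspose_mul,
        Matrix.conjTranspose_conjTranspose, Δ.spinGen_conjTranspose hGi,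
        Δ.spinGen_conjTranspose hGj]
      rw [eq_neg_of_add_eq_zero_left hL']
      noncomm_ring
    · have hCs : Δ.chargeConj * (Lᴴ).map star = Lᴴ * Δ.chargeConj := by
        have h1 : L.map star * (Lᴴ).map star = 1 := by
          rw [← map_star_mul, hL2, map_star_one]
        have h2 := congrArg (fun X => Lᴴ * X * (Lᴴ).map star) hC
        rw [mul_assoc, mul_assoc, h1, mul_one, ← mul_assoc, hL, one_mul] at h2
        exact h2.symm
      have hCZ : Δ.chargeConj * Z.map star = Z * Δ.chargeConj := by
        have h3 : Z.map star = L'.map star - (Δ.spinGen Gi).map star * L.map star +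
            L.map star * (Δ.spinGen Gj).map star := by
          rw [← map_star_mul, ← map_star_mul, ← map_star_sub, ← map_star_add]
        rw [h3, mul_add, mul_sub, hC', ← mul_assoc, Δ.spinGen_chargeConj, mul_assoc, hC,
          ← mul_assoc Δ.chargeConj, hC, mul_assoc L, Δ.spinGen_chargeConj, hZ]
        noncomm_ring
      rw [map_star_mul, ← mul_assoc, hCs, mul_assoc, hCZ, mul_assoc]
  have hZ0 : Z = 0 := by rw [← one_mul Z, ← hL2, mul_assoc, hX, mul_zero]
  rw [hZ] at hZ0
  exact eq_neg_of_add_eq_zero_left hZ0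

end DiracMatrices
end TwistedDirac
end

noncomputable section

namespace TwistedDirac

/-! ### Frames on open subsets of the coordinate space -/

section Frames

variable {m : ℕ}

/-- The matrix whose rows are the components of the vectors of a frame. -/
def frameMat (E : Fin (2 * m) → Coord m → Coord m) (y : Coord m) :
    Matrix (Fin (2 * m)) (Fin (2 * m)) ℝ := Matrix.of fun a μ => E a y μ

/-- The coefficients of a vector in a frame. -/
def frameCoeff (E : Fin (2 * m) → Coord m → Coord m) (y v : Coord m) : Fin (2 * m) → ℝ :=
  (v : Fin (2 * m) → ℝ) ᵥ* (frameMat E y)⁻¹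

/-- The structure functions of a frame. -/
def frameBracket (E : Fin (2 * m) → Coord m → Coord m) (a b c : Fin (2 * m)) (y : Coord m) : ℝ :=
  frameCoeff E y (VectorField.lieBracket ℝ (E a) (E b) y) c

/-- The Levi-Civita coefficients of a frame declared to be orthonormal. -/
def frameGamma (E : Fin (2 * m) → Coord m → Coord m) (a b c : Fin (2 * m)) (y : Coord m) : ℝ :=
  (1 / 2) * (frameBracket E a b c y - frameBracket E b c a y + frameBracket E c a b y)

/-- The volume density of a frame declared to be orthonormal. -/
def frameDensity (E : Fin (2 * m) → Coord m → Coord m) (y : Coord m) : ℝ :=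
  |(frameMat E y).det|⁻¹

structure IsFrameOn (E : Fin (2 * m) → Coord m → Coord m) (U : Set (Coord m)) : Prop where
  isOpen : IsOpen U
  smooth : ∀ a, ContDiffOn ℝ ∞ (E a) U
  det_ne : ∀ y ∈ U, (frameMat E y).det ≠ 0

variable {E : Fin (2 * m) → Coord m → Coord m} {y : Coord m}

theorem sum_frameCoeff (h : (frameMat E y).det ≠ 0) (v : Coord m) :
    ∑ a, frameCoeff E y v a • E a y = v := by
  have h1 : frameCoeff E y v ᵥ* frameMat E y = v := by
    rw [frameCoeff, Matrix.vecMul_vecMul, Matrix.nonsing_inv_mul _ (isUnit_iff_ne_zero.2 h),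
      Matrix.vecMul_one]
  ext μ
  rw [← congrFun h1 μ]
  simp [Matrix.vecMul, dotProduct, frameMat]

theorem frameCoeff_sum (h : (frameMat E y).det ≠ 0) (c : Fin (2 * m) → ℝ) :
    frameCoeff E y (∑ a, c a • E a y) = c := by
  have h1 : ((∑ a, c a • E a y : Coord m) : Fin (2 * m) → ℝ) = c ᵥ* frameMat E y := by
    ext μ
    simp [Matrix.vecMul, dotProduct, frameMat]
  rw [frameCoeff, h1, Matrix.vecMul_vecMul, Matrix.mul_nonsing_inv _ (isUnit_iff_ne_zero.2 h),
    Matrix.vecMul_one]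

theorem frameCoeff_smul (c : ℝ) (v : Coord m) :
    frameCoeff E y (c • v) = c • frameCoeff E y v :=
  Matrix.smul_vecMul _ _ _

theorem frameCoeff_sub (v w : Coord m) :
    frameCoeff E y (v - w) = frameCoeff E y v - frameCoeff E y w :=
  Matrix.sub_vecMul _ _ _

theorem frameBracket_swap (a b c : Fin (2 * m)) :
    frameBracket E a b c y = -frameBracket E b a c y := by
  have : VectorField.lieBracket ℝ (E a) (E b) y = (-1 : ℝ) • VectorField.lieBracket ℝ (E b) (E a) y := by
    rw [VectorField.lieBracket_swap]; simp
  rw [frameBracket, this, frameCoeff_smul]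
  simp [frameBracket]

theorem frameGamma_antisymm (a b c : Fin (2 * m)) :
    frameGamma E a b c y = -frameGamma E a c b y := by
  rw [frameGamma, frameGamma, frameBracket_swap c b a, frameBracket_swap b a c,
    frameBracket_swap c a b]
  ring

theorem frameGamma_torsion (a b c : Fin (2 * m)) :
    frameGamma E a b c y - frameGamma E b a c y = frameBracket E a b c y := by
  rw [frameGamma, frameGamma, frameBracket_swap c b a, frameBracket_swap b a c,
    frameBracket_swap a c b]
  ring

/-- The sum over `a` of the left side is the trace left over when the connection form is commuted
past the Dirac matrices. The right side identifies it with a divergence of the frame, so that the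
two cancel in the integration by parts. -/
theorem frameGamma_diag (a c : Fin (2 * m)) :
    frameGamma E a a c y = frameBracket E c a a y := by
  have h : frameBracket E a a c y = 0 := by
    have := frameBracket_swap (E := E) (y := y) a a c
    linarith
  rw [frameGamma, frameBracket_swap a c a, h]
  ring

/-- The algebra behind the uniqueness of the Levi-Civita connection: alternating the two symmetries
around the three indices returns to the start with the opposite sign. -/
theorem eq_zero_of_symm_of_antisymm {ι : Type*} {T : ι → ι → ι → ℝ} (h1 : ∀ a b c, T a b c = T b a c)
    (h2 : ∀ a b c, T a b c = -T a c b) (a b c : ι) : T a b c = 0 := by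
  have := h1 a b c
  have := h2 b a c
  have := h1 b c a
  have := h2 c b a
  have := h1 c a b
  have := h2 a c b
  linarith

/-- The change of the Levi-Civita coefficients under a rotation of the frame. -/
theorem frameGamma_gauge {U : Set (Coord m)} {E E' : Fin (2 * m) → Coord m → Coord m}
    {R : Fin (2 * m) → Fin (2 * m) → Coord m → ℝ} (hE : IsFrameOn E U) (hE' : IsFrameOn E' U)
    (hR : ∀ b a, DifferentiableOn ℝ (R b a) U)
    (hER : ∀ y ∈ U, ∀ a, E' a y = ∑ b, R b a y • E b y)
    (hO : ∀ y ∈ U, ∀ a c, ∑ b, R b a y * R b c y = if a = c then 1 else 0)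
    (hy : y ∈ U) (a b d : Fin (2 * m)) :
    fderiv ℝ (R d b) y (E' a y) + ∑ c, R c b y * ∑ e, R e a y * frameGamma E e c d y =
      ∑ c, R d c y * frameGamma E' a b c y := by
  have hU : U ∈ nhds y := hE.isOpen.mem_nhds hy
  have hRy : ∀ b a, DifferentiableAt ℝ (R b a) y := fun b a => (hR b a).differentiableAt hU
  have hEy : ∀ a, DifferentiableAt ℝ (E a) y := fun a =>
    ((hE.smooth a).differentiableOn (by simp)).differentiableAt hU
  have hO' : ∀ a c, ∑ b, R a b y * R c b y = if a = c then 1 else 0 := by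
    set Q : Matrix (Fin (2 * m)) (Fin (2 * m)) ℝ := Matrix.of fun b a => R b a y with hQ
    have h1 : Qᵀ * Q = 1 := by
      ext a c
      rw [Matrix.mul_apply, Matrix.one_apply, ← hO y hy a c]
      rfl
    have h2 : Q * Qᵀ = 1 := mul_eq_one_comm.1 h1
    intro a c
    have := congrFun (congrFun h2 a) c
    rw [Matrix.mul_apply, Matrix.one_apply] at this
    exact this
  set R' : Fin (2 * m) → Fin (2 * m) → Fin (2 * m) → ℝ :=
    fun a d b => fderiv ℝ (R d b) y (E' a y) with hR'
  -- These are the coefficients, in the frame `E'`, of the connection with coefficients `frameGamma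
  -- E` in the frame `E`. `hanti` says that it is metric and `htor` that it is torsion-free, so by
  -- uniqueness it has the coefficients `frameGamma E'`.
  set Gt : Fin (2 * m) → Fin (2 * m) → Fin (2 * m) → ℝ := fun a b c =>
    ∑ d, R d c y * (R' a d b + ∑ e, R e b y * ∑ f, R f a y * frameGamma E f e d y) with hGt
  have hO'' : ∀ a b c, ∑ d, (R d c y * R' a d b + R d b y * R' a d c) = 0 := by
    intro a b c
    have h1 : (fun z => ∑ d, R d c z * R d b z) =ᶠ[nhds y] fun _ => if c = b then 1 else 0 := by
      filter_upwards [hU] with z hz using hO z hz c b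
    have h2 := h1.fderiv_eq (𝕜 := ℝ)
    rw [fderiv_fun_sum (A := fun d z => R d c z * R d b z)
      fun d _ => (hRy d c).mul (hRy d b)] at h2
    have h3 := congrArg (fun L => L (E' a y)) h2
    simp only [_root_.sum_apply, fderiv_fun_const, Pi.zero_apply] at h3
    refine Eq.trans ?_ (h3.trans rfl)
    refine Finset.sum_congr rfl fun d _ => ?_
    rw [fderiv_fun_mul (hRy d c) (hRy d b)]
    simp [hR']
  have hanti : ∀ a b c, Gt a b c = -Gt a c b := by
    intro a b c
    rw [eq_neg_iff_add_eq_zero]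
    simp only [hGt, mul_add, Finset.sum_add_distrib]
    have h1 := hO'' a b c
    rw [Finset.sum_add_distrib] at h1
    have h2 : ∑ d, R d c y * ∑ e, R e b y * ∑ f, R f a y * frameGamma E f e d y =
        -∑ d, R d b y * ∑ e, R e c y * ∑ f, R f a y * frameGamma E f e d y := by
      simp only [Finset.mul_sum, ← Finset.sum_neg_distrib]
      rw [Finset.sum_comm]
      refine Finset.sum_congr rfl fun d _ => Finset.sum_congr rfl fun e _ =>
        Finset.sum_congr rfl fun f _ => ?_
      rw [frameGamma_antisymm f d e]
      ring
    rw [h2]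
    linarith
  have hcoeff : ∀ v c, frameCoeff E' y v c = ∑ d, R d c y * frameCoeff E y v d := by
    intro v c
    have h1 : ∀ b, E b y = ∑ c, R b c y • E' c y := by
      intro b
      simp only [hER y hy, Finset.smul_sum, smul_smul]
      rw [Finset.sum_comm]
      simp only [← Finset.sum_smul, hO', ite_smul, one_smul, zero_smul, Finset.sum_ite_eq,
        Finset.mem_univ, if_true]
    have h2 : v = ∑ c, (∑ d, R d c y * frameCoeff E y v d) • E' c y := by
      conv_lhs => rw [← sum_frameCoeff (hE.det_ne y hy) v]
      simp only [h1, Finset.smul_sum, smul_smul, Finset.sum_smul]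
      rw [Finset.sum_comm]
      simp only [mul_comm]
    conv_lhs => rw [h2]
    rw [frameCoeff_sum (hE'.det_ne y hy)]
  have hbr : ∀ a b, VectorField.lieBracket ℝ (E' a) (E' b) y =
      ∑ d, (R' a d b - R' b d a + ∑ e, ∑ f, R e b y * R f a y * frameBracket E f e d y) • E d y := by
    have hd : ∀ b v, fderiv ℝ (E' b) y v =
        ∑ d, (R d b y • fderiv ℝ (E d) y v + fderiv ℝ (R d b) y v • E d y) := by
      intro b v
      have h1 : E' b =ᶠ[nhds y] fun z => ∑ d, R d b z • E d z := by
        filter_upwards [hU] with z hz using hER z hz b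
      rw [h1.fderiv_eq (𝕜 := ℝ), fderiv_fun_sum (A := fun d z => R d b z • E d z)
        fun d _ => (hRy d b).smul (hEy d), _root_.sum_apply]
      refine Finset.sum_congr rfl fun d _ => ?_
      rw [fderiv_fun_smul (hRy d b) (hEy d)]
      simp
    intro a b
    have h2 : ∀ e f, ∑ d, frameBracket E f e d y • E d y =
        fderiv ℝ (E e) y (E f y) - fderiv ℝ (E f) y (E e y) := fun e f =>
      sum_frameCoeff (hE.det_ne y hy) _
    have h3 : ∀ a b, ∑ d, R d b y • fderiv ℝ (E d) y (E' a y) =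
        ∑ e, ∑ f, (R e b y * R f a y) • fderiv ℝ (E e) y (E f y) := by
      intro a b
      simp only [hER y hy a, map_sum, map_smul, Finset.smul_sum, smul_smul]
    have h4 : ∑ d, (∑ e, ∑ f, R e b y * R f a y * frameBracket E f e d y) • E d y =
        ∑ e, ∑ f, (R e b y * R f a y) • (fderiv ℝ (E e) y (E f y) - fderiv ℝ (E f) y (E e y)) := by
      simp only [← h2, Finset.smul_sum, smul_smul, Finset.sum_smul]
      rw [Finset.sum_comm]
      refine Finset.sum_congr rfl fun e _ => ?_
      rw [Finset.sum_comm]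
    have h5 : ∑ e, ∑ f, (R e a y * R f b y) • fderiv ℝ (E e) y (E f y) =
        ∑ e, ∑ f, (R e b y * R f a y) • fderiv ℝ (E f) y (E e y) := by
      rw [Finset.sum_comm]
      exact Finset.sum_congr rfl fun _ _ => Finset.sum_congr rfl fun _ _ =>
        by rw [mul_comm (R _ _ y) (R _ _ y)]
    rw [VectorField.lieBracket_eq]
    simp only [add_smul, sub_smul, Finset.sum_add_distrib, Finset.sum_sub_distrib, h4, smul_sub]
    rw [hd, hd, Finset.sum_add_distrib, Finset.sum_add_distrib, h3, h3, h5]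
    abel
  have htor : ∀ a b c, Gt a b c - Gt b a c = frameBracket E' a b c y := by
    intro a b c
    rw [frameBracket, hcoeff, hbr, frameCoeff_sum (hE.det_ne y hy)]
    simp only [hGt, ← Finset.sum_sub_distrib, ← mul_sub]
    refine Finset.sum_congr rfl fun d _ => ?_
    congr 1
    have h1 : ∑ e, R e a y * ∑ f, R f b y * frameGamma E f e d y =
        ∑ e, R e b y * ∑ f, R f a y * frameGamma E e f d y := by
      simp only [Finset.mul_sum]
      rw [Finset.sum_comm]
      exact Finset.sum_congr rfl fun _ _ => Finset.sum_congr rfl fun _ _ => by ring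
    have h2 : ∑ e, ∑ f, R e b y * R f a y * frameBracket E f e d y =
        ∑ e, R e b y * ∑ f, R f a y * frameGamma E f e d y -
          ∑ e, R e b y * ∑ f, R f a y * frameGamma E e f d y := by
      simp only [← frameGamma_torsion, Finset.mul_sum, ← Finset.sum_sub_distrib]
      exact Finset.sum_congr rfl fun _ _ => Finset.sum_congr rfl fun _ _ => by ring
    rw [h1, h2]
    ring
  have hT : ∀ a b c, frameGamma E' a b c y - Gt a b c = 0 := by
    refine eq_zero_of_symm_of_antisymm ?_ ?_
    · intro a b c
      have := htor a b c
      have := frameGamma_torsion (E := E') (y := y) a b c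
      linarith
    · intro a b c
      have := hanti a b c
      have := frameGamma_antisymm (E := E') (y := y) a b c
      linarith
  have hfin : ∀ c, frameGamma E' a b c y = Gt a b c := fun c => sub_eq_zero.1 (hT a b c)
  have hinv : ∀ X : Fin (2 * m) → ℝ, ∑ c, R d c y * ∑ e, R e c y * X e = X d := by
    intro X
    simp only [Finset.mul_sum]
    rw [Finset.sum_comm]
    simp only [← mul_assoc, ← Finset.sum_mul, hO', ite_mul, one_mul, zero_mul, Finset.sum_ite_eq,
      Finset.mem_univ, if_true]
  simp only [hfin, hGt]
  rw [hinv]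

/-! ### The divergence of a frame -/

/-- Jacobi's formula for the determinant of a matrix depending on a parameter. -/
theorem hasFDerivAt_det {ι F : Type*} [Fintype ι] [DecidableEq ι] [NormedAddCommGroup F]
    [NormedSpace ℝ F] {N : F → ι → ι → ℝ} {N' : F →L[ℝ] (ι → ι → ℝ)} {y : F}
    (hN : HasFDerivAt N N' y) :
    ∃ d' : F →L[ℝ] ℝ, HasFDerivAt (fun z => (Matrix.of (N z)).det) d' y ∧
      ∀ v, d' v = ∑ a, ((Matrix.of (N y)).updateRow a (N' v a)).det := by
  let D : ContinuousMultilinearMap ℝ (fun _ : ι => ι → ℝ) ℝ :=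
    { (Matrix.detRowAlternating (R := ℝ) (n := ι)).toMultilinearMap with
      cont := by
        change Continuous fun A : Matrix ι ι ℝ => A.det
        exact continuous_id.matrix_det }
  refine ⟨(D.linearDeriv (N y)).comp N', (D.hasFDerivAt (N y)).comp y hN, fun v => ?_⟩
  rw [ContinuousLinearMap.comp_apply, ContinuousMultilinearMap.linearDeriv_apply]
  rfl

theorem det_updateRow_frame (h : (frameMat E y).det ≠ 0) (a : Fin (2 * m)) (v : Coord m) :
    ((frameMat E y).updateRow a v).det = frameCoeff E y v a * (frameMat E y).det := by
  have h1 : (v : Fin (2 * m) → ℝ) = ∑ k, frameCoeff E y v k • frameMat E y k := by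
    conv_lhs => rw [← sum_frameCoeff h v]
    ext μ
    simp [frameMat]
  conv_lhs => rw [h1]
  rw [Matrix.det_updateRow_sum, smul_eq_mul]

/-- Both sides are the trace of `L`, computed in the frame and in the standard basis. -/
theorem trace_frameCoeff (h : (frameMat E y).det ≠ 0) (L : Coord m →L[ℝ] Coord m) :
    ∑ a, frameCoeff E y (L (E a y)) a = ∑ μ, L (EuclideanSpace.single μ 1) μ := by
  set A : Matrix (Fin (2 * m)) (Fin (2 * m)) ℝ :=
    Matrix.of fun μ ν => L (EuclideanSpace.single μ 1) ν with hA
  have h1 : ∀ v : Coord m, (L v : Fin (2 * m) → ℝ) = (v : Fin (2 * m) → ℝ) ᵥ* A := by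
    intro v
    have hv : v = ∑ μ, v μ • EuclideanSpace.single μ (1 : ℝ) := by
      ext ν
      simp [Pi.single_apply]
    conv_lhs => rw [hv]
    ext ν
    simp [Matrix.vecMul, dotProduct, hA]
  have h2 : ∀ a, frameCoeff E y (L (E a y)) a =
      (frameMat E y * A * (frameMat E y)⁻¹) a a := by
    intro a
    rw [frameCoeff, h1, Matrix.vecMul_vecMul, mul_assoc]
    rfl
  calc _ = (frameMat E y * A * (frameMat E y)⁻¹).trace := Finset.sum_congr rfl fun a _ => h2 a
    _ = A.trace := by
      rw [Matrix.trace_mul_comm, ← mul_assoc, Matrix.nonsing_inv_mul _ (isUnit_iff_ne_zero.2 h),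
        one_mul]
    _ = _ := rfl

namespace IsFrameOn

variable {U : Set (Coord m)}

theorem differentiableAt (hE : IsFrameOn E U) (hy : y ∈ U) (a : Fin (2 * m)) :
    DifferentiableAt ℝ (E a) y :=
  ((hE.smooth a).differentiableOn (by simp)).differentiableAt (hE.isOpen.mem_nhds hy)

theorem contDiffOn_det (hE : IsFrameOn E U) : ContDiffOn ℝ ∞ (fun z => (frameMat E z).det) U := by
  have h : ∀ a μ, ContDiffOn ℝ ∞ (fun z => frameMat E z a μ) U := fun a μ =>
    (contDiffOn_euclidean.1 (hE.smooth a)) μ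
  simp only [Matrix.det_apply]
  refine ContDiffOn.sum fun σ _ => ?_
  exact (contDiffOn_prod fun a _ => h _ _).const_smul _

theorem density_pos (hE : IsFrameOn E U) (hy : y ∈ U) : 0 < frameDensity E y :=
  inv_pos.2 (abs_pos.2 (hE.det_ne y hy))

theorem contDiffOn_density (hE : IsFrameOn E U) : ContDiffOn ℝ ∞ (frameDensity E) U := by
  intro z hz
  have h1 := hE.contDiffOn_det z hz
  exact (h1.abs (hE.det_ne z hz)).inv (abs_pos.2 (hE.det_ne z hz)).ne'

/-- Cramer's rule writes the coefficient as a quotient of determinants, so no smoothness of the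
matrix inverse is needed. -/
theorem contDiffOn_frameCoeff (hE : IsFrameOn E U) {v : Coord m → Coord m}
    (hv : ContDiffOn ℝ ∞ v U) (a : Fin (2 * m)) :
    ContDiffOn ℝ ∞ (fun z => frameCoeff E z (v z) a) U := by
  have h : ∀ a μ, ContDiffOn ℝ ∞ (fun z => frameMat E z a μ) U := fun a μ =>
    (contDiffOn_euclidean.1 (hE.smooth a)) μ
  have h2 : Set.EqOn (fun z => frameCoeff E z (v z) a)
      (fun z => ((frameMat E z).updateRow a (v z)).det * ((frameMat E z).det)⁻¹) U := by
    intro z hz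
    simp only
    rw [det_updateRow_frame (hE.det_ne z hz), mul_inv_cancel_right₀ (hE.det_ne z hz)]
  refine ContDiffOn.congr ?_ h2
  refine ContDiffOn.mul ?_ (hE.contDiffOn_det.inv hE.det_ne)
  simp only [Matrix.det_apply]
  refine ContDiffOn.sum fun σ _ => ?_
  refine (contDiffOn_prod fun b _ => ?_).const_smul _
  by_cases hb : σ b = a
  · simp only [Matrix.updateRow_apply, hb, if_true]
    exact (contDiffOn_euclidean.1 hv) b
  · simp only [Matrix.updateRow_apply, hb, if_false]
    exact h _ _

theorem contDiffOn_bracket (hE : IsFrameOn E U) (a b c : Fin (2 * m)) :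
    ContDiffOn ℝ ∞ (frameBracket E a b c) U := by
  refine hE.contDiffOn_frameCoeff ?_ c
  have h1 : ∀ a b, ContDiffOn ℝ ∞ (fun z => fderiv ℝ (E b) z (E a z)) U := fun a b =>
    ((hE.smooth b).fderiv_of_isOpen hE.isOpen (by simp)).clm_apply (hE.smooth a)
  exact (h1 a b).sub (h1 b a)

theorem contDiffOn_gamma (hE : IsFrameOn E U) (a b c : Fin (2 * m)) :
    ContDiffOn ℝ ∞ (frameGamma E a b c) U :=
  contDiffOn_const.mul (((hE.contDiffOn_bracket a b c).sub (hE.contDiffOn_bracket b c a)).add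
    (hE.contDiffOn_bracket c a b))

/-- By Jacobi's formula the logarithmic derivative of the determinant along `E c` is the sum over
`a` of the `a`-th coefficients of the derivatives of `E a` along `E c`. The Euclidean divergence of
`E c` is the trace of its differential, computed in the frame. Their difference is made of the
brackets `[E c, E a]`. -/
theorem divergence (hE : IsFrameOn E U) (hy : y ∈ U) (c : Fin (2 * m)) :
    ∑ μ, fderiv ℝ (fun z => frameDensity E z * E c z μ) y (EuclideanSpace.single μ 1) =
      -(frameDensity E y * ∑ a, frameBracket E c a a y) := by
  have hne := hE.det_ne y hy
  let P : Coord m →L[ℝ] (Fin (2 * m) → ℝ) := (EuclideanSpace.equiv (Fin (2 * m)) ℝ : _ →L[ℝ] _)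
  have hN : HasFDerivAt (fun z a => P (E a z))
      (ContinuousLinearMap.pi fun a => P.comp (fderiv ℝ (E a) y)) y :=
    hasFDerivAt_pi.2 fun a => P.hasFDerivAt.comp y (hE.differentiableAt hy a).hasFDerivAt
  obtain ⟨d', hd', hd⟩ := hasFDerivAt_det hN
  have hdet : ∀ v, d' v =
      (∑ a, frameCoeff E y (fderiv ℝ (E a) y v) a) * (frameMat E y).det := by
    intro v
    rw [hd, Finset.sum_mul]
    exact Finset.sum_congr rfl fun a _ => det_updateRow_frame hne a _
  have hw : HasFDerivAt (frameDensity E)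
      (-(frameDensity E y * ((frameMat E y).det)⁻¹) • d') y := by
    have h1 : HasDerivAt (fun t : ℝ => |t|⁻¹) (-(|(frameMat E y).det|⁻¹ * ((frameMat E y).det)⁻¹))
        (frameMat E y).det := by
      refine ((hasDerivAt_abs hne).inv (abs_pos.2 hne).ne').congr_deriv ?_
      rcases lt_or_gt_of_ne hne with h | h
      · rw [abs_of_neg h, sign_neg h]
        field_simp
        simp
      · rw [abs_of_pos h, sign_pos h]
        field_simp
        simp
    exact h1.comp_hasFDerivAt (f := fun z => (frameMat E z).det) y hd'
  have hcomp : ∀ μ, fderiv ℝ (fun z => frameDensity E z * E c z μ) y (EuclideanSpace.single μ 1) =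
      frameDensity E y * fderiv ℝ (E c) y (EuclideanSpace.single μ 1) μ -
        (frameDensity E y * ((frameMat E y).det)⁻¹) * (E c y μ * d' (EuclideanSpace.single μ 1)) := by
    intro μ
    have h1 : HasFDerivAt (fun z => E c z μ)
        ((EuclideanSpace.proj μ : Coord m →L[ℝ] ℝ).comp (fderiv ℝ (E c) y)) y :=
      (EuclideanSpace.proj μ : Coord m →L[ℝ] ℝ).hasFDerivAt.comp y
        (hE.differentiableAt hy c).hasFDerivAt
    rw [(hw.fun_mul h1).fderiv]
    simp
    ring
  have hsum : ∑ μ, E c y μ * d' (EuclideanSpace.single μ 1) = d' (E c y) := by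
    have hv : E c y = ∑ μ, E c y μ • EuclideanSpace.single μ (1 : ℝ) := by
      ext ν
      simp [Pi.single_apply]
    conv_rhs => rw [hv]
    simp
  simp only [hcomp, Finset.sum_sub_distrib, ← Finset.mul_sum, hsum]
  rw [hdet, ← trace_frameCoeff hne]
  have hbr : ∀ a, frameBracket E c a a y = frameCoeff E y (fderiv ℝ (E a) y (E c y)) a -
      frameCoeff E y (fderiv ℝ (E c) y (E a y)) a := by
    intro a
    rw [frameBracket, VectorField.lieBracket_eq]
    simp only [frameCoeff_sub, Pi.sub_apply]
  simp only [hbr, Finset.sum_sub_distrib]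
  field_simp
  ring

end IsFrameOn

end Frames

/-! ### Matrices acting on spinors -/

section Act

variable {m : ℕ}

theorem act_apply (A : SpinorMatrix m) (v : Spinor m) (k : Fin (2 ^ m)) :
    act A v k = ∑ l, A k l * v l := rfl

theorem act_mul (A B : SpinorMatrix m) (v : Spinor m) : act (A * B) v = act A (act B v) := by
  rw [act, map_mul]; rfl

theorem act_one (v : Spinor m) : act (1 : SpinorMatrix m) v = v := by
  rw [act, map_one]; rfl

theorem act_add (A B : SpinorMatrix m) (v : Spinor m) : act (A + B) v = act A v + act B v := by
  rw [act, map_add]; rfl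

theorem act_sub (A B : SpinorMatrix m) (v : Spinor m) : act (A - B) v = act A v - act B v := by
  rw [act, map_sub]; rfl

theorem act_neg (A : SpinorMatrix m) (v : Spinor m) : act (-A) v = -act A v := by
  rw [act, map_neg]; rfl

theorem act_zero (v : Spinor m) : act (0 : SpinorMatrix m) v = 0 := by
  rw [act, map_zero]; rfl

theorem act_smul (c : ℂ) (A : SpinorMatrix m) (v : Spinor m) : act (c • A) v = c • act A v := by
  rw [act, map_smul]; rfl

theorem act_sum {ι : Type*} (s : Finset ι) (A : ι → SpinorMatrix m) (v : Spinor m) :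
    act (∑ k ∈ s, A k) v = ∑ k ∈ s, act (A k) v := by
  rw [act, map_sum, _root_.sum_apply]; rfl

theorem act_conjTranspose_eq_adjoint (A : SpinorMatrix m) :
    act Aᴴ = ContinuousLinearMap.adjoint (act A) := by
  rw [act, ← Matrix.star_eq_conjTranspose, map_star]; rfl

theorem inner_act_left (A : SpinorMatrix m) (v w : Spinor m) :
    inner ℂ (act A v) w = inner ℂ v (act Aᴴ w) := by
  rw [act_conjTranspose_eq_adjoint, ContinuousLinearMap.adjoint_inner_right]

theorem inner_act_unitary {A : SpinorMatrix m} (hA : Aᴴ * A = 1) (v w : Spinor m) :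
    inner ℂ (act A v) (act A w) = inner ℂ v w := by
  rw [inner_act_left, ← act_mul, hA, act_one]

theorem norm_act_unitary {A : SpinorMatrix m} (hA : Aᴴ * A = 1) (v : Spinor m) :
    ‖act A v‖ = ‖v‖ := by
  rw [@norm_eq_sqrt_re_inner ℂ, @norm_eq_sqrt_re_inner ℂ, inner_act_unitary hA]

theorem conjSpinor_apply (v : Spinor m) (k : Fin (2 ^ m)) : conjSpinor m v k = star (v k) := rfl

theorem act_conjSpinor (A : SpinorMatrix m) (v : Spinor m) :
    act A (conjSpinor m v) = conjSpinor m (act (A.map star) v) := by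
  ext k
  simp [act_apply, conjSpinor_apply]

theorem contDiffOn_act {F : Type*} [NormedAddCommGroup F] [NormedSpace ℝ F] {n : WithTop ℕ∞}
    {A : F → SpinorMatrix m} {u : F → Spinor m} {U : Set F}
    (hA : ∀ k l, ContDiffOn ℝ n (fun z => A z k l) U) (hu : ContDiffOn ℝ n u U) :
    ContDiffOn ℝ n (fun z => act (A z) (u z)) U := by
  rw [contDiffOn_piLp]
  intro k
  simp only [act_apply]
  exact ContDiffOn.sum fun l _ => (hA k l).mul ((contDiffOn_piLp 2).1 hu l)

theorem continuousOn_act {X : Type*} [TopologicalSpace X]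
    {A : X → SpinorMatrix m} {u : X → Spinor m} {U : Set X}
    (hA : ∀ k l, ContinuousOn (fun z => A z k l) U) (hu : ContinuousOn u U) :
    ContinuousOn (fun z => act (A z) (u z)) U := by
  refine (PiLp.continuous_toLp 2 (fun _ : Fin (2 ^ m) => ℂ)).comp_continuousOn
    (continuousOn_pi.2 fun k => ?_)
  change ContinuousOn (fun z => act (A z) (u z) k) U
  simp only [act_apply]
  exact continuousOn_finsetSum _ fun l _ => (hA k l).mul
    ((PiLp.continuous_apply 2 (fun _ : Fin (2 ^ m) => ℂ) l).comp_continuousOn hu)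

theorem fderiv_act {F : Type*} [NormedAddCommGroup F] [NormedSpace ℝ F]
    {A : F → SpinorMatrix m} {u : F → Spinor m} {y : F}
    (hA : ∀ k l, DifferentiableAt ℝ (fun z => A z k l) y) (hu : DifferentiableAt ℝ u y) (v : F) :
    fderiv ℝ (fun z => act (A z) (u z)) y v =
      act (Matrix.of fun k l => fderiv ℝ (fun z => A z k l) y v) (u y) +
        act (A y) (fderiv ℝ u y v) := by
  let pr : Fin (2 ^ m) → Spinor m →L[ℝ] ℂ := PiLp.proj 2 (fun _ => ℂ)
  have hu' : ∀ l, HasFDerivAt (fun z => u z l) ((pr l).comp (fderiv ℝ u y)) y := fun l =>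
    (pr l).hasFDerivAt.comp y hu.hasFDerivAt
  have h1 : ∀ k, HasFDerivAt (fun z => ∑ l, A z k l * u z l)
      (∑ l, (A y k l • ((pr l).comp (fderiv ℝ u y)) +
        u y l • fderiv ℝ (fun z => A z k l) y)) y := fun k =>
    HasFDerivAt.fun_sum fun l _ => (hA k l).hasFDerivAt.mul (hu' l)
  have h2 : DifferentiableAt ℝ (fun z => act (A z) (u z)) y :=
    (differentiableAt_piLp 2).2 fun k => (h1 k).differentiableAt
  ext k
  have h3 : HasFDerivAt (fun z => ∑ l, A z k l * u z l)
      ((pr k).comp (fderiv ℝ (fun z => act (A z) (u z)) y)) y :=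
    (pr k).hasFDerivAt.comp y h2.hasFDerivAt
  have h4 := congrArg (fun L => L v) (h3.unique (h1 k))
  refine Eq.trans h4 ?_
  simp only [_root_.sum_apply]
  rw [PiLp.add_apply, act_apply, act_apply, ← Finset.sum_add_distrib]
  refine Finset.sum_congr rfl fun l _ => ?_
  simp [mul_comm, add_comm, pr]

end Act

end TwistedDirac
end

noncomputable section

namespace TwistedDirac

/-! ### Functions supported in a compact subset of an open set -/

section ZeroOff

theorem contDiff_of_eq_zero_off {F G : Type*} [NormedAddCommGroup F] [NormedSpace ℝ F]
    [NormedAddCommGroup G] [NormedSpace ℝ G] {n : WithTop ℕ∞} {f : F → G} {U K : Set F}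
    (hU : IsOpen U) (hK : IsClosed K) (hKU : K ⊆ U) (hf : ContDiffOn ℝ n f U)
    (h0 : ∀ y, y ∉ K → f y = 0) : ContDiff ℝ n f := by
  rw [contDiff_iff_contDiffAt]
  intro y
  by_cases hy : y ∈ K
  · exact hf.contDiffAt (hU.mem_nhds (hKU hy))
  · refine (contDiffAt_const (c := (0 : G))).congr_of_eventuallyEq ?_
    filter_upwards [hK.isOpen_compl.mem_nhds hy] with z hz using h0 z hz

theorem continuous_of_eq_zero_off {X G : Type*} [TopologicalSpace X] [TopologicalSpace G] [Zero G]
    {f : X → G} {U K : Set X} (hU : IsOpen U) (hK : IsClosed K) (hKU : K ⊆ U)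
    (hf : ContinuousOn f U) (h0 : ∀ y, y ∉ K → f y = 0) : Continuous f := by
  rw [continuous_iff_continuousAt]
  intro y
  by_cases hy : y ∈ K
  · exact hf.continuousAt (hU.mem_nhds (hKU hy))
  · refine (continuousAt_const (y := (0 : G))).congr ?_
    filter_upwards [hK.isOpen_compl.mem_nhds hy] with z hz using (h0 z hz).symm

theorem integrable_of_eq_zero_off {m : ℕ} {G : Type*} [NormedAddCommGroup G] {f : Coord m → G}
    {U K : Set (Coord m)} (hU : IsOpen U) (hK : IsCompact K) (hKU : K ⊆ U)
    (hf : ContinuousOn f U) (h0 : ∀ y, y ∉ K → f y = 0) : Integrable f :=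
  (continuous_of_eq_zero_off hU hK.isClosed hKU hf h0).integrable_of_hasCompactSupport
    (HasCompactSupport.intro hK h0)

theorem fderiv_eq_zero_off {F G : Type*} [NormedAddCommGroup F] [NormedSpace ℝ F]
    [NormedAddCommGroup G] [NormedSpace ℝ G] {f : F → G} {K : Set F} (hK : IsClosed K)
    (h0 : ∀ y, y ∉ K → f y = 0) {y : F} (hy : y ∉ K) : fderiv ℝ f y = 0 := by
  have : f =ᶠ[nhds y] fun _ => 0 := by
    filter_upwards [hK.isOpen_compl.mem_nhds hy] with z hz using h0 z hz
  rw [this.fderiv_eq (𝕜 := ℝ)]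
  simp

/-- The integrand is the derivative of `k q` along `v`. The function `k` is smooth on `U` only,
which suffices because `q` vanishes off a compact part of `U`. -/
theorem integral_div_eq_zero {m : ℕ} {U K : Set (Coord m)} {k : Coord m → ℝ} {q : Coord m → ℂ}
    (hU : IsOpen U) (hK : IsCompact K) (hKU : K ⊆ U) (hk : ContDiffOn ℝ ∞ k U)
    (hq : ContDiffOn ℝ ∞ q U) (h0 : ∀ y, y ∉ K → q y = 0) (v : Coord m) :
    Integrable (fun y => (fderiv ℝ k y v) • q y + k y • fderiv ℝ q y v) ∧
      ∫ y, ((fderiv ℝ k y v) • q y + k y • fderiv ℝ q y v) = 0 := by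
  have hk' : ContinuousOn (fun y => fderiv ℝ k y v) U :=
    (hk.continuousOn_fderiv_of_isOpen hU (by simp)).clm_apply continuousOn_const
  have hq' : ContinuousOn (fun y => fderiv ℝ q y v) U :=
    (hq.continuousOn_fderiv_of_isOpen hU (by simp)).clm_apply continuousOn_const
  have i1 : Integrable (fun y => (fderiv ℝ k y v) • q y) :=
    integrable_of_eq_zero_off hU hK hKU (hk'.smul hq.continuousOn)
      (fun y hy => by rw [h0 y hy, smul_zero])
  have i2 : Integrable (fun y => k y • fderiv ℝ q y v) :=
    integrable_of_eq_zero_off hU hK hKU (hk.continuousOn.smul hq')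
      (fun y hy => by rw [fderiv_eq_zero_off hK.isClosed h0 hy]; simp)
  have i3 : Integrable (fun y => k y • q y) :=
    integrable_of_eq_zero_off hU hK hKU (hk.continuousOn.smul hq.continuousOn)
      (fun y hy => by rw [h0 y hy, smul_zero])
  have hsupp : tsupport q ⊆ U :=
    (closure_minimal (Function.support_subset_iff'.2 h0) hK.isClosed).trans hKU
  have hqd := contDiff_of_eq_zero_off hU hK.isClosed hKU hq h0
  refine ⟨i1.add i2, ?_⟩
  rw [integral_add i1 i2]
  have := integral_bilinear_fderiv_right_eq_neg_left_of_integrable (μ := volume)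
    (B := (ContinuousLinearMap.lsmul ℝ ℝ : ℝ →L[ℝ] ℂ →L[ℝ] ℂ)) (f := k) (g := q) (v := v)
    i1 i2 i3
    (fun x hx => (hk.contDiffAt (hU.mem_nhds (hsupp hx))).differentiableAt (by simp))
    (fun x _ => hqd.contDiffAt.differentiableAt (by simp))
  simp only [ContinuousLinearMap.lsmul_apply] at this
  rw [this, add_neg_cancel]

end ZeroOff

/-! ### The Dirac operator in a frame -/

section LocalDirac

variable {m : ℕ} (Δ : DiracMatrices m) (E : Fin (2 * m) → Coord m → Coord m)

/-- The spin connection form in the direction of the `a`-th vector of the frame. -/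
def locSpin (a : Fin (2 * m)) (y : Coord m) : SpinorMatrix m :=
  Δ.spinGen fun b c => frameGamma E a b c y

/-- The Dirac operator in a frame. -/
def locDirac (u : Coord m → Spinor m) (y : Coord m) : Spinor m :=
  (-Complex.I) • ∑ a, act (Δ.gamma a) (fderiv ℝ u y (E a y) - act (locSpin Δ E a y) (u y))

/-- The zeroth-order part of the Dirac operator. -/
def locPotential (y : Coord m) : SpinorMatrix m :=
  Complex.I • ∑ a, Δ.gamma a * locSpin Δ E a y

theorem locDirac_eq (u : Coord m → Spinor m) (y : Coord m) :
    locDirac Δ E u y = (∑ a, act ((-Complex.I) • Δ.gamma a) (fderiv ℝ u y (E a y))) +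
      act (locPotential Δ E y) (u y) := by
  simp only [locDirac, locPotential, act_smul, act_sum, act_mul, map_sub, Finset.sum_sub_distrib,
    smul_sub, Finset.smul_sum, neg_smul, act_neg, Finset.sum_neg_distrib, sub_neg_eq_add]

variable {Δ E} {U : Set (Coord m)}

theorem contDiffOn_locSpin (hE : IsFrameOn E U) (a : Fin (2 * m)) (k l : Fin (2 ^ m)) :
    ContDiffOn ℝ ∞ (fun y => locSpin Δ E a y k l) U := by
  have : ∀ y, locSpin Δ E a y k l =
      (1 / 4 : ℂ) * ∑ b, ∑ c, (frameGamma E a b c y : ℂ) * (Δ.gamma b * Δ.gamma c) k l := by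
    intro y
    simp [locSpin, DiracMatrices.spinGen, Matrix.sum_apply]
  simp only [this]
  refine contDiffOn_const.mul (ContDiffOn.sum fun b _ => ContDiffOn.sum fun c _ => ?_)
  exact (Complex.ofRealCLM.contDiff.comp_contDiffOn (hE.contDiffOn_gamma a b c)).mul
    contDiffOn_const

theorem contDiffOn_locPotential (hE : IsFrameOn E U) (k l : Fin (2 ^ m)) :
    ContDiffOn ℝ ∞ (fun y => locPotential Δ E y k l) U := by
  have : ∀ y, locPotential Δ E y k l =
      Complex.I * ∑ a, ∑ j, Δ.gamma a k j * locSpin Δ E a y j l := by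
    intro y
    simp [locPotential, Matrix.sum_apply, Matrix.mul_apply]
  simp only [this]
  exact contDiffOn_const.mul (ContDiffOn.sum fun a _ => ContDiffOn.sum fun j _ =>
    contDiffOn_const.mul (contDiffOn_locSpin hE a j l))

theorem contDiffOn_locDirac (hE : IsFrameOn E U) {u : Coord m → Spinor m}
    (hu : ContDiffOn ℝ ∞ u U) : ContDiffOn ℝ ∞ (locDirac Δ E u) U := by
  have : locDirac Δ E u = fun y => _ := funext fun y => locDirac_eq Δ E u y
  rw [this]
  refine ContDiffOn.add (ContDiffOn.sum fun a _ => contDiffOn_act (fun _ _ => contDiffOn_const) ?_)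
    (contDiffOn_act (contDiffOn_locPotential hE) hu)
  exact (hu.fderiv_of_isOpen hE.isOpen (by simp)).clm_apply (hE.smooth a)

theorem fderiv_act_const {F : Type*} [NormedAddCommGroup F] [NormedSpace ℝ F]
    (A : SpinorMatrix m) {u : F → Spinor m} {y : F} (hu : DifferentiableAt ℝ u y) (v : F) :
    fderiv ℝ (fun z => act A (u z)) y v = act A (fderiv ℝ u y v) := by
  rw [fderiv_act (A := fun _ => A) (fun _ _ => differentiableAt_const _) hu]
  have : (Matrix.of fun k l => fderiv ℝ (fun _ : F => A k l) y v : SpinorMatrix m) = 0 := by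
    ext k l; simp
  rw [this, act_zero, zero_add]

/-- The derivative terms combine into derivatives of `⟨u, γ^c v⟩`. The connection form is skew and
commutes with the Dirac matrices up to the rotation of `spinGen_comm_gamma`, whose trace is the
bracket sum by `frameGamma_diag`. -/
theorem inner_locDirac_sub {u v : Coord m → Spinor m} {y : Coord m} (hu : DifferentiableAt ℝ u y) (hv : DifferentiableAt ℝ v y) :
    inner ℂ (locDirac Δ E u y) (v y) - inner ℂ (u y) (locDirac Δ E v y) =
      Complex.I * ∑ c, (fderiv ℝ (fun z => inner ℂ (u z) (act (Δ.gamma c) (v z))) y (E c y) -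
        (∑ a, frameBracket E c a a y : ℝ) * inner ℂ (u y) (act (Δ.gamma c) (v y))) := by
  have hd : ∀ c, fderiv ℝ (fun z => inner ℂ (u z) (act (Δ.gamma c) (v z))) y (E c y) =
      inner ℂ (u y) (act (Δ.gamma c) (fderiv ℝ v y (E c y))) +
        inner ℂ (fderiv ℝ u y (E c y)) (act (Δ.gamma c) (v y)) := by
    intro c
    have h1 : DifferentiableAt ℝ (fun z => act (Δ.gamma c) (v z)) y :=
      ((act (Δ.gamma c)).restrictScalars ℝ).differentiableAt.comp y hv
    rw [fderiv_inner_apply ℂ hu h1, fderiv_act_const _ hv]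
  have hz : ∑ a, (inner ℂ (u y) (act (locSpin Δ E a y) (act (Δ.gamma a) (v y))) -
      inner ℂ (u y) (act (Δ.gamma a) (act (locSpin Δ E a y) (v y)))) =
      -∑ c, ((∑ a, frameBracket E c a a y : ℝ) : ℂ) * inner ℂ (u y) (act (Δ.gamma c) (v y)) := by
    have h1 : ∀ a, inner ℂ (u y) (act (locSpin Δ E a y) (act (Δ.gamma a) (v y))) -
        inner ℂ (u y) (act (Δ.gamma a) (act (locSpin Δ E a y) (v y))) =
        -∑ c, (frameBracket E c a a y : ℂ) * inner ℂ (u y) (act (Δ.gamma c) (v y)) := by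
      intro a
      rw [← inner_sub_right, ← act_mul, ← act_mul, ← act_sub, locSpin,
        Δ.spinGen_comm_gamma (fun b c => frameGamma_antisymm a b c), act_neg, inner_neg_right,
        act_sum, inner_sum]
      congr 1
      refine Finset.sum_congr rfl fun c _ => ?_
      rw [act_smul, inner_smul_right, frameGamma_diag]
    simp only [h1, Finset.sum_neg_distrib]
    rw [Finset.sum_comm]
    congr 1
    refine Finset.sum_congr rfl fun c _ => ?_
    rw [← Finset.sum_mul]
    push_cast
    rfl
  have h2 : ∀ a, inner ℂ (act (Δ.gamma a) (fderiv ℝ u y (E a y) - act (locSpin Δ E a y) (u y))) (v y)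
      = inner ℂ (fderiv ℝ u y (E a y)) (act (Δ.gamma a) (v y)) +
        inner ℂ (u y) (act (locSpin Δ E a y) (act (Δ.gamma a) (v y))) := by
    intro a
    rw [inner_act_left, Δ.gamma_conjTranspose, inner_sub_left, inner_act_left, locSpin,
      Δ.spinGen_conjTranspose (fun b c => frameGamma_antisymm a b c), act_neg, inner_neg_right,
      sub_neg_eq_add]
  simp only [Finset.sum_sub_distrib, hd, Finset.sum_add_distrib] at hz ⊢
  rw [sub_eq_add_neg _ (∑ c, _), ← hz]
  have h3 : inner ℂ (locDirac Δ E u y) (v y) =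
      Complex.I * ∑ a, (inner ℂ (fderiv ℝ u y (E a y)) (act (Δ.gamma a) (v y)) +
        inner ℂ (u y) (act (locSpin Δ E a y) (act (Δ.gamma a) (v y)))) := by
    rw [locDirac, inner_smul_left, sum_inner, Finset.sum_congr rfl fun a _ => h2 a]
    simp
  have h4 : inner ℂ (u y) (locDirac Δ E v y) =
      -Complex.I * ∑ a, (inner ℂ (u y) (act (Δ.gamma a) (fderiv ℝ v y (E a y))) -
        inner ℂ (u y) (act (Δ.gamma a) (act (locSpin Δ E a y) (v y)))) := by
    rw [locDirac, inner_smul_right, inner_sum]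
    simp only [map_sub, inner_sub_right]
  rw [h3, h4, Finset.sum_add_distrib, Finset.sum_sub_distrib]
  ring

/-- Multiplied by the density, the defect of symmetry is a sum of derivatives `∂_μ (w E_c^μ ⟨u, γ^c
v⟩)` by `IsFrameOn.divergence`. Only `u` needs compact support. -/
theorem integral_locDirac_symm (hE : IsFrameOn E U) {K : Set (Coord m)} (hK : IsCompact K)
    (hKU : K ⊆ U) {u v : Coord m → Spinor m} (hu : ContDiffOn ℝ ∞ u U) (hv : ContDiffOn ℝ ∞ v U)
    (h0 : ∀ y, y ∉ K → u y = 0) :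
    ∫ y in U, frameDensity E y • inner ℂ (locDirac Δ E u y) (v y) =
      ∫ y in U, frameDensity E y • inner ℂ (u y) (locDirac Δ E v y) := by
  set q : Fin (2 * m) → Coord m → ℂ := fun c z => inner ℂ (u z) (act (Δ.gamma c) (v z)) with hq
  set k : Fin (2 * m) → Fin (2 * m) → Coord m → ℝ := fun c μ z => frameDensity E z * E c z μ with hk
  have hqs : ∀ c, ContDiffOn ℝ ∞ (q c) U := fun c =>
    hu.inner ℂ (contDiffOn_act (fun _ _ => contDiffOn_const) hv)
  have hks : ∀ c μ, ContDiffOn ℝ ∞ (k c μ) U := fun c μ =>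
    hE.contDiffOn_density.mul ((contDiffOn_euclidean.1 (hE.smooth c)) μ)
  have hq0 : ∀ c y, y ∉ K → q c y = 0 := fun c y hy => by
    simp only [hq, h0 y hy, inner_zero_left]
  have hd0 : ∀ y, y ∉ K → locDirac Δ E u y = 0 := fun y hy => by
    simp [locDirac, fderiv_eq_zero_off hK.isClosed h0 hy, h0 y hy]
  have i1 : IntegrableOn (fun y => frameDensity E y • inner ℂ (locDirac Δ E u y) (v y)) U := by
    refine (integrable_of_eq_zero_off hE.isOpen hK hKU ?_ ?_).integrableOn
    · exact hE.contDiffOn_density.continuousOn.smul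
        ((contDiffOn_locDirac hE hu).continuousOn.inner hv.continuousOn)
    · intro y hy
      rw [hd0 y hy, inner_zero_left, smul_zero]
  have i2 : IntegrableOn (fun y => frameDensity E y • inner ℂ (u y) (locDirac Δ E v y)) U := by
    refine (integrable_of_eq_zero_off hE.isOpen hK hKU ?_ ?_).integrableOn
    · exact hE.contDiffOn_density.continuousOn.smul
        (hu.continuousOn.inner (contDiffOn_locDirac hE hv).continuousOn)
    · intro y hy
      rw [h0 y hy, inner_zero_left, smul_zero]
  rw [← sub_eq_zero, ← integral_sub i1 i2]
  have hpt : ∀ y ∈ U, frameDensity E y • inner ℂ (locDirac Δ E u y) (v y) -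
      frameDensity E y • inner ℂ (u y) (locDirac Δ E v y) =
      Complex.I * ∑ c, ∑ μ, ((fderiv ℝ (k c μ) y (EuclideanSpace.single μ 1)) • q c y +
        k c μ y • fderiv ℝ (q c) y (EuclideanSpace.single μ 1)) := by
    intro y hy
    have hud := (hu.contDiffAt (hE.isOpen.mem_nhds hy)).differentiableAt (by simp)
    have hvd := (hv.contDiffAt (hE.isOpen.mem_nhds hy)).differentiableAt (by simp)
    rw [← smul_sub, inner_locDirac_sub hud hvd, Complex.real_smul, mul_left_comm,
      Finset.mul_sum]
    congr 1
    refine Finset.sum_congr rfl fun c _ => ?_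
    have e1 : E c y = ∑ μ, E c y μ • EuclideanSpace.single μ (1 : ℝ) := by
      ext ν
      simp [Pi.single_apply]
    have e2 := hE.divergence hy c
    rw [Finset.sum_add_distrib, ← Finset.sum_smul]
    simp only [hk]
    rw [e2]
    conv_lhs => enter [2, 1]; rw [e1, map_sum]
    simp only [map_smul, Complex.real_smul, hq, mul_sub, Finset.mul_sum]
    push_cast
    rw [neg_mul, ← sub_eq_neg_add]
    simp only [mul_assoc, Finset.sum_mul, Finset.mul_sum]
  rw [setIntegral_congr_fun hE.isOpen.measurableSet hpt, integral_const_mul]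
  have hall : ∀ c μ, IntegrableOn (fun y =>
      (fderiv ℝ (k c μ) y (EuclideanSpace.single μ 1)) • q c y +
        k c μ y • fderiv ℝ (q c) y (EuclideanSpace.single μ 1)) U ∧
      ∫ y in U, ((fderiv ℝ (k c μ) y (EuclideanSpace.single μ 1)) • q c y +
        k c μ y • fderiv ℝ (q c) y (EuclideanSpace.single μ 1)) = 0 := by
    intro c μ
    have h1 := integral_div_eq_zero hE.isOpen hK hKU (hks c μ) (hqs c) (hq0 c)
      (EuclideanSpace.single μ 1)
    refine ⟨h1.1.integrableOn, ?_⟩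
    rw [setIntegral_eq_integral_of_forall_compl_eq_zero, h1.2]
    intro y hy
    have hyK : y ∉ K := fun h => hy (hKU h)
    rw [hq0 c y hyK, fderiv_eq_zero_off hK.isClosed (hq0 c) hyK]
    simp
  rw [integral_finsetSum _ fun c _ => integrable_finsetSum _ fun μ _ => (hall c μ).1,
    Finset.sum_eq_zero, mul_zero]
  intro c _
  rw [integral_finsetSum _ fun μ _ => (hall c μ).1]
  exact Finset.sum_eq_zero fun μ _ => (hall c μ).2

end LocalDirac

/-! ### Change of frame -/

section Gauge

variable {m : ℕ}

/-- The entrywise directional derivative of a matrix-valued function. -/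
def matDeriv (A : Coord m → SpinorMatrix m) (y v : Coord m) : SpinorMatrix m :=
  Matrix.of fun k l => fderiv ℝ (fun z => A z k l) y v

theorem matDeriv_congr {A B : Coord m → SpinorMatrix m} {y : Coord m} (h : A =ᶠ[nhds y] B)
    (v : Coord m) : matDeriv A y v = matDeriv B y v := by
  ext k l
  have : (fun z => A z k l) =ᶠ[nhds y] fun z => B z k l := by
    filter_upwards [h] with z hz using by rw [hz]
  exact congrArg (fun L => L v) (this.fderiv_eq (𝕜 := ℝ))

theorem matDeriv_const (A : SpinorMatrix m) (y v : Coord m) : matDeriv (fun _ => A) y v = 0 := by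
  ext k l
  simp [matDeriv]

theorem matDeriv_mul {A B : Coord m → SpinorMatrix m} {y : Coord m}
    (hA : ∀ k l, DifferentiableAt ℝ (fun z => A z k l) y)
    (hB : ∀ k l, DifferentiableAt ℝ (fun z => B z k l) y) (v : Coord m) :
    matDeriv (fun z => A z * B z) y v = matDeriv A y v * B y + A y * matDeriv B y v := by
  ext k l
  simp only [matDeriv, Matrix.of_apply, Matrix.add_apply, Matrix.mul_apply]
  rw [fderiv_fun_sum (A := fun j z => A z k j * B z j l) fun j _ => (hA k j).mul (hB j l),
    _root_.sum_apply, ← Finset.sum_add_distrib]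
  refine Finset.sum_congr rfl fun j _ => ?_
  rw [fderiv_fun_mul (hA k j) (hB j l)]
  simp [mul_comm, add_comm]

theorem matDeriv_map_star {A : Coord m → SpinorMatrix m} {y : Coord m} (v : Coord m) :
    matDeriv (fun z => (A z).map star) y v = (matDeriv A y v).map star := by
  ext k l
  simp only [matDeriv, Matrix.of_apply, Matrix.map_apply]
  exact congrArg (fun L => L v) (fderiv_star (𝕜 := ℝ) (f := fun z => A z _ _))

theorem matDeriv_conjTranspose {A : Coord m → SpinorMatrix m} {y : Coord m} (v : Coord m) :
    matDeriv (fun z => (A z)ᴴ) y v = (matDeriv A y v)ᴴ := by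
  ext k l
  simp only [matDeriv, Matrix.of_apply, Matrix.conjTranspose_apply]
  exact congrArg (fun L => L v) (fderiv_star (𝕜 := ℝ) (f := fun z => A z _ _))

variable {Δ : DiracMatrices m}

/-- The covariance of the Dirac operator under a change of frame. -/
theorem locDirac_gauge {U : Set (Coord m)} {E E' : Fin (2 * m) → Coord m → Coord m}
    {R : Fin (2 * m) → Fin (2 * m) → Coord m → ℝ} {L : Coord m → SpinorMatrix m}
    (hE : IsFrameOn E U) (hE' : IsFrameOn E' U)
    (hRd : ∀ b a, DifferentiableOn ℝ (R b a) U)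
    (hER : ∀ y ∈ U, ∀ a, E' a y = ∑ b, R b a y • E b y)
    (hO : ∀ y ∈ U, ∀ a c, ∑ b, R b a y * R b c y = if a = c then 1 else 0)
    (hL : ∀ y ∈ U, L y ∈ Δ.spinMatrices)
    (hLd : ∀ k l, DifferentiableOn ℝ (fun z => L z k l) U)
    (hLR : ∀ y ∈ U, ∀ a, L y * Δ.gamma a = (∑ b, (R b a y : ℂ) • Δ.gamma b) * L y)
    {u : Coord m → Spinor m} {y : Coord m} (hy : y ∈ U) (hu : DifferentiableAt ℝ u y) :
    locDirac Δ E (fun z => act (L z) (u z)) y = act (L y) (locDirac Δ E' u y) := by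
  have hU : U ∈ nhds y := hE.isOpen.mem_nhds hy
  have hRy : ∀ b a, DifferentiableAt ℝ (R b a) y := fun b a => (hRd b a).differentiableAt hU
  have hLy : ∀ k l, DifferentiableAt ℝ (fun z => L z k l) y := fun k l =>
    (hLd k l).differentiableAt hU
  have hO' : ∀ a c, ∑ b, R a b y * R c b y = if a = c then 1 else 0 := by
    set Q : Matrix (Fin (2 * m)) (Fin (2 * m)) ℝ := Matrix.of fun b a => R b a y with hQ
    have h1 : Qᵀ * Q = 1 := by
      ext a c
      rw [Matrix.mul_apply, Matrix.one_apply, ← hO y hy a c]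
      rfl
    have h2 : Q * Qᵀ = 1 := mul_eq_one_comm.1 h1
    intro a c
    have := congrFun (congrFun h2 a) c
    rw [Matrix.mul_apply, Matrix.one_apply] at this
    exact this
  have hLs : ∀ k l, DifferentiableAt ℝ (fun z => (L z)ᴴ k l) y := fun k l => (hLy l k).star
  -- The hypotheses of `spinGen_gauge` come from differentiating along `E' a` the identities
  -- satisfied by spin matrices: unitarity, compatibility with the charge conjugation and the
  -- intertwining of the frames. The last hypothesis is `frameGamma_gauge`.
  have hgauge : ∀ a, matDeriv L y (E' a y) -
      Δ.spinGen (fun c d => ∑ e, R e a y * frameGamma E e c d y) * L y =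
      -(L y * locSpin Δ E' a y) := by
    intro a
    refine Δ.spinGen_gauge (R := fun b a => R b a y)
      (R' := fun b c => fderiv ℝ (R b c) y (E' a y)) ?_ (fun b c => frameGamma_antisymm a b c)
      (DiracMatrices.spin_conjTranspose_mul (hL y hy)) ?_
      (DiracMatrices.spin_chargeConj (hL y hy)) ?_ (hLR y hy) ?_ ?_
    · intro b c
      rw [← Finset.sum_neg_distrib]
      exact Finset.sum_congr rfl fun e _ => by rw [frameGamma_antisymm e b c, mul_neg]
    · have h1 : (fun z => (L z)ᴴ * L z) =ᶠ[nhds y] fun _ => 1 := by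
        filter_upwards [hU] with z hz using DiracMatrices.spin_conjTranspose_mul (hL z hz)
      have h2 := matDeriv_congr h1 (E' a y)
      rwa [matDeriv_mul hLs hLy, matDeriv_const, matDeriv_conjTranspose] at h2
    · have h1 : (fun z => Δ.chargeConj * (L z).map star) =ᶠ[nhds y]
          fun z => L z * Δ.chargeConj := by
        filter_upwards [hU] with z hz using DiracMatrices.spin_chargeConj (hL z hz)
      have h2 := matDeriv_congr h1 (E' a y)
      rwa [matDeriv_mul (A := fun _ => Δ.chargeConj) (B := fun z => (L z).map star)
          (fun _ _ => differentiableAt_const _) (fun k l => (hLy k l).star),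
        matDeriv_mul (B := fun _ => Δ.chargeConj) hLy (fun _ _ => differentiableAt_const _),
        matDeriv_const, matDeriv_map_star, zero_mul, mul_zero, zero_add, add_zero] at h2
    · intro b
      have hRm : ∀ k l, DifferentiableAt ℝ
          (fun z => (∑ c, (R c b z : ℂ) • Δ.gamma c) k l) y := by
        intro k l
        simp only [Matrix.sum_apply, Matrix.smul_apply, smul_eq_mul]
        exact DifferentiableAt.fun_sum fun c _ =>
          (Complex.ofRealCLM.differentiableAt.comp y (hRy c b)).mul_const _
      have h1 : (fun z => L z * Δ.gamma b) =ᶠ[nhds y]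
          fun z => (∑ c, (R c b z : ℂ) • Δ.gamma c) * L z := by
        filter_upwards [hU] with z hz using hLR z hz b
      have h2 := matDeriv_congr h1 (E' a y)
      rw [matDeriv_mul (B := fun _ => Δ.gamma b) hLy (fun _ _ => differentiableAt_const _),
        matDeriv_const, mul_zero, add_zero, matDeriv_mul hRm hLy] at h2
      rw [h2]
      congr 2
      ext k l
      simp only [matDeriv, Matrix.of_apply, Matrix.sum_apply, Matrix.smul_apply, smul_eq_mul]
      rw [fderiv_fun_sum (A := fun c z => (R c b z : ℂ) * Δ.gamma c k l) fun c _ =>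
        (Complex.ofRealCLM.differentiableAt.comp y (hRy c b)).mul_const _, _root_.sum_apply]
      refine Finset.sum_congr rfl fun c _ => ?_
      have h3 : HasFDerivAt (fun z => (R c b z : ℂ) * Δ.gamma c k l)
          (Δ.gamma c k l • (Complex.ofRealCLM.comp (fderiv ℝ (R c b) y))) y :=
        (Complex.ofRealCLM.hasFDerivAt.comp y (hRy c b).hasFDerivAt).mul_const _
      rw [h3.fderiv]
      simp [mul_comm]
    · intro b d
      exact frameGamma_gauge hE hE' hRd hER hO hy a b d
  set D : Fin (2 * m) → Spinor m := fun b =>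
    fderiv ℝ (fun z => act (L z) (u z)) y (E b y) - act (locSpin Δ E b y) (act (L y) (u y)) with hD
  have hsum : ∀ a, ∑ b, (R b a y : ℂ) • D b =
      act (L y) (fderiv ℝ u y (E' a y) - act (locSpin Δ E' a y) (u y)) := by
    intro a
    have h1 : ∑ b, (R b a y : ℂ) • fderiv ℝ (fun z => act (L z) (u z)) y (E b y) =
        fderiv ℝ (fun z => act (L z) (u z)) y (E' a y) := by
      rw [hER y hy, map_sum]
      refine Finset.sum_congr rfl fun b _ => ?_
      rw [map_smul]
      exact (Complex.coe_smul _ _)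
    have h2 : ∑ b, (R b a y : ℂ) • locSpin Δ E b y =
        Δ.spinGen (fun c d => ∑ e, R e a y * frameGamma E e c d y) := by
      simp only [locSpin, DiracMatrices.spinGen, Finset.smul_sum, smul_smul]
      rw [Finset.sum_comm]
      refine Finset.sum_congr rfl fun c _ => ?_
      rw [Finset.sum_comm]
      refine Finset.sum_congr rfl fun d _ => ?_
      rw [← Finset.sum_smul]
      congr 1
      push_cast
      rw [Finset.mul_sum]
      exact Finset.sum_congr rfl fun _ _ => by ring
    have h3 : ∑ b, (R b a y : ℂ) • act (locSpin Δ E b y) (act (L y) (u y)) =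
        act (Δ.spinGen (fun c d => ∑ e, R e a y * frameGamma E e c d y)) (act (L y) (u y)) := by
      rw [← h2, act_sum]
      simp only [act_smul]
    simp only [hD, smul_sub, Finset.sum_sub_distrib]
    rw [h1, h3, fderiv_act hLy hu, ← act_mul, map_sub, ← act_mul]
    have h4 := congrArg (fun A => act A (u y)) (hgauge a)
    simp only [act_sub, act_neg] at h4
    rw [add_sub_right_comm, sub_eq_add_neg (act (L y) _), ← h4, add_comm]
    rfl
  -- The rotation appears once from moving `L` past the Dirac matrix and once from the change of
  -- direction of the derivative. Orthogonality contracts the two factors.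
  have hfin : ∑ b, act (Δ.gamma b) (D b) =
      ∑ a, act (L y) (act (Δ.gamma a) (fderiv ℝ u y (E' a y) - act (locSpin Δ E' a y) (u y))) := by
    have h1 : ∀ a, act (L y) (act (Δ.gamma a)
        (fderiv ℝ u y (E' a y) - act (locSpin Δ E' a y) (u y))) =
        ∑ c, ∑ b, ((R c a y * R b a y : ℝ) : ℂ) • act (Δ.gamma c) (D b) := by
      intro a
      rw [← act_mul, hLR y hy, act_mul, ← hsum, act_sum]
      refine Finset.sum_congr rfl fun c _ => ?_
      rw [act_smul, map_sum, Finset.smul_sum]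
      refine Finset.sum_congr rfl fun b _ => ?_
      rw [map_smul, smul_smul]
      push_cast
      rfl
    simp only [h1]
    rw [Finset.sum_comm]
    refine Finset.sum_congr rfl fun c _ => ?_
    rw [Finset.sum_comm]
    simp only [← Finset.sum_smul, ← Complex.ofReal_sum, hO']
    simp
  rw [locDirac, locDirac, map_smul, map_sum, ← hfin]

end Gauge

end TwistedDirac
end

noncomputable section

namespace TwistedDirac

/-! ### Mollifiers -/

section Mollifier

variable {m : ℕ}

/-- A smooth probability density on the ball of radius `ε`, with the natural bounds. -/
structure IsMollifier (ρ : Coord m → ℝ) (ε C : ℝ) : Prop where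
  pos : 0 < ε
  smooth : ContDiff ℝ ∞ ρ
  zero_off : ∀ z, z ∉ Metric.closedBall 0 ε → ρ z = 0
  nonneg : ∀ z, 0 ≤ ρ z
  integral_eq_one : ∫ z, ρ z = 1
  bound : ∀ z, ‖ρ z‖ ≤ C * (ε⁻¹) ^ (2 * m)
  bound_fderiv : ∀ z, ‖fderiv ℝ ρ z‖ ≤ C * (ε⁻¹) ^ (2 * m) * ε⁻¹

/-- All the kernels are rescalings of one bump function, so the constant does not depend on `ε`. The
exponent `2 * m` is the dimension. -/
theorem exists_isMollifier (m : ℕ) :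
    ∃ C : ℝ, 0 ≤ C ∧ ∀ ε : ℝ, 0 < ε → ∃ ρ : Coord m → ℝ, IsMollifier ρ ε C := by
  let b : ContDiffBump (0 : Coord m) := ⟨1 / 2, 1, by norm_num, by norm_num⟩
  set f : Coord m → ℝ := b.normed volume with hf
  have hfs : ContDiff ℝ ∞ f := b.contDiff_normed
  have hf0 : ∀ z, z ∉ Metric.closedBall (0 : Coord m) 1 → f z = 0 := by
    intro z hz
    by_contra h
    have : z ∈ Function.support f := h
    rw [hf, b.support_normed_eq] at this
    exact hz (Metric.ball_subset_closedBall this)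
  have hfc : HasCompactSupport f := HasCompactSupport.intro (isCompact_closedBall 0 1) hf0
  obtain ⟨C1, hC1⟩ := hfc.exists_bound_of_continuous hfs.continuous
  obtain ⟨C2, hC2⟩ := (hfc.fderiv (𝕜 := ℝ)).exists_bound_of_continuous
    (hfs.continuous_fderiv (by simp))
  refine ⟨max C1 C2, (norm_nonneg _).trans ((hC1 0).trans (le_max_left _ _)), fun ε hε => ?_⟩
  have hdiff : ∀ z, HasFDerivAt (fun z : Coord m => (ε⁻¹) ^ (2 * m) * f (ε⁻¹ • z))
      ((ε⁻¹) ^ (2 * m) • (ε⁻¹ • fderiv ℝ f (ε⁻¹ • z))) z := by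
    intro z
    have h1 : HasFDerivAt (fun z : Coord m => ε⁻¹ • z) (ε⁻¹ • ContinuousLinearMap.id ℝ (Coord m)) z :=
      (ε⁻¹ • ContinuousLinearMap.id ℝ (Coord m)).hasFDerivAt
    have h2 := ((hfs.differentiable (by simp)) (ε⁻¹ • z)).hasFDerivAt.comp z h1
    have h3 := h2.const_mul ((ε⁻¹) ^ (2 * m))
    refine h3.congr_fderiv ?_
    ext v
    simp
  refine ⟨fun z => (ε⁻¹) ^ (2 * m) * f (ε⁻¹ • z), hε, ?_, ?_, ?_, ?_, ?_, ?_⟩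
  · exact contDiff_const.mul (hfs.comp (contDiff_const_smul ε⁻¹))
  · intro z hz
    rw [hf0, mul_zero]
    intro h
    apply hz
    rw [mem_closedBall_zero_iff] at h ⊢
    rwa [norm_smul, norm_inv, Real.norm_of_nonneg hε.le, inv_mul_le_iff₀ hε, mul_one] at h
  · intro z
    have : 0 ≤ f (ε⁻¹ • z) := b.nonneg_normed _
    positivity
  · rw [integral_const_mul, Measure.integral_comp_smul, b.integral_normed]
    simp only [finrank_euclideanSpace, Fintype.card_fin, smul_eq_mul, mul_one]
    rw [abs_of_pos (by positivity), mul_inv_cancel₀ (by positivity)]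
  · intro z
    rw [norm_mul, norm_pow, norm_inv, Real.norm_of_nonneg hε.le, mul_comm]
    gcongr
    exact (hC1 _).trans (le_max_left _ _)
  · intro z
    rw [(hdiff z).fderiv, norm_smul, norm_smul, norm_pow, norm_inv, Real.norm_of_nonneg hε.le,
      mul_comm _ ‖fderiv ℝ f _‖, ← mul_assoc, mul_comm _ ‖fderiv ℝ f _‖]
    gcongr
    exact (hC2 _).trans (le_max_right _ _)

/-- The average of the `f` over a ball is bounded in `L²` by `f`. -/
theorem lintegral_average_sq_le {f : Coord m → ℝ≥0∞} (hf : AEMeasurable f) {ε : ℝ} (hε : 0 < ε) :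
    ∫⁻ x, (ENNReal.ofReal ((ε⁻¹) ^ (2 * m)) * ∫⁻ y in Metric.closedBall x ε, f y) ^ 2 ≤
      volume (Metric.ball (0 : Coord m) 1) ^ 2 * ∫⁻ y, f y ^ 2 := by
  set κ := volume (Metric.ball (0 : Coord m) 1) with hκ
  have hvol : ∀ x : Coord m, volume (Metric.closedBall x ε) = ENNReal.ofReal (ε ^ (2 * m)) * κ := by
    intro x
    rw [Measure.addHaar_closedBall _ _ hε.le]
    simp [hκ]
  have hcancel : ENNReal.ofReal ((ε⁻¹) ^ (2 * m)) * ENNReal.ofReal (ε ^ (2 * m)) = 1 := by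
    rw [← ENNReal.ofReal_mul (by positivity), ← mul_pow, inv_mul_cancel₀ hε.ne']
    simp
  -- Cauchy–Schwarz on the ball against the constant function `1`.
  have hcs : ∀ x, (∫⁻ y in Metric.closedBall x ε, f y) ^ 2 ≤
      (∫⁻ y in Metric.closedBall x ε, f y ^ 2) * (ENNReal.ofReal (ε ^ (2 * m)) * κ) := by
    intro x
    have h1 := ENNReal.lintegral_mul_le_Lp_mul_Lq (volume.restrict (Metric.closedBall x ε))
      (p := 2) (q := 2) (by rw [Real.holderConjugate_iff]; norm_num) (f := f) (g := fun _ => 1)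
      hf.restrict aemeasurable_const
    simp only [Pi.mul_apply, mul_one, ENNReal.rpow_ofNat, one_pow, lintegral_const,
      Measure.restrict_apply MeasurableSet.univ, Set.univ_inter, one_mul, hvol] at h1
    calc _ ≤ ((∫⁻ y in Metric.closedBall x ε, f y ^ 2) ^ (1 / 2 : ℝ) *
        (ENNReal.ofReal (ε ^ (2 * m)) * κ) ^ (1 / 2 : ℝ)) ^ 2 := by gcongr
      _ = _ := by
        rw [mul_pow, ← ENNReal.rpow_natCast, ← ENNReal.rpow_natCast, ← ENNReal.rpow_mul,
          ← ENNReal.rpow_mul]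
        norm_num
  -- Tonelli: each `y` lies in the balls whose centres form a ball of the same volume.
  have hswap : ∫⁻ x, ∫⁻ y in Metric.closedBall x ε, f y ^ 2 =
      (ENNReal.ofReal (ε ^ (2 * m)) * κ) * ∫⁻ y, f y ^ 2 := by
    have hS : MeasurableSet {p : Coord m × Coord m | dist p.2 p.1 ≤ ε} :=
      (isClosed_le (continuous_snd.dist continuous_fst) continuous_const).measurableSet
    have h1 : ∀ x, ∫⁻ y in Metric.closedBall x ε, f y ^ 2 =
        ∫⁻ y, {p : Coord m × Coord m | dist p.2 p.1 ≤ ε}.indicator (fun p => f p.2 ^ 2) (x, y) := by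
      intro x
      rw [← lintegral_indicator Metric.isClosed_closedBall.measurableSet]
      rfl
    have h2 : AEMeasurable ({p : Coord m × Coord m | dist p.2 p.1 ≤ ε}.indicator
        (fun p => f p.2 ^ 2)) (volume.prod volume) :=
      ((hf.comp_quasiMeasurePreserving Measure.quasiMeasurePreserving_snd).pow_const 2).indicator hS
    simp only [h1]
    rw [lintegral_lintegral_swap (f := fun x y =>
      {p : Coord m × Coord m | dist p.2 p.1 ≤ ε}.indicator (fun p => f p.2 ^ 2) (x, y)) h2]
    have h3 : ∀ y, ∫⁻ x, {p : Coord m × Coord m | dist p.2 p.1 ≤ ε}.indicator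
        (fun p => f p.2 ^ 2) (x, y) = f y ^ 2 * (ENNReal.ofReal (ε ^ (2 * m)) * κ) := by
      intro y
      have h4 : ∀ x, {p : Coord m × Coord m | dist p.2 p.1 ≤ ε}.indicator
          (fun p => f p.2 ^ 2) (x, y) = (Metric.closedBall y ε).indicator (fun _ => f y ^ 2) x := by
        intro x
        simp only [Set.indicator, Set.mem_ofPred_eq, Metric.mem_closedBall, dist_comm]
      simp only [h4]
      rw [lintegral_indicator Metric.isClosed_closedBall.measurableSet, setLIntegral_const, hvol]
    simp only [h3]
    rw [lintegral_mul_const'' _ (hf.pow_const 2), mul_comm]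
  calc _ ≤ ∫⁻ x, ENNReal.ofReal ((ε⁻¹) ^ (2 * m)) ^ 2 *
        ((∫⁻ y in Metric.closedBall x ε, f y ^ 2) * (ENNReal.ofReal (ε ^ (2 * m)) * κ)) := by
        gcongr with x
        rw [mul_pow]
        gcongr
        exact hcs x
    _ = ENNReal.ofReal ((ε⁻¹) ^ (2 * m)) ^ 2 *
        ((ENNReal.ofReal (ε ^ (2 * m)) * κ) * (∫⁻ y, f y ^ 2) *
          (ENNReal.ofReal (ε ^ (2 * m)) * κ)) := by
        rw [lintegral_const_mul' _ _ (by simp), lintegral_mul_const', hswap]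
        exact ENNReal.mul_ne_top (by simp) measure_ball_lt_top.ne
    _ = (ENNReal.ofReal ((ε⁻¹) ^ (2 * m)) * ENNReal.ofReal (ε ^ (2 * m))) ^ 2 *
        (κ ^ 2 * ∫⁻ y, f y ^ 2) := by ring
    _ = _ := by rw [hcancel, one_pow, one_mul]

theorem integral_sq_le_of_average {F : Coord m → Spinor m} {f : Coord m → ℝ} (hf : Integrable f)
    (hf0 : ∀ y, 0 ≤ f y) (hf2 : Integrable fun y => f y ^ 2) {ε C : ℝ}
    (hε : 0 < ε) (hC : 0 ≤ C)
    (h : ∀ x, ‖F x‖ ≤ C * ((ε⁻¹) ^ (2 * m) * ∫ y in Metric.closedBall x ε, f y)) :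
    ∫⁻ x, ‖F x‖ₑ ^ 2 ≤ ENNReal.ofReal C ^ 2 * (volume (Metric.ball (0 : Coord m) 1) ^ 2 *
      ENNReal.ofReal (∫ y, f y ^ 2)) := by
  have h1 : ∀ x, ‖F x‖ₑ ^ 2 ≤ ENNReal.ofReal C ^ 2 * (ENNReal.ofReal ((ε⁻¹) ^ (2 * m)) *
      ∫⁻ y in Metric.closedBall x ε, ENNReal.ofReal (f y)) ^ 2 := by
    intro x
    rw [← mul_pow]
    gcongr
    rw [← ofReal_integral_eq_lintegral_ofReal hf.integrableOn (Filter.Eventually.of_forall hf0),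
      ← ENNReal.ofReal_mul (by positivity), ← ENNReal.ofReal_mul hC, ← ofReal_norm]
    exact ENNReal.ofReal_le_ofReal (h x)
  calc _ ≤ _ := lintegral_mono h1
    _ = ENNReal.ofReal C ^ 2 * _ := lintegral_const_mul' _ _ (by simp)
    _ ≤ _ := by
      gcongr
      refine (lintegral_average_sq_le hf.aemeasurable.ennreal_ofReal hε).trans ?_
      rw [ofReal_integral_eq_lintegral_ofReal hf2
        (Filter.Eventually.of_forall fun y => by positivity)]
      gcongr with y
      rw [ENNReal.ofReal_pow (hf0 y)]

/-- The mollification of `u`. -/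
def mollify (ρ : Coord m → ℝ) (u : Coord m → Spinor m) (x : Coord m) : Spinor m :=
  ∫ y, ρ (x - y) • u y

variable {ρ : Coord m → ℝ} {ε C : ℝ} {u h : Coord m → Spinor m}

theorem mollify_eq_convolution (ρ : Coord m → ℝ) (u : Coord m → Spinor m) :
    mollify ρ u = convolution u ρ (ContinuousLinearMap.lsmul ℝ ℝ).flip volume := by
  ext1 x
  rw [convolution_def]
  rfl

namespace IsMollifier

theorem hasCompactSupport (hρ : IsMollifier ρ ε C) : HasCompactSupport ρ :=
  HasCompactSupport.intro (isCompact_closedBall 0 ε) hρ.zero_off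

theorem contDiff_mollify (hρ : IsMollifier ρ ε C) (hu : Integrable u) :
    ContDiff ℝ ∞ (mollify ρ u) := by
  rw [mollify_eq_convolution]
  exact hρ.hasCompactSupport.contDiff_convolution_right _ hu.locallyIntegrable hρ.smooth

theorem fderiv_mollify (hρ : IsMollifier ρ ε C) (hu : Integrable u) (x v : Coord m) :
    fderiv ℝ (mollify ρ u) x v = ∫ y, (fderiv ℝ ρ (x - y) v) • u y := by
  rw [mollify_eq_convolution, (hρ.hasCompactSupport.hasFDerivAt_convolution_right _
    hu.locallyIntegrable (hρ.smooth.of_le (by simp)) x).fderiv,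
    convolution_precompR_apply _ hu.locallyIntegrable (hρ.hasCompactSupport.fderiv (𝕜 := ℝ))
      (hρ.smooth.continuous_fderiv (by simp)), convolution_def]
  rfl

theorem fderiv_zero_off (hρ : IsMollifier ρ ε C) {z : Coord m} (hz : z ∉ Metric.closedBall 0 ε) :
    fderiv ℝ ρ z = 0 := fderiv_eq_zero_off Metric.isClosed_closedBall hρ.zero_off hz

theorem notMem_sub {x y : Coord m} (hy : y ∉ Metric.closedBall x ε) :
    x - y ∉ Metric.closedBall 0 ε := by
  rwa [mem_closedBall_zero_iff, ← dist_eq_norm, dist_comm, ← Metric.mem_closedBall]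

theorem mollify_eq_zero (hρ : IsMollifier ρ ε C) {K : Set (Coord m)} (hu : ∀ y, y ∉ K → u y = 0)
    {x : Coord m} (hx : ∀ y ∈ K, y ∉ Metric.closedBall x ε) : mollify ρ u x = 0 := by
  rw [mollify]
  refine integral_eq_zero_of_ae (Filter.Eventually.of_forall fun y => ?_)
  by_cases hy : y ∈ K
  · simp [hρ.zero_off _ (notMem_sub (hx y hy))]
  · simp [hu y hy]

theorem norm_mollify_le (hρ : IsMollifier ρ ε C) (hu : Integrable u) (x : Coord m) :
    ‖mollify ρ u x‖ ≤ C * ((ε⁻¹) ^ (2 * m) * ∫ y in Metric.closedBall x ε, ‖u y‖) := by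
  rw [mollify, ← mul_assoc, ← integral_const_mul,
    ← integral_indicator Metric.isClosed_closedBall.measurableSet]
  refine norm_integral_le_of_norm_le
    (IntegrableOn.integrable_indicator (hu.norm.const_mul _).integrableOn
      Metric.isClosed_closedBall.measurableSet) (Filter.Eventually.of_forall fun y => ?_)
  by_cases hy : y ∈ Metric.closedBall x ε
  · rw [Set.indicator_of_mem hy, norm_smul]
    gcongr
    exact hρ.bound _
  · rw [Set.indicator_of_notMem hy, hρ.zero_off _ (notMem_sub hy), zero_smul, norm_zero]

end IsMollifier

theorem IsMollifier.comp_neg (hρ : IsMollifier ρ ε C) : IsMollifier (fun z => ρ (-z)) ε C where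
  pos := hρ.pos
  smooth := hρ.smooth.comp contDiff_neg
  zero_off z hz := hρ.zero_off _ (by simpa using hz)
  nonneg z := hρ.nonneg _
  integral_eq_one := (integral_neg_eq_self ρ volume).trans hρ.integral_eq_one
  bound z := hρ.bound _
  bound_fderiv z := by
    have h1 : HasFDerivAt (fun z => ρ (-z))
        ((fderiv ℝ ρ (-z)).comp (-ContinuousLinearMap.id ℝ (Coord m))) z :=
      ((hρ.smooth.differentiable (by simp)) (-z)).hasFDerivAt.comp z (hasFDerivAt_id z).neg
    have h2 : (fderiv ℝ ρ (-z)).comp (-ContinuousLinearMap.id ℝ (Coord m)) = -fderiv ℝ ρ (-z) := by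
      ext v; simp
    rw [h1.fderiv, h2, norm_neg]
    exact hρ.bound_fderiv _

theorem IsMollifier.integrable_smul (hρ : IsMollifier ρ ε C) (hu : Integrable u) (x : Coord m) :
    Integrable fun y => ρ (x - y) • u y := by
  refine (hu.norm.const_mul (C * (ε⁻¹) ^ (2 * m))).mono' ?_ ?_
  · exact ((hρ.smooth.continuous.comp
      (continuous_const.sub continuous_id)).aestronglyMeasurable).smul hu.1
  · refine Filter.Eventually.of_forall fun y => ?_
    rw [norm_smul]
    exact mul_le_mul_of_nonneg_right (hρ.bound _) (norm_nonneg _)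

/-- Fubini moves the mollification to the test function, with the reflected kernel. Weak convergence
for an integrable `u` then reduces to uniform convergence for a continuous test function. -/
theorem IsMollifier.integral_inner_mollify (hρ : IsMollifier ρ ε C) (hu : Integrable u)
    {g : Coord m → Spinor m} (hg : Integrable g) :
    ∫ x, inner ℂ (mollify ρ u x) (g x) = ∫ y, inner ℂ (u y) (mollify (fun z => ρ (-z)) g y) := by
  have h1 : ∀ x, inner ℂ (mollify ρ u x) (g x) = ∫ y, inner ℂ (u y) (ρ (x - y) • g x) := by
    intro x
    rw [mollify, ← inner_conj_symm, ← integral_inner (hρ.integrable_smul hu x), ← integral_conj]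
    refine integral_congr_ae (Filter.Eventually.of_forall fun y => ?_)
    simp only [inner_conj_symm]
    rw [inner_smul_left_eq_smul, inner_smul_right_eq_smul]
  have h2 : Integrable (Function.uncurry fun x y => inner ℂ (u y) (ρ (x - y) • g x))
      (volume.prod volume) := by
    refine ((hg.norm.mul_prod hu.norm).const_mul (C * (ε⁻¹) ^ (2 * m))).mono' ?_ ?_
    · refine AEStronglyMeasurable.inner (𝕜 := ℂ)
        (hu.1.comp_quasiMeasurePreserving Measure.quasiMeasurePreserving_snd) ?_
      exact (hρ.smooth.continuous.comp
        (continuous_fst.sub continuous_snd)).aestronglyMeasurable.smul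
        (hg.1.comp_quasiMeasurePreserving Measure.quasiMeasurePreserving_fst)
    · refine Filter.Eventually.of_forall fun p => ?_
      refine (norm_inner_le_norm (𝕜 := ℂ) (u p.2) (ρ (p.1 - p.2) • g p.1)).trans ?_
      rw [norm_smul, mul_left_comm, mul_comm ‖u p.2‖]
      exact mul_le_mul_of_nonneg_right (hρ.bound _) (by positivity)
  simp only [h1]
  rw [integral_integral_swap h2]
  refine integral_congr_ae (Filter.Eventually.of_forall fun y => ?_)
  have h3 := integral_inner (𝕜 := ℂ) (hρ.comp_neg.integrable_smul hg y) (u y)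
  simp only [neg_sub] at h3
  simp only [mollify, neg_sub]
  exact h3

theorem IsMollifier.norm_mollify_sub_le (hρ : IsMollifier ρ ε C) {g : Coord m → Spinor m}
    (hg : Integrable g) {y : Coord m} {w : Spinor m} {η : ℝ}
    (h : ∀ x ∈ Metric.closedBall y ε, ‖g x - w‖ ≤ η) : ‖mollify ρ g y - w‖ ≤ η := by
  have hone : ∫ x, ρ (y - x) = 1 := by
    rw [integral_sub_left_eq_self (fun x => ρ x), hρ.integral_eq_one]
  have hρi : Integrable fun x => ρ (y - x) :=
    (hρ.smooth.continuous.integrable_of_hasCompactSupport hρ.hasCompactSupport).comp_sub_left y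
  have h1 : mollify ρ g y - w = ∫ x, ρ (y - x) • (g x - w) := by
    simp only [smul_sub]
    rw [integral_sub (hρ.integrable_smul hg y) (hρi.smul_const _), integral_smul_const, hone,
      one_smul, mollify]
  rw [h1]
  calc _ ≤ ∫ x, ρ (y - x) * η := norm_integral_le_of_norm_le (hρi.mul_const _)
        (Filter.Eventually.of_forall fun x => by
          rw [norm_smul, Real.norm_of_nonneg (hρ.nonneg _)]
          by_cases hx : x ∈ Metric.closedBall y ε
          · exact mul_le_mul_of_nonneg_left (h x hx) (hρ.nonneg _)
          · rw [hρ.zero_off _ (IsMollifier.notMem_sub hx), zero_mul, zero_mul])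
    _ = η := by rw [integral_mul_const, hone, one_mul]

/-- Mollifications converge weakly. -/
theorem tendsto_integral_inner_mollify {ρ : ℕ → Coord m → ℝ} {ε : ℕ → ℝ} {C : ℝ}
    (hρ : ∀ n, IsMollifier (ρ n) (ε n) C) (hε : Filter.Tendsto ε Filter.atTop (nhds 0))
    (hu : Integrable u) {g : Coord m → Spinor m} (hg : Continuous g) (hgc : HasCompactSupport g) :
    Filter.Tendsto (fun n => ∫ x, inner ℂ (mollify (ρ n) u x) (g x)) Filter.atTop
      (nhds (∫ x, inner ℂ (u x) (g x))) := by
  have hgi : Integrable g := hg.integrable_of_hasCompactSupport hgc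
  obtain ⟨Cg, hCg⟩ := hgc.exists_bound_of_continuous hg
  have huc := hgc.uniformContinuous_of_continuous hg
  simp only [fun n => (hρ n).integral_inner_mollify hu hgi]
  refine tendsto_integral_of_dominated_convergence (fun y => ‖u y‖ * Cg) ?_ (hu.norm.mul_const _) ?_
    (Filter.Eventually.of_forall fun y => ?_)
  · intro n
    exact hu.1.inner ((hρ n).comp_neg.contDiff_mollify hgi).continuous.aestronglyMeasurable
  · intro n
    refine Filter.Eventually.of_forall fun y => (norm_inner_le_norm _ _).trans ?_
    refine mul_le_mul_of_nonneg_left ?_ (norm_nonneg _)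
    have := (hρ n).comp_neg.norm_mollify_sub_le hgi (y := y) (w := 0) (η := Cg)
      (fun x _ => by rw [sub_zero]; exact hCg x)
    rwa [sub_zero] at this
  · refine Filter.Tendsto.inner tendsto_const_nhds ?_
    rw [Metric.tendsto_atTop]
    intro η hη
    obtain ⟨δ, hδ, hδ'⟩ := Metric.uniformContinuous_iff.1 huc (η / 2) (by positivity)
    obtain ⟨N, hN⟩ := Metric.tendsto_atTop.1 hε δ hδ
    refine ⟨N, fun n hn => ?_⟩
    rw [dist_eq_norm]
    refine lt_of_le_of_lt ((hρ n).comp_neg.norm_mollify_sub_le hgi fun x hx => ?_)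
      (half_lt_self hη)
    rw [← dist_eq_norm]
    refine (hδ' ?_).le
    have h1 := hN n hn
    rw [Real.dist_eq, sub_zero, abs_of_pos (hρ n).pos] at h1
    exact (Metric.mem_closedBall.1 hx).trans_lt h1

end Mollifier

end TwistedDirac
end

noncomputable section

namespace TwistedDirac

/-! ### Friedrichs' commutator bound -/

section Friedrichs

variable {m : ℕ} {n : ℕ}

/-- A first-order operator with constant matrices in the symbol. -/
def firstOrder (A : Fin n → SpinorMatrix m) (E : Fin n → Coord m → Coord m)
    (B : Coord m → SpinorMatrix m) (u : Coord m → Spinor m) (y : Coord m) : Spinor m :=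
  (∑ a, act (A a) (fderiv ℝ u y (E a y))) + act (B y) (u y)

theorem continuous_actMatrix : Continuous (act : SpinorMatrix m → Spinor m →L[ℂ] Spinor m) :=
  LinearMap.continuous_of_finiteDimensional
    ((Matrix.toEuclideanCLM (n := Fin (2 ^ m)) (𝕜 := ℂ)).toAlgEquiv.toLinearMap)

theorem continuousOn_actMatrix {X : Type*} [TopologicalSpace X] {B : X → SpinorMatrix m} {U : Set X}
    (hB : ∀ k l, ContinuousOn (fun y => B y k l) U) : ContinuousOn (fun y => act (B y)) U :=
  continuous_actMatrix.comp_continuousOn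
    (continuousOn_pi.2 fun k => continuousOn_pi.2 fun l => hB k l)

theorem act_real_smul (A : SpinorMatrix m) (c : ℝ) (v : Spinor m) : act A (c • v) = c • act A v :=
  (act A).map_smul_of_tower c v

theorem integrable_inner_of_compactSupport {g u : Coord m → Spinor m} (hg : Continuous g)
    (hgc : HasCompactSupport g) (hu : Integrable u) : Integrable fun y => inner ℂ (g y) (u y) := by
  obtain ⟨C, hC⟩ := hgc.exists_bound_of_continuous hg
  refine (hu.norm.const_mul C).mono' (hg.aestronglyMeasurable.inner hu.1) ?_
  refine Filter.Eventually.of_forall fun y => (norm_inner_le_norm _ _).trans ?_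
  exact mul_le_mul_of_nonneg_right (hC y) (norm_nonneg _)

theorem inner_integral_smul {c : Coord m → ℝ} {u : Coord m → Spinor m} (s : Spinor m)
    (h : Integrable fun y => c y • u y) :
    inner ℂ s (∫ y, c y • u y) = ∫ y, inner ℂ (c y • s) (u y) := by
  rw [← integral_inner h]
  refine integral_congr_ae (Filter.Eventually.of_forall fun y => ?_)
  simp only
  rw [inner_smul_left_eq_smul, inner_smul_right_eq_smul]

variable {A : Fin n → SpinorMatrix m} {E : Fin n → Coord m → Coord m}
  {B₁ B₂ : Coord m → SpinorMatrix m} {U : Set (Coord m)}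

/-- The derivative falls on the kernel, and skewness of `A a` moves the matrix to the other side
with a sign. The vector fields are frozen at `x`, whereas in `firstOrder_test` they are evaluated at
`y`. The comparison of the two is the commutator estimate. -/
theorem inner_firstOrder_mollify (hA : ∀ a, (A a)ᴴ = -A a)
    {ε C : ℝ} {ρ : Coord m → ℝ} (hρ : IsMollifier ρ ε C) {u : Coord m → Spinor m}
    (hu : Integrable u) (x : Coord m) (z : Spinor m) :
    inner ℂ z (firstOrder A E B₂ (mollify ρ u) x) =
      ∫ y, inner ℂ ((∑ a, -(fderiv ℝ ρ (x - y) (E a x)) • act (A a) z) +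
        ρ (x - y) • act (B₂ x)ᴴ z) (u y) := by
  have hdi : ∀ v, Integrable fun y => (fderiv ℝ ρ (x - y) v) • u y := by
    intro v
    have hc : Continuous fun y => fderiv ℝ ρ (x - y) v :=
      ((hρ.smooth.continuous_fderiv (by simp)).comp (continuous_const.sub continuous_id)).clm_apply
        continuous_const
    refine (hu.norm.const_mul (C * (ε⁻¹) ^ (2 * m) * ε⁻¹ * ‖v‖)).mono'
      (hc.aestronglyMeasurable.smul hu.1) (Filter.Eventually.of_forall fun y => ?_)
    rw [norm_smul]
    refine mul_le_mul_of_nonneg_right ?_ (norm_nonneg _)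
    exact ((fderiv ℝ ρ (x - y)).le_opNorm v).trans
      (mul_le_mul_of_nonneg_right (hρ.bound_fderiv _) (norm_nonneg _))
  have h1 : ∀ a, inner ℂ z (act (A a) (fderiv ℝ (mollify ρ u) x (E a x))) =
      ∫ y, inner ℂ (-(fderiv ℝ ρ (x - y) (E a x)) • act (A a) z) (u y) := by
    intro a
    have e : inner ℂ z (act (A a) (fderiv ℝ (mollify ρ u) x (E a x))) =
        inner ℂ (act (A a)ᴴ z) (fderiv ℝ (mollify ρ u) x (E a x)) := by
      rw [inner_act_left, Matrix.conjTranspose_conjTranspose]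
    rw [e, hρ.fderiv_mollify hu, inner_integral_smul _ (hdi _), hA]
    simp only [act_neg, smul_neg, neg_smul]
  have h2 : inner ℂ z (act (B₂ x) (mollify ρ u x)) =
      ∫ y, inner ℂ (ρ (x - y) • act (B₂ x)ᴴ z) (u y) := by
    have e : inner ℂ z (act (B₂ x) (mollify ρ u x)) =
        inner ℂ (act (B₂ x)ᴴ z) (mollify ρ u x) := by
      rw [inner_act_left, Matrix.conjTranspose_conjTranspose]
    rw [e, mollify, inner_integral_smul _ (hρ.integrable_smul hu x)]
  have i1 : ∀ a, Integrable fun y =>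
      inner ℂ (-(fderiv ℝ ρ (x - y) (E a x)) • act (A a) z) (u y) := by
    intro a
    refine (((hdi (E a x)).const_inner (𝕜 := ℂ) (act (A a) z)).neg).congr
      (Filter.Eventually.of_forall fun y => ?_)
    simp only [Pi.neg_apply]
    rw [inner_smul_left_eq_smul, inner_smul_right_eq_smul, neg_smul]
  have i2 : Integrable fun y => inner ℂ (ρ (x - y) • act (B₂ x)ᴴ z) (u y) := by
    refine ((hρ.integrable_smul hu x).const_inner (𝕜 := ℂ) (act (B₂ x)ᴴ z)).congr
      (Filter.Eventually.of_forall fun y => ?_)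
    simp only
    rw [inner_smul_left_eq_smul, inner_smul_right_eq_smul]
  rw [firstOrder, inner_add_right, inner_sum, Finset.sum_congr rfl fun a _ => h1 a, h2,
    ← integral_finsetSum _ fun a _ => i1 a, ← integral_add (integrable_finsetSum _ fun a _ => i1 a) i2]
  refine integral_congr_ae (Filter.Eventually.of_forall fun y => ?_)
  simp only [inner_add_left, sum_inner]

theorem firstOrder_test {ε C : ℝ} {ρ : Coord m → ℝ} (hρ : IsMollifier ρ ε C) (x y : Coord m)
    (z : Spinor m) : firstOrder A E B₁ (fun y => ρ (x - y) • z) y =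
      (∑ a, -(fderiv ℝ ρ (x - y) (E a y)) • act (A a) z) + ρ (x - y) • act (B₁ y) z := by
  have h1 : HasFDerivAt (fun y => ρ (x - y) • z)
      (((fderiv ℝ ρ (x - y)).comp (-ContinuousLinearMap.id ℝ (Coord m))).smulRight z) y :=
    (((hρ.smooth.differentiable (by simp)) (x - y)).hasFDerivAt.comp y
      ((hasFDerivAt_id y).const_sub x)).smul_const z
  rw [firstOrder, h1.fderiv, act_real_smul]
  congr 1
  refine Finset.sum_congr rfl fun a _ => ?_
  rw [← act_real_smul]
  simp

/-- Friedrichs' cancellation: the gradient of the kernel costs a factor `ε⁻¹`, and the difference of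
the vector fields on the ball gains a factor `ε`. The zeroth-order terms are only bounded, so `B₁`
and `B₂` need not be related. -/
theorem norm_firstOrder_test_sub_le {ε C b1 b2 : ℝ} {ρ : Coord m → ℝ} (hρ : IsMollifier ρ ε C)
    (hC : 0 ≤ C) {L : Fin n → ℝ} (hL0 : ∀ a, 0 ≤ L a) {x y : Coord m} (z : Spinor m)
    (hE : ∀ a, ‖E a y - E a x‖ ≤ L a * ε) (hb1 : ‖act (B₁ y)‖ ≤ b1) (hb2 : ‖act (B₂ x)‖ ≤ b2) :
    ‖((∑ a, -(fderiv ℝ ρ (x - y) (E a x)) • act (A a) z) + ρ (x - y) • act (B₂ x)ᴴ z) -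
        firstOrder A E B₁ (fun y => ρ (x - y) • z) y‖ ≤
      C * (ε⁻¹) ^ (2 * m) * (∑ a, L a * ‖act (A a)‖ + (b1 + b2)) * ‖z‖ := by
  have hε := hρ.pos
  obtain ⟨T, hT⟩ : ∃ T, T = C * (ε⁻¹) ^ (2 * m) := ⟨_, rfl⟩
  have hT0 : 0 ≤ T := by rw [hT]; positivity
  have e1 : ((∑ a, -(fderiv ℝ ρ (x - y) (E a x)) • act (A a) z) + ρ (x - y) • act (B₂ x)ᴴ z) -
        firstOrder A E B₁ (fun y => ρ (x - y) • z) y =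
      (∑ a, (fderiv ℝ ρ (x - y) (E a y - E a x)) • act (A a) z) +
      ρ (x - y) • (act (B₂ x)ᴴ z - act (B₁ y) z) := by
    rw [firstOrder_test hρ]
    simp only [map_sub, sub_smul, neg_smul, Finset.sum_sub_distrib, Finset.sum_neg_distrib,
      smul_sub]
    abel
  have e2 : ∀ a, ‖(fderiv ℝ ρ (x - y) (E a y - E a x)) • act (A a) z‖ ≤
      T * (L a * ‖act (A a)‖) * ‖z‖ := by
    intro a
    have hLa := hL0 a
    rw [norm_smul]
    calc _ ≤ (T * ε⁻¹ * (L a * ε)) * (‖act (A a)‖ * ‖z‖) := by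
          refine mul_le_mul ?_ ((act (A a)).le_opNorm z) (norm_nonneg _) (by positivity)
          refine ((fderiv ℝ ρ (x - y)).le_opNorm _).trans ?_
          rw [hT]
          exact mul_le_mul (hρ.bound_fderiv _) (hE a) (norm_nonneg _) (by positivity)
      _ = (ε⁻¹ * ε) * (T * (L a * ‖act (A a)‖) * ‖z‖) := by ring
      _ = _ := by rw [inv_mul_cancel₀ hε.ne', one_mul]
  have e3 : ‖ρ (x - y) • (act (B₂ x)ᴴ z - act (B₁ y) z)‖ ≤ T * (b1 + b2) * ‖z‖ := by
    have h1 : ‖act (B₂ x)ᴴ z‖ ≤ b2 * ‖z‖ := by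
      refine ((act (B₂ x)ᴴ).le_opNorm z).trans ?_
      rw [act_conjTranspose_eq_adjoint, LinearIsometryEquiv.norm_map]
      exact mul_le_mul_of_nonneg_right hb2 (norm_nonneg _)
    have h2 : ‖act (B₁ y) z‖ ≤ b1 * ‖z‖ :=
      ((act (B₁ y)).le_opNorm z).trans (mul_le_mul_of_nonneg_right hb1 (norm_nonneg _))
    rw [norm_smul, mul_assoc]
    refine mul_le_mul (hT ▸ hρ.bound _) ?_ (norm_nonneg _) hT0
    refine (norm_sub_le _ _).trans ?_
    rw [add_mul]
    linarith
  rw [e1, ← hT]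
  refine (norm_add_le _ _).trans ((add_le_add ((norm_sum_le _ _).trans
    (Finset.sum_le_sum fun a _ => e2 a)) e3).trans (le_of_eq ?_))
  rw [← Finset.sum_mul, ← Finset.mul_sum]
  ring

/-- The weak equation is tested on the kernel `ρ(x - ·) z`, admissible because the ball lies in `U`.
Adding and subtracting it leaves a commutator term in `u` and a mollification of `h`. -/
theorem inner_firstOrder_mollify_eq (hA : ∀ a, (A a)ᴴ = -A a) (hU : IsOpen U)
    (hE : ∀ a, ContDiffOn ℝ ∞ (E a) U) (hB₁ : ∀ k l, ContinuousOn (fun y => B₁ y k l) U)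
    {ε C : ℝ} {ρ : Coord m → ℝ} (hρ : IsMollifier ρ ε C) {u h : Coord m → Spinor m}
    (hu : Integrable u) (hh : Integrable h)
    (hweak : ∀ φ : Coord m → Spinor m, ContDiff ℝ ∞ φ → ∀ L, IsCompact L → L ⊆ U →
        (∀ y, y ∉ L → φ y = 0) →
        ∫ y, inner ℂ (firstOrder A E B₁ φ y) (u y) = ∫ y, inner ℂ (φ y) (h y))
    {x : Coord m} (hx : Metric.closedBall x ε ⊆ U) (z : Spinor m) :
    inner ℂ z (firstOrder A E B₂ (mollify ρ u) x) =
      ∫ y, (inner ℂ (((∑ a, -(fderiv ℝ ρ (x - y) (E a x)) • act (A a) z) +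
        ρ (x - y) • act (B₂ x)ᴴ z) - firstOrder A E B₁ (fun y => ρ (x - y) • z) y) (u y) +
        inner ℂ (ρ (x - y) • z) (h y)) := by
  have hball : IsCompact (Metric.closedBall x ε) := isCompact_closedBall x ε
  have hρc : Continuous fun y => ρ (x - y) :=
    hρ.smooth.continuous.comp (continuous_const.sub continuous_id)
  have hρ'c : Continuous fun y => fderiv ℝ ρ (x - y) :=
    (hρ.smooth.continuous_fderiv (by simp)).comp (continuous_const.sub continuous_id)
  have hoff : ∀ y, y ∉ Metric.closedBall x ε → ρ (x - y) = 0 ∧ fderiv ℝ ρ (x - y) = 0 :=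
    fun y hy => ⟨hρ.zero_off _ (IsMollifier.notMem_sub hy),
      hρ.fderiv_zero_off (IsMollifier.notMem_sub hy)⟩
  have hg1off : ∀ y, y ∉ Metric.closedBall x ε →
      firstOrder A E B₁ (fun y => ρ (x - y) • z) y = 0 := fun y hy => by
    rw [firstOrder_test hρ, (hoff y hy).1, (hoff y hy).2]; simp
  have hg1c : Continuous (firstOrder A E B₁ (fun y => ρ (x - y) • z)) := by
    refine continuous_of_eq_zero_off hU hball.isClosed hx ?_ hg1off
    refine ContinuousOn.congr ?_ fun y _ => firstOrder_test hρ x y z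
    refine ContinuousOn.add (continuousOn_finsetSum _ fun a _ => ?_) ?_
    · exact ((hρ'c.continuousOn.clm_apply (hE a).continuousOn).neg).smul continuousOn_const
    · exact hρc.continuousOn.smul (continuousOn_act hB₁ continuousOn_const)
  have hg2c : Continuous fun y => (∑ a, -(fderiv ℝ ρ (x - y) (E a x)) • act (A a) z) +
      ρ (x - y) • act (B₂ x)ᴴ z := by
    refine Continuous.add (continuous_finsetSum _ fun a _ => ?_) ?_
    · exact ((hρ'c.clm_apply continuous_const).neg).smul continuous_const
    · exact hρc.smul continuous_const
  have i1 := integrable_inner_of_compactSupport hg1c (HasCompactSupport.intro hball hg1off) hu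
  have i2 := integrable_inner_of_compactSupport hg2c
    (HasCompactSupport.intro hball fun y hy => by
      rw [(hoff y hy).1, (hoff y hy).2]; simp) hu
  have hρz : ∀ y, y ∉ Metric.closedBall x ε → ρ (x - y) • z = 0 := fun y hy => by
    rw [(hoff y hy).1, zero_smul]
  have i3 : Integrable fun y => inner ℂ (ρ (x - y) • z) (h y) :=
    integrable_inner_of_compactSupport (g := fun y => ρ (x - y) • z)
      (hρc.smul continuous_const) (HasCompactSupport.intro hball hρz) hh
  have e2 := hweak (fun y => ρ (x - y) • z)
    ((hρ.smooth.comp (contDiff_const.sub contDiff_id)).smul contDiff_const) _ hball hx hρz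
  rw [inner_firstOrder_mollify hA hρ hu x z]
  simp only [inner_sub_left] at i1 i2 i3 ⊢
  refine Eq.trans ?_ (integral_add (i2.sub i1) i3).symm
  refine Eq.trans ?_ (congrArg (· + _) (integral_sub i2 i1).symm)
  rw [← e2, sub_add_cancel]

theorem norm_firstOrder_mollify_le (hA : ∀ a, (A a)ᴴ = -A a) (hU : IsOpen U)
    (hE : ∀ a, ContDiffOn ℝ ∞ (E a) U) (hB₁ : ∀ k l, ContinuousOn (fun y => B₁ y k l) U)
    {ε C b1 b2 : ℝ} (hC : 0 ≤ C) {L : Fin n → ℝ} (hL0 : ∀ a, 0 ≤ L a) {ρ : Coord m → ℝ}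
    (hρ : IsMollifier ρ ε C) {u h : Coord m → Spinor m}
    (hu : Integrable u) (hh : Integrable h)
    (hweak : ∀ φ : Coord m → Spinor m, ContDiff ℝ ∞ φ → ∀ L, IsCompact L → L ⊆ U →
        (∀ y, y ∉ L → φ y = 0) →
        ∫ y, inner ℂ (firstOrder A E B₁ φ y) (u y) = ∫ y, inner ℂ (φ y) (h y))
    {x : Coord m} (hx : Metric.closedBall x ε ⊆ U)
    (hLE : ∀ a, ∀ y ∈ Metric.closedBall x ε, ‖E a y - E a x‖ ≤ L a * ε)
    (hb1 : ∀ y ∈ Metric.closedBall x ε, ‖act (B₁ y)‖ ≤ b1) (hb2 : ‖act (B₂ x)‖ ≤ b2) :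
    ‖firstOrder A E B₂ (mollify ρ u) x‖ ≤
      C * (∑ a, L a * ‖act (A a)‖ + (b1 + b2) + 1) *
        ((ε⁻¹) ^ (2 * m) * ∫ y in Metric.closedBall x ε, (‖u y‖ + ‖h y‖)) := by
  have hε := hρ.pos
  -- The value to be estimated is itself taken as the test vector `z`. This bounds `‖z‖²` by a
  -- multiple of `‖z‖`, and one factor is cancelled at the end.
  have key := inner_firstOrder_mollify_eq (B₂ := B₂) hA hU hE hB₁ hρ hu hh hweak hx
    (firstOrder A E B₂ (mollify ρ u) x)
  generalize firstOrder A E B₂ (mollify ρ u) x = z at key ⊢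
  have hS0 : 0 ≤ ∑ a, L a * ‖act (A a)‖ + (b1 + b2) := by
    have h1 := (norm_nonneg _).trans (hb1 x (Metric.mem_closedBall_self hε.le))
    have h2 := (norm_nonneg _).trans hb2
    have h3 : 0 ≤ ∑ a, L a * ‖act (A a)‖ :=
      Finset.sum_nonneg fun a _ => mul_nonneg (hL0 a) (norm_nonneg _)
    linarith
  have hT0 : 0 ≤ C * (ε⁻¹) ^ (2 * m) := by positivity
  have hpt := fun y hy => norm_firstOrder_test_sub_le (A := A) (E := E) (B₁ := B₁) (B₂ := B₂) hρ hC hL0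
    z (fun a => hLE a y hy) (hb1 y hy) hb2
  have hoff : ∀ y, y ∉ Metric.closedBall x ε → ρ (x - y) = 0 ∧ fderiv ℝ ρ (x - y) = 0 :=
    fun y hy => ⟨hρ.zero_off _ (IsMollifier.notMem_sub hy),
      hρ.fderiv_zero_off (IsMollifier.notMem_sub hy)⟩
  generalize (∑ a, L a * ‖act (A a)‖ + (b1 + b2)) = S at hS0 hpt ⊢
  have hmain : ‖z‖ * ‖z‖ ≤ ‖z‖ * (C * (S + 1) * ((ε⁻¹) ^ (2 * m) *
      ∫ y in Metric.closedBall x ε, (‖u y‖ + ‖h y‖))) := by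
    have e1 : ‖z‖ * ‖z‖ = ‖inner ℂ z z‖ := by
      rw [inner_self_eq_norm_sq_to_K, ← sq]; simp
    have e2 : ‖z‖ * (C * (S + 1) * ((ε⁻¹) ^ (2 * m) *
      ∫ y in Metric.closedBall x ε, (‖u y‖ + ‖h y‖))) =
        ∫ y, (Metric.closedBall x ε).indicator
          (fun y => C * (ε⁻¹) ^ (2 * m) * (S + 1) * ‖z‖ * (‖u y‖ + ‖h y‖)) y := by
      rw [integral_indicator Metric.isClosed_closedBall.measurableSet, integral_const_mul]
      ring
    rw [e1, key, e2]
    refine norm_integral_le_of_norm_le (IntegrableOn.integrable_indicator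
      ((hu.norm.add hh.norm).const_mul _).integrableOn
      Metric.isClosed_closedBall.measurableSet) (Filter.Eventually.of_forall fun y => ?_)
    by_cases hy : y ∈ Metric.closedBall x ε
    · rw [Set.indicator_of_mem hy]
      have h1 := (norm_inner_le_norm (𝕜 := ℂ) _ (u y)).trans
        (mul_le_mul_of_nonneg_right (hpt y hy) (norm_nonneg (u y)))
      have h2 : ‖inner ℂ (ρ (x - y) • z) (h y)‖ ≤ C * (ε⁻¹) ^ (2 * m) * ‖z‖ * ‖h y‖ := by
        refine (norm_inner_le_norm _ _).trans (mul_le_mul_of_nonneg_right ?_ (norm_nonneg _))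
        rw [norm_smul]
        exact mul_le_mul_of_nonneg_right (hρ.bound _) (norm_nonneg _)
      refine (norm_add_le _ _).trans ((add_le_add h1 h2).trans ?_)
      have h4 := mul_nonneg (mul_nonneg hT0 (norm_nonneg z)) (norm_nonneg (u y))
      have h5 := mul_nonneg (mul_nonneg (mul_nonneg hT0 (norm_nonneg z)) (norm_nonneg (h y))) hS0
      generalize C * (ε⁻¹) ^ (2 * m) = T at *
      have e3 : T * (S + 1) * ‖z‖ * (‖u y‖ + ‖h y‖) = T * S * ‖z‖ * ‖u y‖ + T * ‖z‖ * ‖h y‖ +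
        T * ‖z‖ * ‖u y‖ + T * ‖z‖ * ‖h y‖ * S := by ring
      rw [e3]
      linarith
    · rw [Set.indicator_of_notMem hy, firstOrder_test hρ, (hoff y hy).1, (hoff y hy).2]
      simp
  by_cases h0 : ‖z‖ = 0
  · rw [h0]
    have h1 : 0 ≤ ∫ y in Metric.closedBall x ε, (‖u y‖ + ‖h y‖) :=
      integral_nonneg fun y => add_nonneg (norm_nonneg _) (norm_nonneg _)
    exact mul_nonneg (mul_nonneg hC (by linarith))
      (mul_nonneg (pow_nonneg (inv_nonneg.2 hε.le) _) h1)
  · exact le_of_mul_le_mul_left hmain (lt_of_le_of_ne (norm_nonneg _) (Ne.symm h0))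

/-- Compactness of `K` bounds the derivatives of the vector fields and the potentials, so the
constant depends neither on `ε` nor on `u` and `h`. The mean value inequality on the convex ball
supplies the Lipschitz estimate. -/
theorem exists_firstOrder_mollify_bound (hA : ∀ a, (A a)ᴴ = -A a) (hU : IsOpen U)
    (hE : ∀ a, ContDiffOn ℝ ∞ (E a) U) (hB₁ : ∀ k l, ContinuousOn (fun y => B₁ y k l) U)
    (hB₂ : ∀ k l, ContinuousOn (fun y => B₂ y k l) U) {K : Set (Coord m)} (hK : IsCompact K)
    (hKU : K ⊆ U) {C : ℝ} (hC : 0 ≤ C) :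
    ∃ C' : ℝ, 0 ≤ C' ∧ ∀ (ε : ℝ) (ρ : Coord m → ℝ), IsMollifier ρ ε C →
      ∀ u h : Coord m → Spinor m, Integrable u → Integrable h →
      (∀ φ : Coord m → Spinor m, ContDiff ℝ ∞ φ → ∀ L, IsCompact L → L ⊆ U →
        (∀ y, y ∉ L → φ y = 0) →
        ∫ y, inner ℂ (firstOrder A E B₁ φ y) (u y) = ∫ y, inner ℂ (φ y) (h y)) →
      ∀ x, Metric.closedBall x ε ⊆ K →
        ‖firstOrder A E B₂ (mollify ρ u) x‖ ≤
          C' * ((ε⁻¹) ^ (2 * m) * ∫ y in Metric.closedBall x ε, (‖u y‖ + ‖h y‖)) := by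
  have hL : ∀ a, ∃ L, ∀ y ∈ K, ‖fderiv ℝ (E a) y‖ ≤ L := fun a =>
    hK.exists_bound_of_continuousOn
      (((hE a).continuousOn_fderiv_of_isOpen hU (by simp)).mono hKU)
  choose L hL using hL
  obtain ⟨b1, hb1⟩ := hK.exists_bound_of_continuousOn ((continuousOn_actMatrix hB₁).mono hKU)
  obtain ⟨b2, hb2⟩ := hK.exists_bound_of_continuousOn ((continuousOn_actMatrix hB₂).mono hKU)
  refine ⟨C * (∑ a, |L a| * ‖act (A a)‖ + (|b1| + |b2|) + 1), by positivity,
    fun ε ρ hρ u h hu hh hweak x hx => ?_⟩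
  have hε := hρ.pos
  refine norm_firstOrder_mollify_le hA hU hE hB₁ hC (fun a => abs_nonneg _) hρ hu hh hweak
    (hx.trans hKU) (fun a y hy => ?_) (fun y hy => (hb1 y (hx hy)).trans (le_abs_self _))
    ((hb2 x (hx (Metric.mem_closedBall_self hε.le))).trans (le_abs_self _))
  have h2 := Convex.norm_image_sub_le_of_norm_fderiv_le (𝕜 := ℝ) (f := E a) (C := |L a|)
    (s := Metric.closedBall x ε) (x := x) (y := y)
    (fun w hw => ((hE a).contDiffAt (hU.mem_nhds (hKU (hx hw)))).differentiableAt (by simp))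
    (fun w hw => (hL a w (hx hw)).trans (le_abs_self _)) (convex_closedBall x ε)
    (Metric.mem_closedBall_self hε.le) hy
  refine h2.trans (mul_le_mul_of_nonneg_left ?_ (abs_nonneg _))
  rw [← dist_eq_norm]
  exact hy

end Friedrichs

end TwistedDirac
end

/-! ### Smooth approximation of weak solutions of the local Dirac equation. -/

noncomputable section

namespace TwistedDirac

section Approximation

variable {m : ℕ} {Δ : DiracMatrices m} {E : Fin (2 * m) → Coord m → Coord m} {U : Set (Coord m)}

theorem locDirac_eq_firstOrder (u : Coord m → Spinor m) :
    locDirac Δ E u = firstOrder (fun a => (-Complex.I) • Δ.gamma a) E (locPotential Δ E) u :=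
  funext fun y => locDirac_eq Δ E u y

/-- The zeroth-order term of the operator `w P w⁻¹`, for `P` the local Dirac operator and `w` the
density of the frame. -/
def weightedPotential (Δ : DiracMatrices m) (E : Fin (2 * m) → Coord m → Coord m) (y : Coord m) :
    SpinorMatrix m :=
  locPotential Δ E y + ∑ a, ((frameDensity E y *
    fderiv ℝ (fun z => (frameDensity E z)⁻¹) y (E a y) : ℝ) : ℂ) • ((-Complex.I) • Δ.gamma a)

theorem continuousOn_weightedPotential (hE : IsFrameOn E U) (k l : Fin (2 ^ m)) :
    ContinuousOn (fun y => weightedPotential Δ E y k l) U := by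
  have hd : ContDiffOn ℝ ∞ (fun z => (frameDensity E z)⁻¹) U :=
    hE.contDiffOn_density.inv fun y hy => (hE.density_pos hy).ne'
  simp only [weightedPotential, Matrix.add_apply, Matrix.sum_apply, Matrix.smul_apply]
  refine ((contDiffOn_locPotential hE k l).continuousOn).add
    (continuousOn_finsetSum _ fun a _ => ContinuousOn.smul (f := fun y => ((frameDensity E y *
      fderiv ℝ (fun z => (frameDensity E z)⁻¹) y (E a y) : ℝ) : ℂ)) ?_ continuousOn_const)
  exact Complex.continuous_ofReal.comp_continuousOn (hE.contDiffOn_density.continuousOn.mul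
    ((hd.continuousOn_fderiv_of_isOpen hE.isOpen (by simp)).clm_apply (hE.smooth a).continuousOn))

/-- The local Dirac operator is formally symmetric for the measure `w dx`, so its formal adjoint for
Lebesgue measure is `w P w⁻¹`. It has the same first-order part as `P`, and Friedrichs' estimate
applies with different potentials. -/
theorem density_smul_locDirac (hE : IsFrameOn E U) {φ : Coord m → Spinor m} {y : Coord m}
    (hφ : DifferentiableAt ℝ φ y) (hy : y ∈ U) :
    frameDensity E y • locDirac Δ E (fun z => (frameDensity E z)⁻¹ • φ z) y =
      firstOrder (fun a => (-Complex.I) • Δ.gamma a) E (weightedPotential Δ E) φ y := by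
  have hw := (hE.density_pos hy).ne'
  have hd : DifferentiableAt ℝ (fun z => (frameDensity E z)⁻¹) y :=
    ((hE.contDiffOn_density.contDiffAt (hE.isOpen.mem_nhds hy)).differentiableAt (by simp)).inv hw
  rw [locDirac_eq, firstOrder, weightedPotential, act_add, act_sum]
  simp only [fderiv_fun_smul hd hφ, act_smul]
  simp only [_root_.add_apply, _root_.smul_apply,
    ContinuousLinearMap.smulRight_apply, map_add, act_real_smul, smul_add, Finset.sum_add_distrib,
    Finset.smul_sum, smul_comm (-Complex.I) (_ : ℝ), smul_smul, mul_inv_cancel₀ hw, one_smul]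
  rw [add_assoc, add_comm (act _ (φ y))]
  congr 2
  refine Finset.sum_congr rfl fun a _ => ?_
  rw [← Complex.coe_smul, smul_smul, mul_comm]

/-- A compactly supported weak solution of a Dirac equation with square integrable right-hand side
is a weak limit of smooth functions that are bounded in the graph norm. -/
theorem exists_weak_approximation (hE : IsFrameOn E U) {K₀ : Set (Coord m)} (hK₀ : IsCompact K₀)
    (hKU : K₀ ⊆ U) {u h : Coord m → Spinor m} (hu : Integrable u) (hh : Integrable h)
    (hu2 : MemLp u 2 volume) (hh2 : MemLp h 2 volume) (h0 : ∀ y, y ∉ K₀ → u y = 0)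
    (hweak : ∀ φ : Coord m → Spinor m, ContDiff ℝ ∞ φ → ∀ L, IsCompact L → L ⊆ U →
      (∀ y, y ∉ L → φ y = 0) →
      ∫ y in U, frameDensity E y • inner ℂ (locDirac Δ E φ y) (u y) =
        ∫ y in U, frameDensity E y • inner ℂ (φ y) (h y)) :
    ∃ (K : Set (Coord m)) (C : ℝ≥0∞) (Ψ : ℕ → Coord m → Spinor m), IsCompact K ∧ K ⊆ U ∧ C ≠ ⊤ ∧
      (∀ n, ContDiff ℝ ∞ (Ψ n)) ∧ (∀ n y, y ∉ K → Ψ n y = 0) ∧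
      (∀ n, ∫⁻ y, ‖Ψ n y‖ₑ ^ 2 ≤ C) ∧ (∀ n, ∫⁻ y, ‖locDirac Δ E (Ψ n) y‖ₑ ^ 2 ≤ C) ∧
      ∀ g : Coord m → Spinor m, Continuous g → HasCompactSupport g →
        Filter.Tendsto (fun n => ∫ y, inner ℂ (Ψ n y) (g y)) Filter.atTop
          (nhds (∫ y, inner ℂ (u y) (g y))) := by
  have hUo := hE.isOpen
  obtain ⟨δ, hδ, hδU⟩ := hK₀.exists_cthickening_subset_open hUo hKU
  have hKc : IsCompact (Metric.cthickening δ K₀) := hK₀.cthickening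
  obtain ⟨C, hC0, hC⟩ := exists_isMollifier m
  have hweak' : ∀ φ : Coord m → Spinor m, ContDiff ℝ ∞ φ → ∀ L, IsCompact L → L ⊆ U →
      (∀ y, y ∉ L → φ y = 0) →
      ∫ y, inner ℂ (firstOrder (fun a => (-Complex.I) • Δ.gamma a) E (weightedPotential Δ E) φ y)
        (u y) = ∫ y, inner ℂ (φ y) (h y) := by
    intro φ hφ L hL hLU hφ0
    have hd : ContDiff ℝ ∞ (fun z => (frameDensity E z)⁻¹ • φ z) :=
      contDiff_of_eq_zero_off hUo hL.isClosed hLU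
        ((hE.contDiffOn_density.inv fun y hy => (hE.density_pos hy).ne').smul hφ.contDiffOn)
        fun y hy => by rw [hφ0 y hy, smul_zero]
    -- Testing with `w⁻¹ φ` removes the density from the weak equation.
    have key := hweak _ hd L hL hLU fun y hy => by rw [hφ0 y hy, smul_zero]
    have e1 : ∀ y ∈ U, frameDensity E y • inner ℂ (locDirac Δ E
        (fun z => (frameDensity E z)⁻¹ • φ z) y) (u y) =
        inner ℂ (firstOrder (fun a => (-Complex.I) • Δ.gamma a) E (weightedPotential Δ E) φ y)
          (u y) := by
      intro y hy
      rw [← density_smul_locDirac hE (hφ.differentiable (by simp) y) hy, inner_smul_left_eq_smul]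
    have e2 : ∀ y ∈ U, frameDensity E y • inner ℂ ((frameDensity E y)⁻¹ • φ y) (h y) =
        inner ℂ (φ y) (h y) := by
      intro y hy
      rw [inner_smul_left_eq_smul, smul_smul, mul_inv_cancel₀ (hE.density_pos hy).ne', one_smul]
    rw [setIntegral_congr_fun hUo.measurableSet e1, setIntegral_congr_fun hUo.measurableSet e2,
      setIntegral_eq_integral_of_forall_compl_eq_zero,
      setIntegral_eq_integral_of_forall_compl_eq_zero] at key
    · exact key
    · intro y hy
      rw [hφ0 y fun hy' => hy (hLU hy'), inner_zero_left]
    · intro y hy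
      rw [h0 y fun hy' => hy (hKU hy'), inner_zero_right]
  have hA : ∀ a, ((-Complex.I) • Δ.gamma a)ᴴ = -((-Complex.I) • Δ.gamma a) := by
    intro a
    rw [Matrix.conjTranspose_smul, Δ.gamma_conjTranspose]
    simp
  obtain ⟨C', hC'0, hC'⟩ := exists_firstOrder_mollify_bound (B₁ := weightedPotential Δ E)
    (B₂ := locPotential Δ E) hA hUo hE.smooth (continuousOn_weightedPotential hE)
    (fun k l => (contDiffOn_locPotential hE k l).continuousOn) hKc hδU hC0
  -- The radius is at most `δ / 2` because it is used twice: the mollified function lives in the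
  -- thickening of `K₀` by the radius, and the balls about points of that set must remain in the
  -- thickening by `δ`.
  have hε0 : ∀ n : ℕ, 0 < δ / 2 / ((n : ℝ) + 1) := fun n => by positivity
  have hεδ : ∀ n : ℕ, δ / 2 / ((n : ℝ) + 1) ≤ δ / 2 := fun n =>
    div_le_self (by positivity) (by linarith [(Nat.cast_nonneg n : (0 : ℝ) ≤ n)])
  choose! ρ hρ using hC
  have hρ' := fun n : ℕ => hρ _ (hε0 n)
  have hzero : ∀ n : ℕ, ∀ y, y ∉ Metric.cthickening (δ / 2 / ((n : ℝ) + 1)) K₀ →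
      mollify (ρ (δ / 2 / ((n : ℝ) + 1))) u y = 0 := fun n y hy =>
    (hρ' n).mollify_eq_zero h0 fun z hz hzy => hy
      (Metric.closedBall_subset_cthickening hz _ (Metric.mem_closedBall_comm.1 hzy))
  have hf0 : ∀ y, 0 ≤ ‖u y‖ + ‖h y‖ := fun y => add_nonneg (norm_nonneg _) (norm_nonneg _)
  have hf2 : Integrable fun y => (‖u y‖ + ‖h y‖) ^ 2 := (hu2.norm.add hh2.norm).integrable_sq
  have hf : Integrable fun y => ‖u y‖ + ‖h y‖ := hu.norm.add hh.norm
  have hbd : ∀ n : ℕ, ∀ x, ‖locDirac Δ E (mollify (ρ (δ / 2 / ((n : ℝ) + 1))) u) x‖ ≤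
      C' * (((δ / 2 / ((n : ℝ) + 1))⁻¹) ^ (2 * m) *
        ∫ y in Metric.closedBall x (δ / 2 / ((n : ℝ) + 1)), (‖u y‖ + ‖h y‖)) := by
    intro n x
    by_cases hx : x ∈ Metric.cthickening (δ / 2 / ((n : ℝ) + 1)) K₀
    · rw [locDirac_eq_firstOrder]
      refine hC' _ _ (hρ' n) u h hu hh hweak' x ?_
      refine ((Metric.closedBall_subset_cthickening hx _).trans
        (Metric.cthickening_cthickening_subset (hε0 n).le (hε0 n).le _)).trans
        (Metric.cthickening_mono ?_ _)
      linarith [hεδ n]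
    · rw [locDirac_eq, fderiv_eq_zero_off Metric.isClosed_cthickening (hzero n) hx, hzero n x hx]
      simp only [_root_.zero_apply, map_zero, Finset.sum_const_zero, add_zero,
        norm_zero]
      exact mul_nonneg hC'0 (mul_nonneg (pow_nonneg (inv_nonneg.2 (hε0 n).le) _)
        (integral_nonneg hf0))
  have hbd0 : ∀ n : ℕ, ∀ x, ‖mollify (ρ (δ / 2 / ((n : ℝ) + 1))) u x‖ ≤
      C * (((δ / 2 / ((n : ℝ) + 1))⁻¹) ^ (2 * m) *
        ∫ y in Metric.closedBall x (δ / 2 / ((n : ℝ) + 1)), (‖u y‖ + ‖h y‖)) := by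
    intro n x
    refine ((hρ' n).norm_mollify_le hu x).trans (mul_le_mul_of_nonneg_left
      (mul_le_mul_of_nonneg_left ?_ (pow_nonneg (inv_nonneg.2 (hε0 n).le) _)) hC0)
    exact integral_mono hu.norm.integrableOn hf.integrableOn
      fun y => le_add_of_nonneg_right (norm_nonneg _)
  obtain ⟨I, hI⟩ : ∃ I, I = volume (Metric.ball (0 : Coord m) 1) ^ 2 *
      ENNReal.ofReal (∫ y, (‖u y‖ + ‖h y‖) ^ 2) := ⟨_, rfl⟩
  have hIfin : I ≠ ⊤ := hI ▸ ENNReal.mul_ne_top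
    (ENNReal.pow_ne_top measure_ball_lt_top.ne) ENNReal.ofReal_ne_top
  refine ⟨Metric.cthickening δ K₀, ENNReal.ofReal C ^ 2 * I + ENNReal.ofReal C' ^ 2 * I,
    fun n => mollify (ρ (δ / 2 / ((n : ℝ) + 1))) u, hKc, hδU, ?_, fun n => (hρ' n).contDiff_mollify hu,
    fun n y hy => hzero n y fun hy' => hy (Metric.cthickening_mono
      ((hεδ n).trans (by linarith)) _ hy'), fun n => ?_, fun n => ?_, fun g hg hgc => ?_⟩
  · exact ENNReal.add_ne_top.2 ⟨ENNReal.mul_ne_top (ENNReal.pow_ne_top ENNReal.ofReal_ne_top) hIfin,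
      ENNReal.mul_ne_top (ENNReal.pow_ne_top ENNReal.ofReal_ne_top) hIfin⟩
  · refine (integral_sq_le_of_average hf hf0 hf2 (hε0 n) hC0 (hbd0 n)).trans ?_
    rw [← hI]
    exact le_self_add
  · refine (integral_sq_le_of_average hf hf0 hf2 (hε0 n) hC'0 (hbd n)).trans ?_
    rw [← hI]
    exact le_add_self
  · refine tendsto_integral_inner_mollify hρ' ?_ hu hg hgc
    exact tendsto_const_nhds.div_atTop
      (Filter.tendsto_atTop_add_const_right _ _ tendsto_natCast_atTop_atTop)

end Approximation

end TwistedDirac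
end

/-! ### Frames, metric and structure functions in the coordinates of a chart. -/

noncomputable section

namespace TwistedDirac

namespace SpinStructure

section Coordinates

variable {m : ℕ} {M : Type*} [TopologicalSpace M] [ChartedSpace (Coord m) M]
  [IsManifold (𝓡 (2 * m)) ∞ M] {Δ : DiracMatrices m} {g : Metric (m := m) M}
  (S : SpinStructure Δ g)

theorem contMDiffOn_chart (i : ℕ) :
    ContMDiffOn (𝓡 (2 * m)) (𝓡 (2 * m)) ∞ (S.chart i) (S.chart i).source :=
  contMDiffOn_of_mem_maximalAtlas (S.chart_mem i)

theorem contMDiffOn_chart_symm (i : ℕ) :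
    ContMDiffOn (𝓡 (2 * m)) (𝓡 (2 * m)) ∞ (S.chart i).symm (S.chart i).target :=
  contMDiffOn_symm_of_mem_maximalAtlas (S.chart_mem i)

theorem mdifferentiable_chart (i : ℕ) :
    (S.chart i).MDifferentiable (𝓡 (2 * m)) (𝓡 (2 * m)) :=
  ⟨(S.contMDiffOn_chart i).mdifferentiableOn (by simp),
    (S.contMDiffOn_chart_symm i).mdifferentiableOn (by simp)⟩

/-- The domain of the `j`-th frame in the `i`-th chart. -/
def coordDomain (i j : ℕ) : Set (Coord m) :=
  (S.chart i).target ∩ (S.chart i).symm ⁻¹' (S.chart j).source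

/-- The vectors of the `j`-th frame in the coordinates of the `i`-th chart. -/
def coordFrame (i j : ℕ) (a : Fin (2 * m)) (y : Coord m) : Coord m :=
  VectorField.mpullback (𝓡 (2 * m)) (𝓡 (2 * m)) (S.chart i).symm (S.frame j a) y

theorem isOpen_coordDomain (i j : ℕ) : IsOpen (S.coordDomain i j) :=
  (S.chart i).isOpen_inter_preimage_symm (S.chart j).open_source

theorem coordDomain_self (i : ℕ) : S.coordDomain i i = (S.chart i).target :=
  Set.inter_eq_left.2 fun _ hy => (S.chart i).map_target hy

theorem isInvertible_mfderiv_symm {i : ℕ} {y : Coord m} (hy : y ∈ (S.chart i).target) :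
    (mfderiv (𝓡 (2 * m)) (𝓡 (2 * m)) (S.chart i).symm y).IsInvertible :=
  ⟨(S.mdifferentiable_chart i).symm.mfderiv hy, rfl⟩

theorem mfderiv_coordFrame {i : ℕ} (j : ℕ) (a : Fin (2 * m)) {y : Coord m}
    (hy : y ∈ (S.chart i).target) :
    mfderiv (𝓡 (2 * m)) (𝓡 (2 * m)) (S.chart i).symm y (S.coordFrame i j a y) =
      S.frame j a ((S.chart i).symm y) :=
  (S.isInvertible_mfderiv_symm hy).self_apply_inverse _

theorem contDiffOn_coordFrame (i j : ℕ) (a : Fin (2 * m)) :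
    ContDiffOn ℝ ∞ (S.coordFrame i j a) (S.coordDomain i j) := by
  refine contMDiffOn_vectorSpace_iff_contDiffOn.1 fun y hy => ?_
  have h1 := S.frame_smooth j a _ hy.2
  have h2 : ContMDiffAt (𝓡 (2 * m)) (𝓡 (2 * m)) ∞ (S.chart i).symm y :=
    (S.contMDiffOn_chart_symm i).contMDiffAt ((S.chart i).open_target.mem_nhds hy.1)
  exact (h1.mpullback_vectorField_preimage h2 (S.isInvertible_mfderiv_symm hy.1) (by simp)).mono
    fun z hz => hz.2

theorem sum_inner_frame_smul {j : ℕ} {x : M} (hx : x ∈ (S.chart j).source)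
    (v : TangentSpace (𝓡 (2 * m)) x) :
    ∑ b, g.inner x (S.frame j b x) v • S.frame j b x = v := by
  have hc : ∀ (c : Fin (2 * m) → ℝ) b,
      g.inner x (S.frame j b x) (∑ a, c a • S.frame j a x) = c b := fun c b => by
    simp [map_sum, S.frame_orthonormal j x hx]
  have hli : LinearIndependent ℝ fun b => S.frame j b x := by
    rw [Fintype.linearIndependent_iff]
    intro c h b
    rw [← hc c b, h, map_zero]
  have : FiniteDimensional ℝ (TangentSpace (𝓡 (2 * m)) x) :=
    inferInstanceAs (FiniteDimensional ℝ (Coord m))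
  have hspan : ⊤ ≤ Submodule.span ℝ (Set.range fun b => S.frame j b x) := by
    refine (hli.span_eq_top_of_card_eq_finrank' ?_).ge
    exact (Fintype.card_fin _).trans (finrank_euclideanSpace_fin (𝕜 := ℝ) (n := 2 * m)).symm
  obtain ⟨c, rfl⟩ := (Submodule.mem_span_range_iff_exists_fun ℝ).1 (hspan (Submodule.mem_top (x := v)))
  simp only [hc]

theorem sum_bilin_single (B : Coord m →L[ℝ] Coord m →L[ℝ] ℝ) (L : Coord m →L[ℝ] Coord m)
    (v w : Coord m) :
    ∑ ν, (∑ μ, v μ * B (L (EuclideanSpace.single μ 1)) (L (EuclideanSpace.single ν 1))) * w ν =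
      B (L v) (L w) := by
  have hsum : ∀ v : Coord m, v = ∑ μ, v μ • EuclideanSpace.single μ (1 : ℝ) := fun v => by
    ext k
    simp [Finset.sum_apply, Pi.single_apply]
  conv_rhs => rw [hsum v, hsum w]
  simp only [map_sum, map_smul, _root_.sum_apply, _root_.smul_apply, smul_eq_mul, Finset.sum_mul,
    Finset.mul_sum]
  refine Finset.sum_congr rfl fun ν _ => Finset.sum_congr rfl fun μ _ => ?_
  ring

/-- Orthonormality of the frame read in coordinates. Its determinant shows both that the frame
matrix is invertible and that `√det g` is the inverse of the absolute value of its determinant. -/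
theorem frameMat_mul_metric_mul_transpose {i j : ℕ} {y : Coord m} (hy : y ∈ S.coordDomain i j) :
    frameMat (S.coordFrame i j) y * (Matrix.of fun μ ν : Fin (2 * m) =>
      g.inner ((S.chart i).symm y)
        (mfderiv (𝓡 (2 * m)) (𝓡 (2 * m)) (S.chart i).symm y (EuclideanSpace.single μ (1 : ℝ)))
        (mfderiv (𝓡 (2 * m)) (𝓡 (2 * m)) (S.chart i).symm y (EuclideanSpace.single ν (1 : ℝ)))) *
      (frameMat (S.coordFrame i j) y)ᵀ = 1 := by
  ext a b
  have h := S.frame_orthonormal j _ hy.2 a b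
  rw [← S.mfderiv_coordFrame j a hy.1, ← S.mfderiv_coordFrame j b hy.1] at h
  rw [Matrix.one_apply, ← h]
  simp only [Matrix.mul_apply, Matrix.transpose_apply, frameMat, Matrix.of_apply]
  exact sum_bilin_single (g.inner ((S.chart i).symm y))
    (mfderiv (𝓡 (2 * m)) (𝓡 (2 * m)) (S.chart i).symm y) (S.coordFrame i j a y)
    (S.coordFrame i j b y)

theorem det_frameMat_ne {i j : ℕ} {y : Coord m} (hy : y ∈ S.coordDomain i j) :
    (frameMat (S.coordFrame i j) y).det ≠ 0 := fun h => by
  have := congrArg Matrix.det (S.frameMat_mul_metric_mul_transpose hy)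
  rw [Matrix.det_mul, Matrix.det_mul, h, zero_mul, zero_mul, Matrix.det_one] at this
  exact zero_ne_one this

theorem isFrameOn_coordFrame (i j : ℕ) : IsFrameOn (S.coordFrame i j) (S.coordDomain i j) :=
  ⟨S.isOpen_coordDomain i j, S.contDiffOn_coordFrame i j, fun _ hy => S.det_frameMat_ne hy⟩

theorem volumeDensity_eq [MeasurableSpace M] {i : ℕ} (j : ℕ) {y : Coord m}
    (hy : y ∈ S.coordDomain i j) :
    S.volumeDensity i y = frameDensity (S.coordFrame i j) y := by
  have h := congrArg Matrix.det (S.frameMat_mul_metric_mul_transpose hy)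
  rw [Matrix.det_mul, Matrix.det_mul, Matrix.det_transpose, Matrix.det_one] at h
  have h0 := S.det_frameMat_ne hy
  rw [frameDensity, volumeDensity, ← abs_inv, ← Real.sqrt_sq_eq_abs]
  congr 1
  field_simp
  linear_combination h

theorem mlieBracket_coord (V W : Coord m → Coord m) (y : Coord m) :
    VectorField.mlieBracket (𝓡 (2 * m)) V W y = VectorField.lieBracket ℝ V W y := by
  have h := VectorField.mlieBracketWithin_eq_lieBracketWithin (𝕜 := ℝ) (E := Coord m)
    (V := V) (W := W) (s := Set.univ)
  exact (congrFun h y).trans (congrFun VectorField.lieBracketWithin_univ y)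

/-- Naturality of the Lie bracket under pullback by the chart, the coefficients being extracted with
the metric on `M` and by linear algebra in coordinates. It identifies the Koszul coefficients on
both sides. -/
theorem frameBracket_coordFrame {i j : ℕ} {y : Coord m} (hy : y ∈ S.coordDomain i j)
    (a b c : Fin (2 * m)) :
    frameBracket (S.coordFrame i j) a b c y = S.bracketCoeff j a b c ((S.chart i).symm y) := by
  have hsm : ∀ a, MDifferentiableAt (𝓡 (2 * m)) (𝓡 (2 * m)).tangent
      (fun x => (⟨x, S.frame j a x⟩ : TangentBundle (𝓡 (2 * m)) M)) ((S.chart i).symm y) :=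
    fun a => ((S.frame_smooth j a).contMDiffAt
      ((S.chart j).open_source.mem_nhds hy.2)).mdifferentiableAt (by simp)
  have h2 : ContMDiffAt (𝓡 (2 * m)) (𝓡 (2 * m)) ∞ (S.chart i).symm y :=
    (S.contMDiffOn_chart_symm i).contMDiffAt ((S.chart i).open_target.mem_nhds hy.1)
  have h3 : minSmoothness ℝ 2 ≤ (∞ : ℕ∞ω) := by
    rw [minSmoothness_of_isRCLikeNormedField]
    exact ENat.LEInfty.out
  have : IsManifold (𝓡 (2 * m)) (minSmoothness ℝ 2) M := IsManifold.of_le h3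
  have key := VectorField.mpullback_mlieBracket (hsm a) (hsm b) h2 h3
  have hX := S.sum_inner_frame_smul hy.2
    (VectorField.mlieBracket (𝓡 (2 * m)) (S.frame j a) (S.frame j b) ((S.chart i).symm y))
  have e : VectorField.lieBracket ℝ (S.coordFrame i j a) (S.coordFrame i j b) y =
      ∑ c, S.bracketCoeff j a b c ((S.chart i).symm y) • S.coordFrame i j c y := by
    refine ((mlieBracket_coord _ _ y).symm.trans key.symm).trans ?_
    rw [VectorField.mpullback_apply, ← hX, map_sum]
    refine Finset.sum_congr rfl fun c _ => ?_
    rw [map_smul, g.symm]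
    rfl
  rw [frameBracket, e, frameCoeff_sum (S.det_frameMat_ne hy)]

end Coordinates

end SpinStructure

end TwistedDirac
end

/-! ### Twisted Leibniz rule, and covariance of the Dirac operator on the manifold. -/

noncomputable section

namespace TwistedDirac

section Leibniz

variable {m : ℕ} {Δ : DiracMatrices m} {E : Fin (2 * m) → Coord m → Coord m}

/-- The Dirac matrices exchange `F` and `G`, which produces the twist. The connection form is even
and commutes with the multiplication, so only the derivatives of `F` and `G` remain in the
zeroth-order term. -/
theorem locDirac_chiral {F G : Coord m → ℂ} {u : Coord m → Spinor m} {y : Coord m}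
    (hF : DifferentiableAt ℝ F y) (hG : DifferentiableAt ℝ G y) (hu : DifferentiableAt ℝ u y) :
    locDirac Δ E (fun z => act (Δ.chiral (F z) (G z)) (u z)) y =
      act (Δ.chiral (G y) (F y)) (locDirac Δ E u y) +
        act ((-Complex.I) • ∑ a, Δ.gamma a *
          Δ.chiral (fderiv ℝ F y (E a y)) (fderiv ℝ G y (E a y))) (u y) := by
  have hentry : ∀ k l, (fun z => Δ.chiral (F z) (G z) k l) = fun z =>
      (F z + G z) / 2 * (1 : SpinorMatrix m) k l + (F z - G z) / 2 * Δ.grading k l := by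
    intro k l
    funext z
    simp [DiracMatrices.chiral_eq]
  have hd : ∀ k l, DifferentiableAt ℝ (fun z => Δ.chiral (F z) (G z) k l) y := by
    intro k l
    rw [hentry]
    fun_prop
  have hder : ∀ v, (Matrix.of fun k l => fderiv ℝ (fun z => Δ.chiral (F z) (G z) k l) y v) =
      Δ.chiral (fderiv ℝ F y v) (fderiv ℝ G y v) := by
    intro v
    ext k l
    rw [Matrix.of_apply, hentry]
    have h1 := (((hF.hasFDerivAt.add hG.hasFDerivAt).mul_const' (2 : ℂ)⁻¹).mul_const'
      ((1 : SpinorMatrix m) k l)).add (((hF.hasFDerivAt.sub hG.hasFDerivAt).mul_const'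
        (2 : ℂ)⁻¹).mul_const' (Δ.grading k l))
    have h2 : HasFDerivAt (fun z => (F z + G z) / 2 * (1 : SpinorMatrix m) k l +
      (F z - G z) / 2 * Δ.grading k l) _ y := h1
    rw [h2.fderiv]
    simp [DiracMatrices.chiral_eq]
    ring
  simp only [locDirac, fderiv_act hd hu, hder, act_smul, act_sum, act_mul, map_sub, map_add,
    Finset.sum_add_distrib, Finset.sum_sub_distrib, smul_add, smul_sub, Finset.smul_sum, map_sum,
    map_smul]
  have e1 : ∀ a w, act (Δ.gamma a) (act (Δ.chiral (F y) (G y)) w) =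
      act (Δ.chiral (G y) (F y)) (act (Δ.gamma a) w) := fun a w => by
    rw [← act_mul, Δ.gamma_chiral, act_mul]
  have e2 : ∀ a w, act (locSpin Δ E a y) (act (Δ.chiral (F y) (G y)) w) =
      act (Δ.chiral (F y) (G y)) (act (locSpin Δ E a y) w) := fun a w => by
    rw [← act_mul, locSpin, Δ.spinGen_chiral, act_mul]
  simp only [e2, e1]
  abel

theorem IsFrameOn.mono {U V : Set (Coord m)} (hE : IsFrameOn E U) (hV : IsOpen V) (hVU : V ⊆ U) :
    IsFrameOn E V :=
  ⟨hV, fun a => (hE.smooth a).mono hVU, fun y hy => hE.det_ne y (hVU hy)⟩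

end Leibniz

namespace SpinStructure

section Covariance

variable {m : ℕ} {M : Type*} [TopologicalSpace M] [ChartedSpace (Coord m) M]
  [IsManifold (𝓡 (2 * m)) ∞ M] {Δ : DiracMatrices m} {g : Metric (m := m) M}
  (S : SpinStructure Δ g)

theorem mem_source_idx (x : M) : x ∈ (S.chart (S.idx x)).source := by
  classical exact Nat.find_spec (S.cover x)

theorem trans_conjTranspose_mul {i j : ℕ} {x : M} (hi : x ∈ (S.chart i).source)
    (hj : x ∈ (S.chart j).source) : (S.trans i j x)ᴴ * S.trans i j x = 1 :=
  Δ.spin_conjTranspose_mul (S.trans_spin i j x ⟨hi, hj⟩)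

/-- The cocycle relation makes the matrix idempotent, and a unitary idempotent is the identity. -/
theorem trans_self {i : ℕ} {x : M} (hi : x ∈ (S.chart i).source) : S.trans i i x = 1 := by
  have h1 := S.trans_conjTranspose_mul hi hi
  have h2 := S.trans_cocycle i i i x ⟨⟨hi, hi⟩, hi⟩
  calc S.trans i i x = ((S.trans i i x)ᴴ * S.trans i i x) * S.trans i i x := by rw [h1, one_mul]
    _ = 1 := by rw [mul_assoc, h2, h1]

theorem rep_idx (ψ : M → Spinor m) (x : M) : S.rep ψ (S.idx x) x = ψ x := by
  rw [rep, S.trans_self (S.mem_source_idx x), act_one]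

theorem rep_trans (ψ : M → Spinor m) {i j : ℕ} {x : M} (hi : x ∈ (S.chart i).source)
    (hj : x ∈ (S.chart j).source) : S.rep ψ i x = act (S.trans i j x) (S.rep ψ j x) := by
  rw [rep, rep, ← act_mul, S.trans_cocycle _ _ _ x ⟨⟨hi, hj⟩, S.mem_source_idx x⟩]

theorem norm_rep (ψ : M → Spinor m) {i : ℕ} {x : M} (hi : x ∈ (S.chart i).source) :
    ‖S.rep ψ i x‖ = ‖ψ x‖ :=
  norm_act_unitary (S.trans_conjTranspose_mul hi (S.mem_source_idx x)) _

theorem inner_rep (ψ φ : M → Spinor m) {i : ℕ} {x : M} (hi : x ∈ (S.chart i).source) :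
    inner ℂ (S.rep ψ i x) (S.rep φ i x) = inner ℂ (ψ x) (φ x) :=
  inner_act_unitary (S.trans_conjTranspose_mul hi (S.mem_source_idx x)) _ _

/-- The derivative of a function along a vector of the `i`-th frame. -/
def frameDeriv {F : Type*} [NormedAddCommGroup F] [NormedSpace ℝ F] (i : ℕ) (a : Fin (2 * m))
    (f : M → F) (x : M) : F := mfderiv (𝓡 (2 * m)) 𝓘(ℝ, F) f x (S.frame i a x)

/-- The Dirac operator in the `i`-th frame. -/
def frameDirac (i : ℕ) (f : M → Spinor m) (x : M) : Spinor m :=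
  (-Complex.I) • ∑ a, act (Δ.gamma a) (S.frameDeriv i a f x -
    act (Δ.spinGen fun b c => S.christoffel i a b c x) (f x))

theorem diracSection_eq (ψ : M → Spinor m) (x : M) :
    S.diracSection ψ x = S.frameDirac (S.idx x) (S.rep ψ (S.idx x)) x := rfl

theorem fderiv_comp_symm {F : Type*} [NormedAddCommGroup F] [NormedSpace ℝ F] {i j : ℕ}
    {a : Fin (2 * m)} {f : M → F} {y : Coord m} (hy : y ∈ (S.chart i).target)
    (hf : MDifferentiableAt (𝓡 (2 * m)) 𝓘(ℝ, F) f ((S.chart i).symm y)) :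
    fderiv ℝ (f ∘ (S.chart i).symm) y (S.coordFrame i j a y) =
      S.frameDeriv j a f ((S.chart i).symm y) := by
  have h := mfderiv_comp (I'' := 𝓘(ℝ, F)) y hf
    ((S.mdifferentiable_chart i).mdifferentiableAt_symm hy)
  rw [frameDeriv, ← S.mfderiv_coordFrame j a hy, ← mfderiv_eq_fderiv]
  exact congrArg (fun L => L (S.coordFrame i j a y)) h

theorem differentiableAt_comp_symm {F : Type*} [NormedAddCommGroup F] [NormedSpace ℝ F] {i : ℕ}
    {f : M → F} {y : Coord m} (hy : y ∈ (S.chart i).target)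
    (hf : MDifferentiableAt (𝓡 (2 * m)) 𝓘(ℝ, F) f ((S.chart i).symm y)) :
    DifferentiableAt ℝ (f ∘ (S.chart i).symm) y :=
  (hf.comp y ((S.mdifferentiable_chart i).mdifferentiableAt_symm hy)).differentiableAt

theorem locDirac_comp_symm {i j : ℕ} {f : M → Spinor m} {y : Coord m} (hy : y ∈ S.coordDomain i j)
    (hf : MDifferentiableAt (𝓡 (2 * m)) 𝓘(ℝ, Spinor m) f ((S.chart i).symm y)) :
    locDirac Δ (S.coordFrame i j) (f ∘ (S.chart i).symm) y =
      S.frameDirac j f ((S.chart i).symm y) := by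
  have h : ∀ a b c, frameGamma (S.coordFrame i j) a b c y =
      S.christoffel j a b c ((S.chart i).symm y) := fun a b c => by
    simp only [frameGamma, christoffel, S.frameBracket_coordFrame hy]
  simp only [locDirac, locSpin, h, frameDirac, S.fderiv_comp_symm hy.1 hf]
  rfl

theorem contDiffOn_comp_symm {F : Type*} [NormedAddCommGroup F] [NormedSpace ℝ F] {i : ℕ}
    {f : M → F} {s : Set M} (hf : ContMDiffOn (𝓡 (2 * m)) 𝓘(ℝ, F) ∞ f s) :
    ContDiffOn ℝ ∞ (f ∘ (S.chart i).symm) ((S.chart i).target ∩ (S.chart i).symm ⁻¹' s) :=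
  (hf.comp ((S.contMDiffOn_chart_symm i).mono Set.inter_subset_left)
    fun _ hy => hy.2).contDiffOn

theorem contMDiffOn_act {A : M → SpinorMatrix m} {f : M → Spinor m} {s : Set M}
    (hA : ∀ k l, ContMDiffOn (𝓡 (2 * m)) 𝓘(ℝ, ℂ) ∞ (fun x => A x k l) s)
    (hf : ContMDiffOn (𝓡 (2 * m)) 𝓘(ℝ, Spinor m) ∞ f s) :
    ContMDiffOn (𝓡 (2 * m)) 𝓘(ℝ, Spinor m) ∞ (fun x => act (A x) (f x)) s := by
  have h1 : ContDiff ℝ ∞ fun p : (Fin (2 ^ m) → Fin (2 ^ m) → ℂ) × Spinor m =>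
      act (Matrix.of p.1) p.2 := by
    rw [← contDiffOn_univ]
    exact contDiffOn_act (fun k l => ((contDiff_apply_apply ℝ ℂ k l).comp contDiff_fst).contDiffOn)
      contDiff_snd.contDiffOn
  have h2 : ContMDiffOn (𝓡 (2 * m)) 𝓘(ℝ, Fin (2 ^ m) → Fin (2 ^ m) → ℂ) ∞
      (fun x k l => A x k l) s :=
    contMDiffOn_pi_space.2 fun k => contMDiffOn_pi_space.2 fun l => hA k l
  have h3 := h2.prodMk_space hf
  have h4 := h1.contMDiff.comp_contMDiffOn h3
  exact h4

/-- The covariance of the Dirac operator under a change of frame. -/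
theorem frameDirac_trans {i j : ℕ} {f : M → Spinor m} {x : M} (hi : x ∈ (S.chart i).source)
    (hj : x ∈ (S.chart j).source)
    (hf : MDifferentiableAt (𝓡 (2 * m)) 𝓘(ℝ, Spinor m) f x)
    (hTf : MDifferentiableAt (𝓡 (2 * m)) 𝓘(ℝ, Spinor m)
      (fun z => act (S.trans i j z) (f z)) x) :
    S.frameDirac i (fun z => act (S.trans i j z) (f z)) x =
      act (S.trans i j x) (S.frameDirac j f x) := by
  obtain ⟨y, hy, rfl⟩ : ∃ y ∈ (S.chart i).target, (S.chart i).symm y = x :=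
    ⟨_, (S.chart i).map_source hi, (S.chart i).left_inv hi⟩
  have hyU : y ∈ S.coordDomain i j := ⟨hy, hj⟩
  have hsub : S.coordDomain i j ⊆ S.coordDomain i i := by
    rw [coordDomain_self]
    exact Set.inter_subset_left
  have hE : IsFrameOn (S.coordFrame i i) (S.coordDomain i j) :=
    (S.isFrameOn_coordFrame i i).mono (S.isOpen_coordDomain i j) hsub
  have hE' := S.isFrameOn_coordFrame i j
  have hER : ∀ z ∈ S.coordDomain i j, ∀ a, S.coordFrame i j a z =
      ∑ b, g.inner ((S.chart i).symm z) (S.frame i b ((S.chart i).symm z))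
        (S.frame j a ((S.chart i).symm z)) • S.coordFrame i i b z := by
    intro z hz a
    rw [coordFrame, VectorField.mpullback_apply, ← S.sum_inner_frame_smul (hsub hz).2
      (S.frame j a ((S.chart i).symm z)), map_sum]
    refine Finset.sum_congr rfl fun b _ => ?_
    rw [map_smul, S.sum_inner_frame_smul (hsub hz).2]
    rfl
  -- The entries of the rotation are also frame coefficients, which gives their differentiability
  -- from that of the frames.
  have hR : ∀ z ∈ S.coordDomain i j, ∀ b a, g.inner ((S.chart i).symm z)
      (S.frame i b ((S.chart i).symm z)) (S.frame j a ((S.chart i).symm z)) =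
        frameCoeff (S.coordFrame i i) z (S.coordFrame i j a z) b := by
    intro z hz b a
    rw [hER z hz, frameCoeff_sum (hE.det_ne z hz)]
  have h := locDirac_gauge (Δ := Δ) (R := fun b a z => g.inner ((S.chart i).symm z)
    (S.frame i b ((S.chart i).symm z)) (S.frame j a ((S.chart i).symm z)))
    (L := fun z => S.trans i j ((S.chart i).symm z)) hE hE'
    (fun b a => ((hE.contDiffOn_frameCoeff (hE'.smooth a) b).differentiableOn (by simp)).congr
      fun z hz => hR z hz b a) hER ?_ (fun z hz => S.trans_spin i j _ ⟨(hsub hz).2, hz.2⟩)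
    (fun k l => ?_) (fun z hz => S.trans_frame i j _ ⟨(hsub hz).2, hz.2⟩) hyU
    (S.differentiableAt_comp_symm hy hf)
  · rw [S.locDirac_comp_symm hyU hf] at h
    rw [← S.locDirac_comp_symm ⟨hy, hi⟩ hTf]
    exact h
  · intro z hz a c
    have h1 := S.frame_orthonormal j _ hz.2 a c
    rw [← S.sum_inner_frame_smul (hsub hz).2 (S.frame j a ((S.chart i).symm z)), map_sum] at h1
    simp only [map_smul, _root_.sum_apply, _root_.smul_apply, smul_eq_mul] at h1
    exact h1
  · exact (S.contDiffOn_comp_symm (i := i) (S.trans_smooth i j k l)).differentiableOn (by simp)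
      |>.mono fun z hz => ⟨hz.1, (hsub hz).2, hz.2⟩

theorem frameDirac_congr {i : ℕ} {f h : M → Spinor m} {x : M} (hfh : f =ᶠ[nhds x] h) :
    S.frameDirac i f x = S.frameDirac i h x := by
  simp only [frameDirac, frameDeriv, hfh.mfderiv_eq, hfh.eq_of_nhds]
  rfl

theorem IsSmoothSpinor.mdifferentiableAt {S : SpinStructure Δ g} {ψ : M → Spinor m}
    (hψ : S.IsSmoothSpinor ψ) {i : ℕ} {x : M} (hi : x ∈ (S.chart i).source) :
    MDifferentiableAt (𝓡 (2 * m)) 𝓘(ℝ, Spinor m) (S.rep ψ i) x :=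
  ((hψ i).contMDiffAt ((S.chart i).open_source.mem_nhds hi)).mdifferentiableAt (by simp)

/-- `diracSection` is computed in the preferred frame, whose index jumps. Covariance gives the same
formula in every frame, so the result is again a smooth spinor and can be studied in any chart. -/
theorem rep_diracSection {ψ : M → Spinor m} (hψ : S.IsSmoothSpinor ψ) {i : ℕ} {x : M}
    (hi : x ∈ (S.chart i).source) :
    S.rep (S.diracSection ψ) i x = S.frameDirac i (S.rep ψ i) x := by
  have hk := S.mem_source_idx x
  have he : (fun z => act (S.trans i (S.idx x) z) (S.rep ψ (S.idx x) z)) =ᶠ[nhds x]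
      S.rep ψ i := by
    filter_upwards [(S.chart i).open_source.mem_nhds hi,
      (S.chart (S.idx x)).open_source.mem_nhds hk] with z h1 h2
    exact (S.rep_trans ψ h1 h2).symm
  rw [rep, diracSection_eq, ← S.frameDirac_trans hi hk (hψ.mdifferentiableAt hk)
    ((hψ.mdifferentiableAt hi).congr_of_eventuallyEq he)]
  exact S.frameDirac_congr he

theorem contMDiffOn_of_comp_symm {F : Type*} [NormedAddCommGroup F] [NormedSpace ℝ F] {i : ℕ}
    {f : M → F} (hf : ContDiffOn ℝ ∞ (f ∘ (S.chart i).symm) (S.chart i).target) :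
    ContMDiffOn (𝓡 (2 * m)) 𝓘(ℝ, F) ∞ f (S.chart i).source := by
  refine (hf.contMDiffOn.comp (S.contMDiffOn_chart i) fun x hx =>
    (S.chart i).map_source hx).congr fun x hx => ?_
  simp [(S.chart i).left_inv hx]

theorem isSmoothSpinor_diracSection {ψ : M → Spinor m} (hψ : S.IsSmoothSpinor ψ) :
    S.IsSmoothSpinor (S.diracSection ψ) := by
  intro i
  refine ContMDiffOn.congr (S.contMDiffOn_of_comp_symm ?_) fun x hx => S.rep_diracSection hψ hx
  have h := contDiffOn_locDirac (Δ := Δ) (S.isFrameOn_coordFrame i i)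
    ((S.contDiffOn_comp_symm (i := i) (hψ i)))
  rw [coordDomain_self] at h
  refine h.congr fun y hy => ?_
  exact (S.locDirac_comp_symm ⟨hy, (S.chart i).map_target hy⟩
    (hψ.mdifferentiableAt ((S.chart i).map_target hy))).symm

/-- The matrix of Clifford multiplication by the differentials of a pair of functions. -/
def symbol (i : ℕ) (F G : M → ℂ) (x : M) : SpinorMatrix m :=
  (-Complex.I) • ∑ a, Δ.gamma a * Δ.chiral (S.frameDeriv i a F x) (S.frameDeriv i a G x)

theorem frameDirac_chiral {i : ℕ} {F G : M → ℂ} {f : M → Spinor m} {x : M}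
    (hi : x ∈ (S.chart i).source)
    (hF : MDifferentiableAt (𝓡 (2 * m)) 𝓘(ℝ, ℂ) F x) (hG : MDifferentiableAt (𝓡 (2 * m)) 𝓘(ℝ, ℂ) G x)
    (hf : MDifferentiableAt (𝓡 (2 * m)) 𝓘(ℝ, Spinor m) f x) 
    (hFf : MDifferentiableAt (𝓡 (2 * m)) 𝓘(ℝ, Spinor m)
      (fun z => act (Δ.chiral (F z) (G z)) (f z)) x) :
    S.frameDirac i (fun z => act (Δ.chiral (F z) (G z)) (f z)) x =
      act (Δ.chiral (G x) (F x)) (S.frameDirac i f x) + act (S.symbol i F G x) (f x) := by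
  obtain ⟨y, hy, rfl⟩ : ∃ y ∈ (S.chart i).target, (S.chart i).symm y = x :=
    ⟨_, (S.chart i).map_source hi, (S.chart i).left_inv hi⟩
  have h := locDirac_chiral (Δ := Δ) (E := S.coordFrame i i) (S.differentiableAt_comp_symm hy hF)
    (S.differentiableAt_comp_symm hy hG) (S.differentiableAt_comp_symm hy hf)
  rw [S.locDirac_comp_symm ⟨hy, hi⟩ hf] at h
  simp only [S.fderiv_comp_symm hy hF, S.fderiv_comp_symm hy hG] at h
  rw [← S.locDirac_comp_symm ⟨hy, hi⟩ hFf]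
  exact h

end Covariance

end SpinStructure

end TwistedDirac
end

/-! ### The Riemannian volume in charts. -/

noncomputable section

namespace TwistedDirac

theorem measurableSet_image_source {X Y : Type*} [TopologicalSpace X] [TopologicalSpace Y]
    [MeasurableSpace X] [MeasurableSpace Y] [BorelSpace X] [BorelSpace Y]
    (e : OpenPartialHomeomorph X Y) {B : Set X} (hB : MeasurableSet B) (hBe : B ⊆ e.source) :
    MeasurableSet (e '' B) := by
  have h1 : Measurable (e.target.domRestrict e.symm) :=
    (continuousOn_iff_continuous_domRestrict.1 e.continuousOn_symm).measurable
  have h2 := e.open_target.measurableSet.subtype_image (h1 hB)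
  convert h2 using 1
  ext y
  constructor
  · rintro ⟨x, hx, rfl⟩
    refine ⟨⟨e x, e.map_source (hBe hx)⟩, ?_, rfl⟩
    simpa [e.left_inv (hBe hx)] using hx
  · rintro ⟨⟨z, hz⟩, hzB, rfl⟩
    exact ⟨e.symm z, hzB, e.right_inv hz⟩

namespace SpinStructure

section Volume

variable {m : ℕ} {M : Type*} [TopologicalSpace M] [ChartedSpace (Coord m) M]
  [IsManifold (𝓡 (2 * m)) ∞ M] {Δ : DiracMatrices m} {g : Metric (m := m) M}
  (S : SpinStructure Δ g)

theorem hasFDerivAt_transition {i j : ℕ} {z : Coord m} (hz : z ∈ S.coordDomain j i) :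
    HasFDerivAt (S.chart i ∘ (S.chart j).symm)
      (fderiv ℝ (S.chart i ∘ (S.chart j).symm) z) z :=
  (((S.contDiffOn_comp_symm (i := j) (S.contMDiffOn_chart i)).contDiffAt
    ((S.isOpen_coordDomain j i).mem_nhds hz)).differentiableAt (by simp)).hasFDerivAt

theorem transition_mem {i j : ℕ} {z : Coord m} (hz : z ∈ S.coordDomain j i) :
    S.chart i ((S.chart j).symm z) ∈ S.coordDomain i j := by
  refine ⟨(S.chart i).map_source hz.2, ?_⟩
  rw [Set.mem_preimage, (S.chart i).left_inv hz.2]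
  exact (S.chart j).map_target hz.1

theorem fderiv_transition {i j : ℕ} (k : ℕ) (a : Fin (2 * m)) {z : Coord m}
    (hz : z ∈ S.coordDomain j i) :
    fderiv ℝ (S.chart i ∘ (S.chart j).symm) z (S.coordFrame j k a z) =
      S.coordFrame i k a (S.chart i ((S.chart j).symm z)) := by
  have h1 := S.fderiv_comp_symm (j := k) (a := a) (f := S.chart i) hz.1
    ((S.mdifferentiable_chart i).mdifferentiableAt hz.2)
  have h2 := S.fderiv_comp_symm (i := i) (j := k) (a := a) (f := S.chart i)
    ((S.chart i).map_source hz.2) (by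
      rw [(S.chart i).left_inv hz.2]
      exact (S.mdifferentiable_chart i).mdifferentiableAt hz.2)
  rw [h1]
  rw [(S.chart i).left_inv hz.2] at h2
  rw [← h2]
  have h3 : (S.chart i ∘ (S.chart i).symm) =ᶠ[nhds (S.chart i ((S.chart j).symm z))] id := by
    filter_upwards [(S.chart i).open_target.mem_nhds ((S.chart i).map_source hz.2)] with w hw
    exact (S.chart i).right_inv hw
  rw [h3.fderiv_eq, fderiv_id]
  rfl

theorem frameMat_mul_toMatrix (L : Coord m →L[ℝ] Coord m)
    {E E' : Fin (2 * m) → Coord m → Coord m} {y y' : Coord m} (h : ∀ a, L (E a y) = E' a y') :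
    (frameMat E' y').det = (frameMat E y).det * L.det := by
  have hdet : L.det = (LinearMap.toMatrix (EuclideanSpace.basisFun (Fin (2 * m)) ℝ).toBasis
      (EuclideanSpace.basisFun (Fin (2 * m)) ℝ).toBasis (L : Coord m →ₗ[ℝ] Coord m)).det :=
    (LinearMap.det_toMatrix _ _).symm
  rw [hdet, ← Matrix.det_transpose (LinearMap.toMatrix _ _ _), ← Matrix.det_mul]
  congr 1
  ext a μ
  rw [Matrix.mul_apply]
  simp only [frameMat, Matrix.of_apply, Matrix.transpose_apply, LinearMap.toMatrix_apply, ← h]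
  have hsum : E a y = ∑ ν, E a y ν • EuclideanSpace.single ν (1 : ℝ) := by
    ext k
    simp [Finset.sum_apply, Pi.single_apply]
  conv_lhs => rw [hsum, map_sum]
  simp

/-- The differential of the transition map sends the `j`-th frame in one chart to the `j`-th frame
in the other, so its determinant is the quotient of the frame determinants. -/
theorem density_transition [MeasurableSpace M] {i j : ℕ} {z : Coord m} (hz : z ∈ S.coordDomain j i) :
    |(fderiv ℝ (S.chart i ∘ (S.chart j).symm) z).det| *
      S.volumeDensity i (S.chart i ((S.chart j).symm z)) = S.volumeDensity j z := by
  have hz' : z ∈ S.coordDomain j j := ⟨hz.1, (S.chart j).map_target hz.1⟩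
  have h := frameMat_mul_toMatrix _ fun a => S.fderiv_transition j a hz
  have h0 := (S.isFrameOn_coordFrame i j).det_ne _ (S.transition_mem hz)
  rw [S.volumeDensity_eq j (S.transition_mem hz), S.volumeDensity_eq j hz', frameDensity,
    frameDensity]
  rw [h] at h0 ⊢
  have h1 := abs_ne_zero.2 (right_ne_zero_of_mul h0)
  have h2 := abs_ne_zero.2 (left_ne_zero_of_mul h0)
  rw [abs_mul]
  field_simp

theorem setOf_idx_subset (j : ℕ) : {x | S.idx x = j} ⊆ (S.chart j).source := by
  rintro x rfl
  exact S.mem_source_idx x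

theorem measurableSet_idx [MeasurableSpace M] [BorelSpace M] (j : ℕ) :
    MeasurableSet {x | S.idx x = j} := by
  classical
  have h : {x | S.idx x = j} = (S.chart j).source \ ⋃ k ∈ Finset.range j, (S.chart k).source := by
    ext x
    simp only [Set.mem_ofPred_eq, Set.mem_sdiff, Set.mem_iUnion, Finset.mem_range, not_exists]
    exact Nat.find_eq_iff _
  rw [h]
  exact (S.chart j).open_source.measurableSet.diff
    (Finset.measurableSet_biUnion _ fun k _ => (S.chart k).open_source.measurableSet)

theorem preimage_symm_inter_image {i : ℕ} {A B : Set M} (hB : B ⊆ (S.chart i).source) :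
    (S.chart i).symm ⁻¹' A ∩ S.chart i '' B = S.chart i '' (A ∩ B) := by
  ext y
  constructor
  · rintro ⟨h1, x, hx, rfl⟩
    rw [Set.mem_preimage, (S.chart i).left_inv (hB hx)] at h1
    exact ⟨x, ⟨h1, hx⟩, rfl⟩
  · rintro ⟨x, ⟨h1, hx⟩, rfl⟩
    refine ⟨?_, x, hx, rfl⟩
    rwa [Set.mem_preimage, (S.chart i).left_inv (hB hx)]

variable [MeasurableSpace M] [BorelSpace M]

/-- The measure `√det(g_{μν}) dx` on the target of the `i`-th chart. -/
def chartMeasure (i : ℕ) : Measure (Coord m) :=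
  ((volume : Measure (Coord m)).restrict (S.chart i).target).withDensity
    fun y => ENNReal.ofReal (S.volumeDensity i y)

theorem aemeasurable_symm (i : ℕ) {s : Set (Coord m)} (hs : s ⊆ (S.chart i).target)
    (f : Coord m → ℝ≥0∞) :
    AEMeasurable (S.chart i).symm (((volume : Measure (Coord m)).restrict s).withDensity f) := by
  refine AEMeasurable.mono_ac ?_ (withDensity_absolutelyContinuous _ f)
  exact ((S.chart i).continuousOn_symm.aemeasurable
    (S.chart i).open_target.measurableSet).mono_measure (Measure.restrict_mono_set _ hs)

/-- Change of variables under the transition map, whose Jacobian is absorbed by the densities. It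
shows that the volume does not depend on the chart used for each piece. -/
theorem lintegral_image_chart {i j : ℕ} {B : Set M} (hB : MeasurableSet B)
    (hi : B ⊆ (S.chart i).source) (hj : B ⊆ (S.chart j).source) :
    ∫⁻ y in S.chart i '' B, ENNReal.ofReal (S.volumeDensity i y) =
      ∫⁻ y in S.chart j '' B, ENNReal.ofReal (S.volumeDensity j y) := by
  have hmem : ∀ z ∈ S.chart j '' B, z ∈ S.coordDomain j i := by
    rintro _ ⟨x, hx, rfl⟩
    refine ⟨(S.chart j).map_source (hj hx), ?_⟩
    rw [Set.mem_preimage, (S.chart j).left_inv (hj hx)]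
    exact hi hx
  have himg : S.chart i '' B = (S.chart i ∘ (S.chart j).symm) '' (S.chart j '' B) := by
    rw [Set.image_image]
    refine Set.image_congr fun x hx => ?_
    rw [Function.comp_apply, (S.chart j).left_inv (hj hx)]
  have hmeas := measurableSet_image_source (S.chart j) hB hj
  rw [himg, lintegral_image_eq_lintegral_abs_det_fderiv_mul volume hmeas
    (fun z hz => (S.hasFDerivAt_transition (hmem z hz)).hasFDerivWithinAt)]
  · refine setLIntegral_congr_fun hmeas fun z hz => ?_
    rw [← S.density_transition (hmem z hz), ENNReal.ofReal_mul (abs_nonneg _)]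
    rfl
  · intro z hz w hw h
    exact (S.chart j).symm.injOn (hmem z hz).1 (hmem w hw).1
      ((S.chart i).injOn (hmem z hz).2 (hmem w hw).2 h)

/-- The Riemannian volume in a chart. -/
theorem restrict_vol (i : ℕ) :
    S.vol.restrict (S.chart i).source = (S.chartMeasure i).map (S.chart i).symm := by
  refine Measure.ext fun s hs => ?_
  have hsi : MeasurableSet (s ∩ (S.chart i).source) :=
    hs.inter (S.chart i).open_source.measurableSet
  rw [Measure.restrict_apply hs, vol, Measure.sum_apply _ hsi, chartMeasure,
    Measure.map_apply_of_aemeasurable (S.aemeasurable_symm i subset_rfl _) hs,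
    withDensity_apply', Measure.restrict_restrict' (S.chart i).open_target.measurableSet,
    ← (S.chart i).image_source_eq_target, S.preimage_symm_inter_image subset_rfl]
  -- The volume is a sum over the preferred index. The set is cut along the same index and each
  -- piece is moved from the `i`-th chart to the `j`-th.
  have hU : S.chart i '' (s ∩ (S.chart i).source) =
      ⋃ j, S.chart i '' (s ∩ (S.chart i).source ∩ {x | S.idx x = j}) := by
    rw [← Set.image_iUnion, ← Set.inter_iUnion]
    congr 1
    exact (Set.inter_eq_left.2 fun x _ => Set.mem_iUnion.2 ⟨S.idx x, rfl⟩).symm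
  rw [hU, lintegral_iUnion]
  · refine tsum_congr fun j => ?_
    have hsub := S.setOf_idx_subset j
    rw [Measure.map_apply_of_aemeasurable (S.aemeasurable_symm j
        (by rw [← (S.chart j).image_source_eq_target]; exact Set.image_mono hsub) _) hsi,
      withDensity_apply', Measure.restrict_restrict'
        (measurableSet_image_source _ (S.measurableSet_idx j) hsub),
      S.preimage_symm_inter_image hsub]
    exact S.lintegral_image_chart (hsi.inter (S.measurableSet_idx j))
      (Set.inter_subset_right.trans hsub) (Set.inter_subset_left.trans Set.inter_subset_right)
  · exact fun j => measurableSet_image_source _ (hsi.inter (S.measurableSet_idx j))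
      (Set.inter_subset_left.trans Set.inter_subset_right)
  · intro j k hjk
    refine Set.disjoint_left.2 ?_
    rintro _ ⟨x, hx, rfl⟩ ⟨x', hx', h⟩
    have := (S.chart i).injOn hx'.1.2 hx.1.2 h
    subst this
    exact hjk (hx.2.symm.trans hx'.2)

end Volume

end SpinStructure

end TwistedDirac
end

/-! ### Measurability, integrals and null sets through charts. -/

noncomputable section

namespace TwistedDirac

namespace SpinStructure

section ChartIntegrals

variable {m : ℕ} {M : Type*} [TopologicalSpace M] [ChartedSpace (Coord m) M]
  [IsManifold (𝓡 (2 * m)) ∞ M] {Δ : DiracMatrices m} {g : Metric (m := m) M}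
  (S : SpinStructure Δ g)

theorem IsSmoothSpinor.continuousOn_rep {S : SpinStructure Δ g} {ψ : M → Spinor m}
    (hψ : S.IsSmoothSpinor ψ) (i : ℕ) : ContinuousOn (S.rep ψ i) (S.chart i).source :=
  (hψ i).continuousOn

/-- A section in preferred frames need not be continuous, but its norm does not depend on the frame
and is continuous. Compactness then gives the bound. -/
theorem bounded_of_continuousOn [CompactSpace M] {E : Type*} [NormedAddCommGroup E] {f : M → E}
    {f' : ℕ → M → E} (hf : ∀ k, ∀ x ∈ (S.chart k).source, ‖f x‖ = ‖f' k x‖)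
    (hf' : ∀ k, ContinuousOn (f' k) (S.chart k).source) : ∃ C, ∀ x, ‖f x‖ ≤ C := by
  have hc : Continuous fun x => ‖f x‖ := by
    rw [continuous_iff_continuousAt]
    intro x
    have hx := (S.chart (S.idx x)).open_source.mem_nhds (S.mem_source_idx x)
    refine (((hf' (S.idx x)).norm).continuousAt hx).congr ?_
    filter_upwards [hx] with z hz
    exact (hf _ z hz).symm
  obtain ⟨C, hC⟩ := (isCompact_range hc).bddAbove
  exact ⟨C, fun x => hC (Set.mem_range_self x)⟩

theorem continuousOn_act_trans (i k : ℕ) : ContinuousOn (fun x => act (S.trans i k x))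
    ((S.chart i).source ∩ (S.chart k).source) := by
  have h : ∀ a b, ContinuousOn (fun x => S.trans i k x a b)
      ((S.chart i).source ∩ (S.chart k).source) := fun a b => (S.trans_smooth i k a b).continuousOn
  exact continuousOn_actMatrix h

variable [MeasurableSpace M]

theorem volumeDensity_pos {i : ℕ} {y : Coord m} (hy : y ∈ (S.chart i).target) :
    0 < S.volumeDensity i y := by
  rw [S.volumeDensity_eq i ⟨hy, (S.chart i).map_target hy⟩]
  exact (S.isFrameOn_coordFrame i i).density_pos ⟨hy, (S.chart i).map_target hy⟩

theorem contDiffOn_volumeDensity (i : ℕ) :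
    ContDiffOn ℝ ∞ (S.volumeDensity i) (S.chart i).target := by
  refine ((S.isFrameOn_coordFrame i i).contDiffOn_density.mono ?_).congr fun y hy =>
    S.volumeDensity_eq i ⟨hy, (S.chart i).map_target hy⟩
  rw [coordDomain_self]

theorem aemeasurable_volumeDensity (i : ℕ) :
    AEMeasurable (fun y => ENNReal.ofReal (S.volumeDensity i y))
      ((volume : Measure (Coord m)).restrict (S.chart i).target) :=
  ((S.contDiffOn_volumeDensity i).continuousOn.aemeasurable
    (S.chart i).open_target.measurableSet).ennreal_ofReal

/-- The density is positive on the target of the chart. Hence statements valid almost everywhere on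
`M` hold almost everywhere for Lebesgue measure in coordinates. -/
theorem volume_absolutelyContinuous (i : ℕ) :
    (volume : Measure (Coord m)).restrict (S.chart i).target ≪ S.chartMeasure i := by
  refine withDensity_absolutelyContinuous' (S.aemeasurable_volumeDensity i) ?_
  filter_upwards [ae_restrict_mem (S.chart i).open_target.measurableSet] with y hy
  exact (ENNReal.ofReal_pos.2 (S.volumeDensity_pos hy)).ne'

theorem ae_of_forall_chart {p : M → Prop}
    (h : ∀ i, ∀ᵐ x ∂S.vol, x ∈ (S.chart i).source → p x) : ∀ᵐ x ∂S.vol, p x := by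
  filter_upwards [ae_all_iff.2 h] with x hx
  exact hx _ (S.mem_source_idx x)

theorem aestronglyMeasurable_of_local {E : Type*} [TopologicalSpace E]
    [TopologicalSpace.PseudoMetrizableSpace E] {f : M → E} {μ : Measure M}
    (h : ∀ k, AEStronglyMeasurable f (μ.restrict {x | S.idx x = k})) : AEStronglyMeasurable f μ := by
  have h2 := aestronglyMeasurable_iUnion_iff.2 h
  have h3 : ⋃ k, {x | S.idx x = k} = Set.univ := Set.eq_univ_of_forall fun x =>
    Set.mem_iUnion.2 ⟨S.idx x, rfl⟩
  rwa [h3, Measure.restrict_univ] at h2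

variable [BorelSpace M]

theorem setLIntegral_vol {i : ℕ} {f : M → ℝ≥0∞}
    (hf : AEMeasurable f (S.vol.restrict (S.chart i).source)) :
    ∫⁻ x in (S.chart i).source, f x ∂S.vol =
      ∫⁻ y in (S.chart i).target, ENNReal.ofReal (S.volumeDensity i y) * f ((S.chart i).symm y) := by
  rw [restrict_vol] at hf ⊢
  have hm := S.aemeasurable_symm i subset_rfl fun y => ENNReal.ofReal (S.volumeDensity i y)
  rw [lintegral_map' hf hm]
  exact lintegral_withDensity_eq_lintegral_mul₀' (S.aemeasurable_volumeDensity i)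
    (hf.comp_aemeasurable hm)

theorem setIntegral_vol {E : Type*} [NormedAddCommGroup E] [NormedSpace ℝ E] {i : ℕ} {f : M → E}
    (hf : AEStronglyMeasurable f (S.vol.restrict (S.chart i).source)) :
    ∫ x in (S.chart i).source, f x ∂S.vol =
      ∫ y in (S.chart i).target, S.volumeDensity i y • f ((S.chart i).symm y) := by
  rw [restrict_vol] at hf ⊢
  have hm : AEMeasurable (S.chart i).symm (S.chartMeasure i) := S.aemeasurable_symm i subset_rfl _
  rw [integral_map hm hf, chartMeasure, integral_withDensity_eq_integral_toReal_smul₀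
    (S.aemeasurable_volumeDensity i) (Filter.Eventually.of_forall fun _ => ENNReal.ofReal_lt_top)]
  refine setIntegral_congr_fun (S.chart i).open_target.measurableSet fun y hy => ?_
  simp only [ENNReal.toReal_ofReal (S.volumeDensity_pos hy).le]

theorem ae_chart {i : ℕ} {p : M → Prop} (h : ∀ᵐ x ∂S.vol, x ∈ (S.chart i).source → p x) :
    ∀ᵐ y ∂(volume : Measure (Coord m)).restrict (S.chart i).target, p ((S.chart i).symm y) := by
  have h1 := (ae_restrict_iff'₀ (S.chart i).open_source.measurableSet.nullMeasurableSet).2 h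
  rw [restrict_vol] at h1
  exact (S.volume_absolutelyContinuous i).ae_le
    (ae_of_ae_map (S.aemeasurable_symm i subset_rfl _) h1)

theorem aestronglyMeasurable_comp_symm {E : Type*} [TopologicalSpace E] {i : ℕ} {f : M → E}
    (hf : AEStronglyMeasurable f (S.vol.restrict (S.chart i).source)) :
    AEStronglyMeasurable (fun y => f ((S.chart i).symm y))
      ((volume : Measure (Coord m)).restrict (S.chart i).target) := by
  rw [restrict_vol] at hf
  exact (hf.comp_aemeasurable (S.aemeasurable_symm i subset_rfl _)).mono_ac
    (S.volume_absolutelyContinuous i)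

/-- Used to pass from vanishing almost everywhere to vanishing everywhere for continuous functions.
-/
theorem isOpenPosMeasure_vol : S.vol.IsOpenPosMeasure := by
  refine ⟨fun U hU ⟨x, hx⟩ h0 => ?_⟩
  have hxs := S.mem_source_idx x
  have h2 : ∀ᵐ z ∂S.vol, z ∈ (S.chart (S.idx x)).source → z ∉ U :=
    (measure_eq_zero_iff_ae_notMem.1 h0).mono fun _ h _ => h
  have h3 := S.ae_chart h2
  rw [ae_restrict_iff'₀ (S.chart (S.idx x)).open_target.measurableSet.nullMeasurableSet] at h3
  have h4 : IsOpen ((S.chart (S.idx x)).target ∩ (S.chart (S.idx x)).symm ⁻¹' U) :=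
    (S.chart (S.idx x)).isOpen_inter_preimage_symm hU
  have h5 : volume ((S.chart (S.idx x)).target ∩ (S.chart (S.idx x)).symm ⁻¹' U) = 0 := by
    rw [measure_eq_zero_iff_ae_notMem]
    filter_upwards [h3] with y hy h
    exact hy h.1 h.2
  refine (h4.measure_pos volume ⟨S.chart (S.idx x) x, (S.chart (S.idx x)).map_source hxs, ?_⟩).ne' h5
  rw [Set.mem_preimage, (S.chart (S.idx x)).left_inv hxs]
  exact hx

theorem isFiniteMeasure_vol [CompactSpace M] : IsFiniteMeasure S.vol := by
  have hloc : IsLocallyFiniteMeasure S.vol := by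
    refine ⟨fun x => ?_⟩
    have hxs := S.mem_source_idx x
    generalize S.idx x = i at hxs
    obtain ⟨K, hK, hxK, hKt⟩ := exists_compact_subset (S.chart i).open_target
      ((S.chart i).map_source hxs)
    have hN : IsOpen ((S.chart i).source ∩ S.chart i ⁻¹' interior K) :=
      (S.chart i).isOpen_inter_preimage isOpen_interior
    refine ⟨_, hN.mem_nhds ⟨hxs, hxK⟩, ?_⟩
    obtain ⟨C, hC⟩ := hK.exists_bound_of_continuousOn
      ((S.contDiffOn_volumeDensity i).continuousOn.mono hKt)
    have h1 : S.vol ((S.chart i).source ∩ S.chart i ⁻¹' interior K) =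
        ∫⁻ x in (S.chart i).source,
          ((S.chart i).source ∩ S.chart i ⁻¹' interior K).indicator 1 x ∂S.vol := by
      rw [lintegral_indicator_one hN.measurableSet, Measure.restrict_apply hN.measurableSet]
      congr 1
      exact (Set.inter_eq_left.2 Set.inter_subset_left).symm
    rw [h1, S.setLIntegral_vol (measurable_one.indicator hN.measurableSet).aemeasurable]
    calc _ ≤ ∫⁻ y in (S.chart i).target, K.indicator (fun _ => ENNReal.ofReal C) y := by
          refine setLIntegral_mono' (S.chart i).open_target.measurableSet fun y hy => ?_
          by_cases h : (S.chart i).symm y ∈ (S.chart i).source ∩ S.chart i ⁻¹' interior K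
          · have hyK : y ∈ K := by
              have := interior_subset h.2
              rwa [(S.chart i).right_inv hy] at this
            rw [Set.indicator_of_mem h, Set.indicator_of_mem hyK, Pi.one_apply, mul_one]
            exact ENNReal.ofReal_le_ofReal ((le_abs_self _).trans (hC y hyK))
          · rw [Set.indicator_of_notMem h, mul_zero]
            exact zero_le
      _ ≤ ∫⁻ y, K.indicator (fun _ => ENNReal.ofReal C) y := setLIntegral_le_lintegral _ _
      _ = ENNReal.ofReal C * volume K := lintegral_indicator_const hK.measurableSet _
      _ < ⊤ := ENNReal.mul_lt_top ENNReal.ofReal_lt_top hK.measure_lt_top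
  exact ⟨isCompact_univ.measure_lt_top⟩

/-! ### Continuous spinors -/

theorem aestronglyMeasurable_of_continuousOn {E : Type*} [TopologicalSpace E]
    [TopologicalSpace.PseudoMetrizableSpace E] [SecondCountableTopology E] {f : M → E}
    {f' : ℕ → M → E} (hf : ∀ k x, S.idx x = k → f x = f' k x)
    (hf' : ∀ k, ContinuousOn (f' k) (S.chart k).source) : AEStronglyMeasurable f S.vol := by
  refine S.aestronglyMeasurable_of_local fun k => ?_
  have h1 := ((hf' k).mono (S.setOf_idx_subset k)).aestronglyMeasurable (μ := S.vol)
    (S.measurableSet_idx k)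
  refine h1.congr ?_
  filter_upwards [ae_restrict_mem (S.measurableSet_idx k)] with x hx
  exact (hf k x hx).symm

theorem memLp_of_continuousOn_rep [CompactSpace M] {ψ : M → Spinor m}
    (hψ : ∀ i, ContinuousOn (S.rep ψ i) (S.chart i).source) (p : ℝ≥0∞) : MemLp ψ p S.vol := by
  have := S.isFiniteMeasure_vol
  obtain ⟨C, hC⟩ := S.bounded_of_continuousOn (fun k x hx => (S.norm_rep ψ hx).symm) hψ
  refine MemLp.of_bound (S.aestronglyMeasurable_of_continuousOn (f' := S.rep ψ) ?_ hψ) C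
    (Filter.Eventually.of_forall hC)
  rintro _ x rfl
  exact (S.rep_idx ψ x).symm

/-- On each piece with a fixed preferred index the transition matrix is continuous, and countably
many pieces suffice. -/
theorem aestronglyMeasurable_rep {ψ : M → Spinor m} (hψ : AEStronglyMeasurable ψ S.vol) (i : ℕ) :
    AEStronglyMeasurable (S.rep ψ i) (S.vol.restrict (S.chart i).source) := by
  refine S.aestronglyMeasurable_of_local fun k => ?_
  rw [Measure.restrict_restrict (S.measurableSet_idx k)]
  have hms := (S.measurableSet_idx k).inter (S.chart i).open_source.measurableSet
  have hsub : {x | S.idx x = k} ∩ (S.chart i).source ⊆ (S.chart i).source ∩ (S.chart k).source :=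
    fun x hx => ⟨hx.2, S.setOf_idx_subset k hx.1⟩
  have h1 : AEStronglyMeasurable (fun x => act (S.trans i k x))
      (S.vol.restrict ({x | S.idx x = k} ∩ (S.chart i).source)) :=
    (S.continuousOn_act_trans i k |>.mono hsub).aestronglyMeasurable hms
  have hc : Continuous fun p : (Spinor m →L[ℂ] Spinor m) × Spinor m => p.1 p.2 :=
    continuous_fst.clm_apply continuous_snd
  have h2 := hc.comp_aestronglyMeasurable (h1.prodMk hψ.restrict)
  refine h2.congr ?_
  filter_upwards [ae_restrict_mem hms] with x hx
  rw [rep, hx.1]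

end ChartIntegrals

end SpinStructure

end TwistedDirac
end

/-! ### Passage between spinors supported in a chart and functions of the coordinates. -/

noncomputable section

namespace TwistedDirac

theorem memLp_two_iff {α E : Type*} [MeasurableSpace α] [NormedAddCommGroup E] {μ : Measure α}
    {f : α → E} (hf : AEStronglyMeasurable f μ) :
    MemLp f 2 μ ↔ ∫⁻ x, ‖f x‖ₑ ^ 2 ∂μ < ⊤ := by
  rw [MemLp, eLpNorm_lt_top_iff_lintegral_rpow_enorm_lt_top (by simp) (by simp)]
  simp [hf]

namespace SpinStructure

section Extension

variable {m : ℕ} {M : Type*} [TopologicalSpace M] [ChartedSpace (Coord m) M]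
  [IsManifold (𝓡 (2 * m)) ∞ M] {Δ : DiracMatrices m} {g : Metric (m := m) M}
  (S : SpinStructure Δ g)

open Classical in
/-- The spinor that is given by `u` in the `i`-th chart and frame, and vanishes elsewhere. -/
def extend (i : ℕ) (u : Coord m → Spinor m) (x : M) : Spinor m :=
  if x ∈ (S.chart i).source then act (S.trans (S.idx x) i x) (u (S.chart i x)) else 0

theorem extend_of_notMem {i : ℕ} (u : Coord m → Spinor m) {x : M} (hx : x ∉ (S.chart i).source) :
    S.extend i u x = 0 := if_neg hx

theorem rep_extend {i k : ℕ} (u : Coord m → Spinor m) {x : M} (hi : x ∈ (S.chart i).source)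
    (hk : x ∈ (S.chart k).source) :
    S.rep (S.extend i u) k x = act (S.trans k i x) (u (S.chart i x)) := by
  rw [rep, extend, if_pos hi, ← act_mul,
    S.trans_cocycle _ _ _ x ⟨⟨hk, S.mem_source_idx x⟩, hi⟩]

theorem rep_extend_self {i : ℕ} (u : Coord m → Spinor m) {x : M} (hi : x ∈ (S.chart i).source) :
    S.rep (S.extend i u) i x = u (S.chart i x) := by
  rw [S.rep_extend u hi hi, S.trans_self hi, act_one]

theorem rep_eq_zero {ψ : M → Spinor m} {x : M} (h : ψ x = 0) (i : ℕ) : S.rep ψ i x = 0 := by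
  rw [rep, h, map_zero]

theorem extend_eq_zero {i : ℕ} {u : Coord m → Spinor m} {K : Set (Coord m)}
    (h0 : ∀ y, y ∉ K → u y = 0) {x : M} (hx : x ∉ (S.chart i).symm '' K) : S.extend i u x = 0 := by
  by_cases hi : x ∈ (S.chart i).source
  · rw [extend, if_pos hi, h0 _ fun h => hx ⟨_, h, (S.chart i).left_inv hi⟩, map_zero]
  · exact S.extend_of_notMem u hi

theorem frameDirac_eq_zero {i : ℕ} {f : M → Spinor m} {x : M} (h : f =ᶠ[nhds x] fun _ => 0) :
    S.frameDirac i f x = 0 := by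
  rw [S.frameDirac_congr h]
  have : mfderiv (𝓡 (2 * m)) 𝓘(ℝ, Spinor m) (fun _ : M => (0 : Spinor m)) x = 0 := mfderiv_const
  have e : ∀ a, S.frameDeriv i a (fun _ => (0 : Spinor m)) x = 0 := fun a => by
    rw [frameDeriv, this]
    rfl
  simp only [frameDirac, e, map_zero, sub_zero, Finset.sum_const_zero, smul_zero]

theorem diracSection_eq_zero {ψ : M → Spinor m} {x : M} (h : ψ =ᶠ[nhds x] fun _ => 0) :
    S.diracSection ψ x = 0 :=
  S.frameDirac_eq_zero (h.mono fun _ hz => S.rep_eq_zero hz _)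

theorem isClosed_image_symm [T2Space M] {i : ℕ} {K : Set (Coord m)} (hK : IsCompact K)
    (hKt : K ⊆ (S.chart i).target) : IsClosed ((S.chart i).symm '' K) :=
  (hK.image_of_continuousOn ((S.chart i).continuousOn_symm.mono hKt)).isClosed

/-- Extension by zero is smooth because the image of the compact set is closed in the Hausdorff
space `M`: outside the chart the spinor vanishes on a neighbourhood. -/
theorem isSmoothSpinor_extend [T2Space M] {i : ℕ} {u : Coord m → Spinor m} {K : Set (Coord m)}
    (hu : ContDiff ℝ ∞ u) (hK : IsCompact K) (hKt : K ⊆ (S.chart i).target)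
    (h0 : ∀ y, y ∉ K → u y = 0) : S.IsSmoothSpinor (S.extend i u) := by
  intro k
  have h1 : ContMDiffOn (𝓡 (2 * m)) 𝓘(ℝ, Spinor m) ∞
      (fun x => act (S.trans k i x) (u (S.chart i x))) ((S.chart k).source ∩ (S.chart i).source) :=
    contMDiffOn_act (S.trans_smooth k i)
      ((hu.contMDiff.comp_contMDiffOn (S.contMDiffOn_chart i)).mono Set.inter_subset_right)
  intro x hx
  refine ContMDiffAt.contMDiffWithinAt ?_
  by_cases hi : x ∈ (S.chart i).source
  · have hn := (((S.chart k).open_source.inter (S.chart i).open_source).mem_nhds ⟨hx, hi⟩)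
    refine (h1.contMDiffAt hn).congr_of_eventuallyEq ?_
    filter_upwards [hn] with z hz
    exact S.rep_extend u hz.2 hz.1
  · have hc := S.isClosed_image_symm hK hKt
    have hxK : x ∉ (S.chart i).symm '' K := by
      rintro ⟨y, hy, rfl⟩
      exact hi ((S.chart i).map_target (hKt hy))
    refine (contMDiffAt_const (c := (0 : Spinor m))).congr_of_eventuallyEq ?_
    filter_upwards [hc.isOpen_compl.mem_nhds hxK] with z hz
    exact S.rep_eq_zero (S.extend_eq_zero h0 hz) k

theorem rep_diracSection_extend [T2Space M] {i : ℕ} {u : Coord m → Spinor m} {K : Set (Coord m)}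
    (hu : ContDiff ℝ ∞ u) (hK : IsCompact K) (hKt : K ⊆ (S.chart i).target)
    (h0 : ∀ y, y ∉ K → u y = 0) {y : Coord m} (hy : y ∈ (S.chart i).target) :
    S.rep (S.diracSection (S.extend i u)) i ((S.chart i).symm y) =
      locDirac Δ (S.coordFrame i i) u y := by
  have hx := (S.chart i).map_target hy
  have hs := S.isSmoothSpinor_extend hu hK hKt h0
  rw [S.rep_diracSection hs hx, ← S.locDirac_comp_symm ⟨hy, hx⟩ (hs.mdifferentiableAt hx)]
  have h : (S.rep (S.extend i u) i ∘ (S.chart i).symm) =ᶠ[nhds y] u := by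
    filter_upwards [(S.chart i).open_target.mem_nhds hy] with z hz
    rw [Function.comp_apply, S.rep_extend_self u ((S.chart i).map_target hz),
      (S.chart i).right_inv hz]
  simp only [locDirac, h.fderiv_eq, h.eq_of_nhds]

theorem diracSection_extend_of_notMem [T2Space M] {i : ℕ} {u : Coord m → Spinor m}
    {K : Set (Coord m)} (hK : IsCompact K) (hKt : K ⊆ (S.chart i).target)
    (h0 : ∀ y, y ∉ K → u y = 0) {x : M} (hx : x ∉ (S.chart i).source) :
    S.diracSection (S.extend i u) x = 0 := by
  have hc := S.isClosed_image_symm hK hKt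
  refine S.diracSection_eq_zero ?_
  have hxK : x ∉ (S.chart i).symm '' K := by
    rintro ⟨y, hy, rfl⟩
    exact hx ((S.chart i).map_target (hKt hy))
  filter_upwards [hc.isOpen_compl.mem_nhds hxK] with z hz
  exact S.extend_eq_zero h0 hz

/-- The local expression of a spinor in the `i`-th chart and frame. -/
def pull (i : ℕ) (ψ : M → Spinor m) : Coord m → Spinor m :=
  (S.chart i).target.indicator fun y => S.rep ψ i ((S.chart i).symm y)

theorem pull_eq_zero {i : ℕ} {ψ : M → Spinor m} {K : Set M} (h0 : ∀ x, x ∉ K → ψ x = 0)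
    {y : Coord m} (hy : y ∉ S.chart i '' K) : S.pull i ψ y = 0 := by
  by_cases hyt : y ∈ (S.chart i).target
  · rw [pull, Set.indicator_of_mem hyt]
    exact S.rep_eq_zero (h0 _ fun h => hy ⟨_, h, (S.chart i).right_inv hyt⟩) i
  · rw [pull, Set.indicator_of_notMem hyt]

variable [MeasurableSpace M] [BorelSpace M]

theorem integral_inner_chart {i : ℕ} {ψ φ : M → Spinor m} (hψ : AEStronglyMeasurable ψ S.vol)
    (hφ : AEStronglyMeasurable φ S.vol)
    (h0 : ∀ x, x ∉ (S.chart i).source → inner ℂ (ψ x) (φ x) = 0) :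
    ∫ x, inner ℂ (ψ x) (φ x) ∂S.vol = ∫ y in (S.chart i).target, S.volumeDensity i y •
      inner ℂ (S.rep ψ i ((S.chart i).symm y)) (S.rep φ i ((S.chart i).symm y)) := by
  rw [← setIntegral_eq_integral_of_forall_compl_eq_zero h0, S.setIntegral_vol (hψ.inner hφ).restrict]
  refine setIntegral_congr_fun (S.chart i).open_target.measurableSet fun y hy => ?_
  simp only [S.inner_rep ψ φ ((S.chart i).map_target hy)]

theorem lintegral_sq_chart {i : ℕ} {ψ : M → Spinor m} (hψ : AEStronglyMeasurable ψ S.vol)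
    (h0 : ∀ x, x ∉ (S.chart i).source → ψ x = 0) :
    ∫⁻ x, ‖ψ x‖ₑ ^ 2 ∂S.vol = ∫⁻ y in (S.chart i).target, ENNReal.ofReal (S.volumeDensity i y) *
      ‖S.rep ψ i ((S.chart i).symm y)‖ₑ ^ 2 := by
  have h1 : ∫⁻ x, ‖ψ x‖ₑ ^ 2 ∂S.vol = ∫⁻ x in (S.chart i).source, ‖ψ x‖ₑ ^ 2 ∂S.vol := by
    refine (setLIntegral_eq_of_support_subset ?_).symm
    intro x hx
    by_contra h
    simp [h0 x h] at hx
  rw [h1, S.setLIntegral_vol (hψ.enorm.pow_const 2).restrict]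
  refine setLIntegral_congr_fun (S.chart i).open_target.measurableSet fun y hy => ?_
  rw [← ofReal_norm, ← ofReal_norm, S.norm_rep ψ ((S.chart i).map_target hy)]

/-- The density is bounded below on the compact support, so square integrability for the Riemannian
volume implies it for Lebesgue measure. -/
theorem memLp_pull {i : ℕ} {ψ : M → Spinor m} (hψ : MemLp ψ 2 S.vol) {K : Set M} (hK : IsCompact K)
    (hKs : K ⊆ (S.chart i).source) (h0 : ∀ x, x ∉ K → ψ x = 0) :
    MemLp (S.pull i ψ) 2 volume := by
  have hmeas : AEStronglyMeasurable (S.pull i ψ) volume :=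
    (aestronglyMeasurable_indicator_iff (S.chart i).open_target.measurableSet).2
      (S.aestronglyMeasurable_comp_symm (S.aestronglyMeasurable_rep hψ.1 i))
  rw [memLp_two_iff hmeas]
  have hK' : IsCompact (S.chart i '' K) := hK.image_of_continuousOn ((S.chart i).continuousOn.mono hKs)
  have hKt : S.chart i '' K ⊆ (S.chart i).target := by
    rintro _ ⟨x, hx, rfl⟩
    exact (S.chart i).map_source (hKs hx)
  obtain ⟨C, hC⟩ := hK'.exists_bound_of_continuousOn (f := fun y => (S.volumeDensity i y)⁻¹)
    (((S.contDiffOn_volumeDensity i).continuousOn.inv₀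
      fun y hy => (S.volumeDensity_pos hy).ne').mono hKt)
  have h1 := (memLp_two_iff hψ.1).1 hψ
  rw [S.lintegral_sq_chart hψ.1 fun x hx => h0 x fun h => hx (hKs h)] at h1
  have h2 : ∀ y, ‖S.pull i ψ y‖ₑ ^ 2 ≤ (S.chart i).target.indicator (fun y => ENNReal.ofReal C *
      (ENNReal.ofReal (S.volumeDensity i y) * ‖S.rep ψ i ((S.chart i).symm y)‖ₑ ^ 2)) y := by
    intro y
    by_cases hy : y ∈ S.chart i '' K
    · rw [pull, Set.indicator_of_mem (hKt hy), Set.indicator_of_mem (hKt hy), ← mul_assoc,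
        ← ENNReal.ofReal_mul ((norm_nonneg _).trans (hC y hy))]
      refine le_mul_of_one_le_left' ?_
      rw [← ENNReal.ofReal_one]
      refine ENNReal.ofReal_le_ofReal ?_
      have hp := S.volumeDensity_pos (hKt hy)
      have h3 := hC y hy
      rw [Real.norm_of_nonneg (inv_pos.2 hp).le] at h3
      calc 1 = (S.volumeDensity i y)⁻¹ * S.volumeDensity i y := (inv_mul_cancel₀ hp.ne').symm
        _ ≤ _ := mul_le_mul_of_nonneg_right h3 hp.le
    · rw [S.pull_eq_zero h0 hy]
      simp
  refine (lintegral_mono h2).trans_lt ?_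
  rw [lintegral_indicator (S.chart i).open_target.measurableSet,
    lintegral_const_mul' _ _ ENNReal.ofReal_ne_top]
  exact ENNReal.mul_lt_top ENNReal.ofReal_lt_top h1

theorem integrable_of_memLp_two {E : Type*} [NormedAddCommGroup E] {u : Coord m → E}
    (hu : MemLp u 2 volume) {K : Set (Coord m)} (hK : IsCompact K) (h0 : ∀ y, y ∉ K → u y = 0) :
    Integrable u := by
  have : IsFiniteMeasure ((volume : Measure (Coord m)).restrict K) := ⟨by
    rw [Measure.restrict_apply_univ]; exact hK.measure_lt_top⟩
  have h1 : IntegrableOn u K := (hu.restrict K).integrable (by norm_num)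
  exact h1.integrable_of_forall_notMem_eq_zero h0

end Extension

end SpinStructure

end TwistedDirac
end

/-! ### The symbol of the twisted commutators and the Leibniz rule on sections. -/

noncomputable section

namespace TwistedDirac

namespace SpinStructure

section Symbol

variable {m : ℕ} {M : Type*} [TopologicalSpace M] [ChartedSpace (Coord m) M]
  [IsManifold (𝓡 (2 * m)) ∞ M] {Δ : DiracMatrices m} {g : Metric (m := m) M}
  (S : SpinStructure Δ g)

theorem frameDeriv_trans {F : Type*} [NormedAddCommGroup F] [NormedSpace ℝ F] {i j : ℕ} {x : M}
    (hj : x ∈ (S.chart j).source) (f : M → F) (b : Fin (2 * m)) :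
    S.frameDeriv i b f x =
      ∑ a, g.inner x (S.frame i b x) (S.frame j a x) • S.frameDeriv j a f x := by
  rw [frameDeriv, ← S.sum_inner_frame_smul hj (S.frame i b x), map_sum]
  refine Finset.sum_congr rfl fun a _ => ?_
  rw [map_smul, S.sum_inner_frame_smul hj, g.symm]
  rfl

theorem _root_.TwistedDirac.DiracMatrices.chiral_sum {ι : Type*} (s : Finset ι) (c : ι → ℝ)
    (F G : ι → ℂ) : Δ.chiral (∑ k ∈ s, c k • F k) (∑ k ∈ s, c k • G k) =
      ∑ k ∈ s, (c k : ℂ) • Δ.chiral (F k) (G k) := by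
  simp only [DiracMatrices.chiral_eq, smul_add, smul_smul, Complex.real_smul]
  rw [Finset.sum_add_distrib, ← Finset.sum_smul, ← Finset.sum_smul, ← Finset.sum_add_distrib,
    ← Finset.sum_sub_distrib, Finset.sum_div, Finset.sum_div]
  congr 2 <;> exact Finset.sum_congr rfl fun k _ => by ring

/-- The symbol is an endomorphism of the spinor bundle: the rotation of the Dirac matrices cancels
against that of the derivatives, and spin matrices commute with the chirality. -/
theorem symbol_trans {i j : ℕ} {x : M} (hi : x ∈ (S.chart i).source)
    (hj : x ∈ (S.chart j).source) (F G : M → ℂ) :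
    S.trans i j x * S.symbol j F G x = S.symbol i F G x * S.trans i j x := by
  have hspin := S.trans_spin i j x ⟨hi, hj⟩
  simp only [symbol, Matrix.mul_smul, Matrix.smul_mul, Finset.mul_sum, Finset.sum_mul]
  congr 1
  have e1 : ∀ a, S.trans i j x * (Δ.gamma a * Δ.chiral (S.frameDeriv j a F x)
      (S.frameDeriv j a G x)) = ∑ b, (g.inner x (S.frame i b x) (S.frame j a x) : ℂ) •
        (Δ.gamma b * (Δ.chiral (S.frameDeriv j a F x) (S.frameDeriv j a G x)) *
          S.trans i j x) := by
    intro a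
    rw [← mul_assoc, S.trans_frame i j x ⟨hi, hj⟩, mul_assoc, Δ.spin_chiral hspin, Finset.sum_mul]
    refine Finset.sum_congr rfl fun b _ => ?_
    rw [Matrix.smul_mul, mul_assoc]
  have e2 : ∀ b, Δ.gamma b * Δ.chiral (S.frameDeriv i b F x) (S.frameDeriv i b G x) *
      S.trans i j x = ∑ a, (g.inner x (S.frame i b x) (S.frame j a x) : ℂ) •
        (Δ.gamma b * (Δ.chiral (S.frameDeriv j a F x) (S.frameDeriv j a G x)) *
          S.trans i j x) := by
    intro b
    rw [S.frameDeriv_trans hj F, S.frameDeriv_trans hj G, DiracMatrices.chiral_sum, Finset.mul_sum,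
      Finset.sum_mul]
    refine Finset.sum_congr rfl fun a _ => ?_
    rw [Matrix.mul_smul, Matrix.smul_mul]
  simp only [e1, e2]
  exact Finset.sum_comm

theorem norm_act_conj {L A B : SpinorMatrix m} (hL : Lᴴ * L = 1) (h : L * A = B * L) :
    ‖act A‖ = ‖act B‖ := by
  have hL' : L * Lᴴ = 1 := mul_eq_one_comm.1 hL
  have key : ∀ {L A B : SpinorMatrix m}, Lᴴ * L = 1 → L * Lᴴ = 1 → L * A = B * L →
      ‖act A‖ ≤ ‖act B‖ := by
    intro L A B hL hL' h
    refine ContinuousLinearMap.opNorm_le_bound _ (norm_nonneg _) fun v => ?_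
    rw [← norm_act_unitary hL (act A v), ← act_mul, h, act_mul, ← norm_act_unitary hL v]
    exact (act B).le_opNorm _
  refine le_antisymm (key hL hL' h) (key (L := Lᴴ) ?_ ?_ ?_)
  · rwa [Matrix.conjTranspose_conjTranspose]
  · rwa [Matrix.conjTranspose_conjTranspose]
  · calc Lᴴ * B = Lᴴ * (B * L) * Lᴴ := by rw [mul_assoc, mul_assoc, hL', mul_one]
      _ = A * Lᴴ := by rw [← h, ← mul_assoc Lᴴ, hL, one_mul]

theorem continuousOn_frameDeriv {F : Type*} [NormedAddCommGroup F] [NormedSpace ℝ F] {i : ℕ}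
    {f : M → F} (hf : ContMDiff (𝓡 (2 * m)) 𝓘(ℝ, F) ∞ f) (a : Fin (2 * m)) :
    ContinuousOn (S.frameDeriv i a f) (S.chart i).source := by
  have h1 : ContDiffOn ℝ ∞ (f ∘ (S.chart i).symm) (S.chart i).target := by
    have := S.contDiffOn_comp_symm (i := i) (hf.contMDiffOn (s := Set.univ))
    simpa using this
  have h2 := (h1.continuousOn_fderiv_of_isOpen (S.chart i).open_target (by simp)).clm_apply
    ((S.contDiffOn_coordFrame i i a).continuousOn.mono (S.coordDomain_self i).ge)
  refine (h2.comp (S.chart i).continuousOn fun x hx => (S.chart i).map_source hx).congr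
    fun x hx => ?_
  rw [Function.comp_apply, S.fderiv_comp_symm ((S.chart i).map_source hx)
    (hf.mdifferentiableAt (by simp)), (S.chart i).left_inv hx]

theorem continuousOn_symbol {i : ℕ} {F G : M → ℂ} (hF : ContMDiff (𝓡 (2 * m)) 𝓘(ℝ, ℂ) ∞ F)
    (hG : ContMDiff (𝓡 (2 * m)) 𝓘(ℝ, ℂ) ∞ G) :
    ContinuousOn (fun x => act (S.symbol i F G x)) (S.chart i).source := by
  refine continuousOn_actMatrix fun k l => ?_
  have hF' := fun a => S.continuousOn_frameDeriv (i := i) hF a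
  have hG' := fun a => S.continuousOn_frameDeriv (i := i) hG a
  have h : ∀ x, S.symbol i F G x k l = -Complex.I * ∑ a,
      ((S.frameDeriv i a F x + S.frameDeriv i a G x) / 2 * Δ.gamma a k l +
        (S.frameDeriv i a F x - S.frameDeriv i a G x) / 2 * (Δ.gamma a * Δ.grading) k l) := by
    intro x
    simp only [symbol, DiracMatrices.chiral_eq, Matrix.smul_apply, Matrix.sum_apply, mul_add,
      Matrix.mul_smul, Matrix.add_apply, mul_one, smul_eq_mul]
  simp only [h]
  refine continuousOn_const.mul (continuousOn_finsetSum _ fun a _ => ContinuousOn.add ?_ ?_)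
  · exact (((hF' a).add (hG' a)).div_const 2).mul continuousOn_const
  · exact (((hF' a).sub (hG' a)).div_const 2).mul continuousOn_const

/-- The transition matrices are unitary, so the norm of the symbol does not depend on the frame.
This is the boundedness of the twisted commutators. -/
theorem memLp_symbol [CompactSpace M] [MeasurableSpace M] [BorelSpace M] {F G : M → ℂ}
    (hF : ContMDiff (𝓡 (2 * m)) 𝓘(ℝ, ℂ) ∞ F) (hG : ContMDiff (𝓡 (2 * m)) 𝓘(ℝ, ℂ) ∞ G) :
    MemLp (fun x => act (S.symbol (S.idx x) F G x)) ⊤ S.vol := by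
  obtain ⟨C, hC⟩ := S.bounded_of_continuousOn (f := fun x => act (S.symbol (S.idx x) F G x))
    (f' := fun k x => act (S.symbol k F G x))
    (fun k x hx => norm_act_conj (S.trans_conjTranspose_mul hx (S.mem_source_idx x))
      (S.symbol_trans hx (S.mem_source_idx x) F G)) fun k => S.continuousOn_symbol hF hG
  refine memLp_top_of_bound (S.aestronglyMeasurable_of_continuousOn
    (f' := fun k x => act (S.symbol k F G x)) ?_ fun k => S.continuousOn_symbol hF hG) C
    (Filter.Eventually.of_forall hC)
  rintro _ x rfl
  rfl

/-- The matrix by which `π(a)` acts at a point. -/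
def piMat (Δ : DiracMatrices m) (a : Alg m M) (x : M) : SpinorMatrix m :=
  Δ.chiral ((a.1 : M → ℂ) x) ((a.2 : M → ℂ) x)

theorem rep_piMat (a : Alg m M) (ψ : M → Spinor m) {i : ℕ} {x : M} (hi : x ∈ (S.chart i).source) :
    S.rep (fun z => act (piMat Δ a z) (ψ z)) i x = act (piMat Δ a x) (S.rep ψ i x) := by
  rw [rep, rep, ← act_mul, ← act_mul, piMat,
    Δ.spin_chiral (S.trans_spin i _ x ⟨hi, S.mem_source_idx x⟩)]

theorem contMDiff_piMat (a : Alg m M) (k l : Fin (2 ^ m)) :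
    ContMDiff (𝓡 (2 * m)) 𝓘(ℝ, ℂ) ∞ fun x => piMat Δ a x k l := by
  have h : ∀ x, piMat Δ a x k l = ((a.1 : M → ℂ) x + (a.2 : M → ℂ) x) / 2 * (1 : SpinorMatrix m) k l +
      ((a.1 : M → ℂ) x - (a.2 : M → ℂ) x) / 2 * Δ.grading k l := by
    intro x
    simp [piMat, DiracMatrices.chiral_eq]
  simp only [h]
  have hc : ContDiff ℝ ∞ fun p : ℂ × ℂ => (p.1 + p.2) / 2 * (1 : SpinorMatrix m) k l +
      (p.1 - p.2) / 2 * Δ.grading k l := by fun_prop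
  have h1 : ContMDiff (𝓡 (2 * m)) 𝓘(ℝ, ℂ) ∞ (a.1 : M → ℂ) := a.1.2
  have h2 : ContMDiff (𝓡 (2 * m)) 𝓘(ℝ, ℂ) ∞ (a.2 : M → ℂ) := a.2.2
  have h3 := hc.contMDiff.comp (h1.prodMk_space h2)
  exact h3

theorem isSmoothSpinor_piMat (a : Alg m M) {ψ : M → Spinor m} (hψ : S.IsSmoothSpinor ψ) :
    S.IsSmoothSpinor fun x => act (piMat Δ a x) (ψ x) := fun i =>
  (contMDiffOn_act (fun k l => (contMDiff_piMat a k l).contMDiffOn) (hψ i)).congr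
    fun _ hx => S.rep_piMat a ψ hx

/-- The Leibniz rule for the Dirac operator. -/
theorem diracSection_piMat (a : Alg m M) {ψ : M → Spinor m} (hψ : S.IsSmoothSpinor ψ) (x : M) :
    S.diracSection (fun x => act (piMat Δ a x) (ψ x)) x =
      act (piMat Δ (rho a) x) (S.diracSection ψ x) +
        act (S.symbol (S.idx x) a.1 a.2 x) (ψ x) := by
  have hx := S.mem_source_idx x
  have he : S.rep (fun x => act (piMat Δ a x) (ψ x)) (S.idx x) =ᶠ[nhds x]
      fun z => act (piMat Δ a z) (S.rep ψ (S.idx x) z) := by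
    filter_upwards [(S.chart (S.idx x)).open_source.mem_nhds hx] with z hz
    exact S.rep_piMat a ψ hz
  have h1 := (S.isSmoothSpinor_piMat a hψ).mdifferentiableAt hx
  rw [diracSection_eq, diracSection_eq, S.frameDirac_congr he]
  refine (S.frameDirac_chiral hx (ContMDiff.mdifferentiableAt a.1.2 (by simp))
    (ContMDiff.mdifferentiableAt a.2.2 (by simp)) (hψ.mdifferentiableAt hx)
    (h1.congr_of_eventuallyEq he.symm)).trans ?_
  rw [S.rep_idx]
  rfl

end Symbol

end SpinStructure

end TwistedDirac
end

/-! ### Multiplication operators on `L²(M, S)` and the representation of the algebra. -/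

noncomputable section

namespace TwistedDirac

namespace SpinStructure

section Operators

variable {m : ℕ} {M : Type*} [TopologicalSpace M] [ChartedSpace (Coord m) M]
  [IsManifold (𝓡 (2 * m)) ∞ M] {Δ : DiracMatrices m} {g : Metric (m := m) M}
  (S : SpinStructure Δ g) [MeasurableSpace M]

/-- The operator `T` acts by multiplication by the matrices `Φ x`. -/
def IsMul (T : S.Hilb →L[ℂ] S.Hilb) (Φ : M → SpinorMatrix m) : Prop :=
  ∀ ψ : S.Hilb, T ψ =ᵐ[S.vol] fun x => act (Φ x) (ψ x)

variable {S}

theorem IsMul.ext {T T' : S.Hilb →L[ℂ] S.Hilb} {Φ : M → SpinorMatrix m} (h : S.IsMul T Φ)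
    (h' : S.IsMul T' Φ) : T = T' :=
  ContinuousLinearMap.ext fun ψ => Lp.ext ((h ψ).trans (h' ψ).symm)

theorem IsMul.congr {T : S.Hilb →L[ℂ] S.Hilb} {Φ Φ' : M → SpinorMatrix m} (h : S.IsMul T Φ)
    (hΦ : ∀ x, Φ x = Φ' x) : S.IsMul T Φ' := by
  rwa [← funext hΦ]

theorem IsMul.comp {T T' : S.Hilb →L[ℂ] S.Hilb} {Φ Φ' : M → SpinorMatrix m} (h : S.IsMul T Φ)
    (h' : S.IsMul T' Φ') : S.IsMul (T ∘L T') fun x => Φ x * Φ' x := fun ψ => by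
  filter_upwards [h (T' ψ), h' ψ] with x h1 h2
  rw [ContinuousLinearMap.comp_apply, h1, h2, act_mul]

theorem IsMul.add {T T' : S.Hilb →L[ℂ] S.Hilb} {Φ Φ' : M → SpinorMatrix m} (h : S.IsMul T Φ)
    (h' : S.IsMul T' Φ') : S.IsMul (T + T') fun x => Φ x + Φ' x := fun ψ => by
  filter_upwards [h ψ, h' ψ, Lp.coeFn_add (T ψ) (T' ψ)] with x h1 h2 h3
  rw [_root_.add_apply, h3, Pi.add_apply, h1, h2, act_add]

theorem IsMul.smul {T : S.Hilb →L[ℂ] S.Hilb} {Φ : M → SpinorMatrix m} (c : ℂ) (h : S.IsMul T Φ) :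
    S.IsMul (c • T) fun x => c • Φ x := fun ψ => by
  filter_upwards [h ψ, Lp.coeFn_smul c (T ψ)] with x h1 h2
  rw [_root_.smul_apply, h2, Pi.smul_apply, h1, act_smul]

theorem isMul_one : S.IsMul (1 : S.Hilb →L[ℂ] S.Hilb) fun _ => 1 := fun _ =>
  Filter.Eventually.of_forall fun _ => (act_one _).symm

theorem isMul_constOp (A : SpinorMatrix m) : S.IsMul (S.constOp A) fun _ => A := fun ψ =>
  ContinuousLinearMap.coeFn_compLpL (act A) ψ

theorem inner_eq (ψ φ : S.Hilb) : inner ℂ ψ φ = ∫ x, inner ℂ (ψ x) (φ x) ∂S.vol :=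
  L2.inner_def ψ φ

theorem IsMul.adjoint_eq {T T' : S.Hilb →L[ℂ] S.Hilb} {Φ : M → SpinorMatrix m} (h : S.IsMul T Φ)
    (h' : S.IsMul T' fun x => (Φ x)ᴴ) : ContinuousLinearMap.adjoint T = T' := by
  refine ((ContinuousLinearMap.eq_adjoint_iff T' T).2 fun ψ φ => ?_).symm
  rw [inner_eq, inner_eq]
  refine integral_congr_ae ?_
  filter_upwards [h φ, h' ψ] with x h1 h2
  rw [h1, h2, inner_act_left, Matrix.conjTranspose_conjTranspose]

theorem IsMul.conjJ {T : S.Hilb →L[ℂ] S.Hilb} {Φ : M → SpinorMatrix m} (h : S.IsMul T Φ) :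
    S.IsMul (S.conjJ T) fun x => Δ.chargeConj * (Φ x).map star * Δ.chargeConjᴴ := fun ψ => by
  have h1 := ContinuousLinearMap.coeFn_compLpL (μ := S.vol) (p := 2)
    ((conjSpinor m).comp (act Δ.chargeConjᴴ)) ψ
  have h2 := h ((((conjSpinor m).comp (act Δ.chargeConjᴴ)).compLpL 2 S.vol) ψ)
  have h3 := ContinuousLinearMap.coeFn_compLpL (μ := S.vol) (p := 2)
    ((act Δ.chargeConj).comp (conjSpinor m))
    (T ((((conjSpinor m).comp (act Δ.chargeConjᴴ)).compLpL 2 S.vol) ψ))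
  filter_upwards [h1, h2, h3] with x h1 h2 h3
  refine h3.trans ?_
  simp only [h2, h1, ContinuousLinearMap.comp_apply]
  rw [act_conjSpinor (Φ x), conjSpinor_conjSpinor, act_mul, act_mul]

/-- The operator of multiplication by a bounded matrix-valued function. -/
def matOp (S : SpinStructure Δ g) (Φ : M → SpinorMatrix m)
    (h : MemLp (fun x => act (Φ x)) ⊤ S.vol) : S.Hilb →L[ℂ] S.Hilb :=
  (ContinuousLinearMap.id ℂ (Spinor m →L[ℂ] Spinor m)).holderL S.vol ⊤ 2 2 h.toLp

theorem isMul_matOp {Φ : M → SpinorMatrix m} (h : MemLp (fun x => act (Φ x)) ⊤ S.vol) :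
    S.IsMul (S.matOp Φ h) Φ := fun ψ => by
  filter_upwards [ContinuousLinearMap.coeFn_holder (r := 2)
    (ContinuousLinearMap.id ℂ (Spinor m →L[ℂ] Spinor m)) h.toLp ψ, h.coeFn_toLp] with x h1 h2
  refine h1.trans ?_
  rw [h2]
  rfl

variable [BorelSpace M] [CompactSpace M]

theorem isMul_mulOp (f : smoothFunctions m M) :
    S.IsMul (S.mulOp f) fun x => ((f : M → ℂ) x) • 1 := fun ψ => by
  filter_upwards [ContinuousLinearMap.coeFn_holder (r := 2)
    (ContinuousLinearMap.lsmul ℂ ℂ : ℂ →L[ℂ] Spinor m →L[ℂ] Spinor m) (S.memLp_top f).toLp ψ,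
    (S.memLp_top f).coeFn_toLp] with x h1 h2
  refine h1.trans ?_
  rw [h2, act_smul, act_one]
  rfl

theorem isMul_pi (a : Alg m M) : S.IsMul (S.pi a) (piMat Δ a) := by
  refine (((isMul_constOp _).comp (isMul_mulOp a.1)).add
    ((isMul_constOp _).comp (isMul_mulOp a.2))).congr fun x => ?_
  rw [piMat, DiracMatrices.chiral]
  simp [smul_smul]

theorem pi_adjoint (hm : Even m) (a : Alg m M) :
    ContinuousLinearMap.adjoint (S.pi a) = S.pi (star a) :=
  (isMul_pi a).adjoint_eq ((isMul_pi (star a)).congr fun _ =>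
    (Δ.chiral_conjTranspose hm _ _).symm)

theorem pi_mul (hm : Even m) (a b : Alg m M) : S.pi (a * b) = S.pi a ∘L S.pi b :=
  ((isMul_pi _).ext (((isMul_pi a).comp (isMul_pi b)).congr fun _ =>
    Δ.chiral_mul hm _ _ _ _))

theorem pi_one : S.pi (1 : Alg m M) = 1 :=
  (isMul_pi _).ext (isMul_one.congr fun _ => Δ.chiral_one.symm)

/-- `J` is antilinear and preserves the chirality, so it conjugates the two functions without
exchanging them. -/
theorem conjJ_pi (hm : Even m) (a : Alg m M) : S.conjJ (S.pi a) = S.pi (star a) := by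
  refine (isMul_pi a).conjJ.ext ((isMul_pi (star a)).congr fun x => ?_)
  rw [piMat, piMat, Δ.chargeConj_chiral hm, mul_assoc, Δ.chargeConj_mul_star, mul_one]
  rfl

theorem Ad_eq (hm : Even m) (a : Alg m M) : S.Ad a = S.pi (a * star a) := by
  rw [Ad, conjJ_pi hm, pi_mul hm]

/-- `γ⁰` exchanges the chiralities, so conjugation by it implements `ρ`. The adjoint then gives
`star (rho a)`. -/
theorem plusOp_pi [NeZero m] (hm : Even m) (a : Alg m M) : S.plusOp (S.pi a) = S.pi (plus a) := by
  have h : S.IsMul (S.gammaZero ∘L S.pi a ∘L S.gammaZero) (piMat Δ (rho a)) := by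
    refine ((isMul_constOp _).comp ((isMul_pi a).comp (isMul_constOp _))).congr fun x => ?_
    rw [← mul_assoc, piMat, Δ.gamma_chiral, mul_assoc, Δ.gamma_mul_self, mul_one]
    rfl
  rw [plusOp, h.adjoint_eq ((isMul_pi (plus a)).congr fun _ =>
    (Δ.chiral_conjTranspose hm _ _).symm)]

/-- The twisted commutator of the Dirac operator with an element of the algebra. -/
def commutator (S : SpinStructure Δ g) (a : Alg m M) : S.Hilb →L[ℂ] S.Hilb :=
  S.matOp (fun x => S.symbol (S.idx x) a.1 a.2 x) (S.memLp_symbol a.1.2 a.2.2)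

theorem isMul_commutator (a : Alg m M) :
    S.IsMul (S.commutator a) fun x => S.symbol (S.idx x) a.1 a.2 x := isMul_matOp _

/-- The class of a smooth spinor in `L²(M, S)`. -/
def toHilb {ψ : M → Spinor m} (hψ : S.IsSmoothSpinor ψ) : S.Hilb :=
  (S.memLp_of_continuousOn_rep hψ.continuousOn_rep 2).toLp

theorem coeFn_toHilb {ψ : M → Spinor m} (hψ : S.IsSmoothSpinor ψ) : toHilb hψ =ᵐ[S.vol] ψ :=
  MemLp.coeFn_toLp _

theorem IsMul.toHilb {T : S.Hilb →L[ℂ] S.Hilb} {Φ : M → SpinorMatrix m} (h : S.IsMul T Φ)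
    {ψ : M → Spinor m} (hψ : S.IsSmoothSpinor ψ) :
    T (toHilb hψ) =ᵐ[S.vol] fun x => act (Φ x) (ψ x) := by
  filter_upwards [h (SpinStructure.toHilb hψ), coeFn_toHilb hψ] with x h1 h2
  rw [h1, h2]

theorem pi_toHilb (a : Alg m M) {ψ : M → Spinor m} (hψ : S.IsSmoothSpinor ψ) :
    S.pi a (toHilb hψ) = toHilb (S.isSmoothSpinor_piMat a hψ) :=
  Lp.ext (((isMul_pi a).toHilb hψ).trans (coeFn_toHilb _).symm)

theorem dirac_pi_toHilb (a : Alg m M) {ψ : M → Spinor m} (hψ : S.IsSmoothSpinor ψ) :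
    toHilb (S.isSmoothSpinor_diracSection (S.isSmoothSpinor_piMat a hψ)) =
      S.pi (rho a) (toHilb (S.isSmoothSpinor_diracSection hψ)) + S.commutator a (toHilb hψ) := by
  refine Lp.ext ?_
  filter_upwards [coeFn_toHilb (S.isSmoothSpinor_diracSection (S.isSmoothSpinor_piMat a hψ)),
    (isMul_pi (rho a)).toHilb (S.isSmoothSpinor_diracSection hψ),
    (isMul_commutator a).toHilb hψ,
    Lp.coeFn_add (S.pi (rho a) (toHilb (S.isSmoothSpinor_diracSection hψ)))
      (S.commutator a (toHilb hψ))] with x h1 h2 h3 h4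
  rw [h1, h4, Pi.add_apply, h2, h3, S.diracSection_piMat a hψ]

end Operators

end SpinStructure

end TwistedDirac
end

noncomputable section

namespace TwistedDirac

/-! ### Unbounded operators -/

section Unbounded

variable {H : Type*} [NormedAddCommGroup H] [InnerProductSpace ℂ H]

theorem eq_zero_of_mem_closure_span {F G : Type*} [NormedAddCommGroup F] [NormedSpace ℂ F]
    [NormedAddCommGroup G] [NormedSpace ℂ G] {s : Set F} (L : F →L[ℂ] G) (h : ∀ p ∈ s, L p = 0)
    {p : F} (hp : p ∈ (Submodule.span ℂ s).topologicalClosure) : L p = 0 := by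
  have h1 : (Submodule.span ℂ s).topologicalClosure ≤ LinearMap.ker (L : F →ₗ[ℂ] G) :=
    Submodule.topologicalClosure_minimal _ (Submodule.span_le.2 fun q hq => h q hq) L.isClosed_ker
  exact h1 hp

theorem map_mem_closure_span {F : Type*} [NormedAddCommGroup F] [NormedSpace ℂ F] {s : Set F}
    (L : F →L[ℂ] F) (h : ∀ p ∈ s, L p ∈ s) {p : F}
    (hp : p ∈ (Submodule.span ℂ s).topologicalClosure) :
    L p ∈ (Submodule.span ℂ s).topologicalClosure := by
  have h1 : (Submodule.span ℂ s).topologicalClosure ≤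
      (Submodule.span ℂ s).topologicalClosure.comap (L : F →ₗ[ℂ] F) := by
    refine Submodule.topologicalClosure_minimal _ (Submodule.span_le.2 fun q hq =>
      Submodule.le_topologicalClosure _ (Submodule.subset_span (h q hq))) ?_
    exact (Submodule.isClosed_topologicalClosure _).preimage L.continuous
  exact h1 hp

/-- The functional whose vanishing says that a pair is related to `q` by a formal adjunction. -/
def adjunctionDefect (q : H × H) : H × H →L[ℂ] ℂ :=
  (innerSL ℂ q.1).comp (ContinuousLinearMap.snd ℂ H H) -
    (innerSL ℂ q.2).comp (ContinuousLinearMap.fst ℂ H H)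

theorem adjunctionDefect_eq_zero {p q : H × H} :
    adjunctionDefect q p = 0 ↔ inner ℂ q.1 p.2 = inner ℂ q.2 p.1 := by
  simp [adjunctionDefect, sub_eq_zero]

/-- For a fixed element of `s`, symmetry is the vanishing of a continuous functional, so it extends
to the closed span. The extension is made in one variable and then in the other. -/
theorem symm_of_mem_closure_span {s : Set (H × H)}
    (hs : ∀ p ∈ s, ∀ q ∈ s, inner ℂ p.2 q.1 = inner ℂ p.1 q.2) {p q : H × H}
    (hp : p ∈ (Submodule.span ℂ s).topologicalClosure)
    (hq : q ∈ (Submodule.span ℂ s).topologicalClosure) :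
    inner ℂ p.2 q.1 = inner ℂ p.1 q.2 := by
  have h1 : ∀ r ∈ s, inner ℂ r.1 p.2 = inner ℂ r.2 p.1 := fun r hr =>
    adjunctionDefect_eq_zero.1 (eq_zero_of_mem_closure_span (adjunctionDefect r)
      (fun t ht => adjunctionDefect_eq_zero.2 (hs r hr t ht).symm) hp)
  refine (adjunctionDefect_eq_zero.1 (eq_zero_of_mem_closure_span (adjunctionDefect p)
    (fun r hr => adjunctionDefect_eq_zero.2 ?_) hq)).symm
  have := congrArg (starRingEnd ℂ) (h1 r hr)
  rw [inner_conj_symm, inner_conj_symm] at this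
  exact this.symm

theorem eq_zero_of_dense {D : Set H} (hD : Dense D) {x : H} (h : ∀ d ∈ D, inner ℂ d x = 0) :
    x = 0 := by
  have h1 : ∀ d : H, inner ℂ d x = 0 := fun d =>
    hD.induction (P := fun d => inner ℂ d x = 0) h
      (isClosed_eq (continuous_id.inner continuous_const) continuous_const) d
  exact inner_self_eq_zero.1 (h1 x)

/-- For bounded sequences weak convergence can be tested on a dense set. Without the bound the
approximation error would not be uniform in `n`. -/
theorem tendsto_inner_of_dense {D : Set H} (hD : Dense D) {p : ℕ → H} {ψ : H} {C : ℝ}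
    (hp : ∀ n, ‖p n‖ ≤ C)
    (h : ∀ d ∈ D, Filter.Tendsto (fun n => inner ℂ d (p n)) Filter.atTop (nhds (inner ℂ d ψ)))
    (x : H) : Filter.Tendsto (fun n => inner ℂ x (p n)) Filter.atTop (nhds (inner ℂ x ψ)) := by
  rw [Metric.tendsto_atTop]
  intro ε hε
  have hC : 0 ≤ C := (norm_nonneg _).trans (hp 0)
  have hpos : 0 < C + ‖ψ‖ + 1 := by positivity
  obtain ⟨d, hdD, hd⟩ := Metric.mem_closure_iff.1 (hD x) (ε / 2 / (C + ‖ψ‖ + 1)) (by positivity)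
  obtain ⟨N, hN⟩ := Metric.tendsto_atTop.1 (h d hdD) (ε / 2) (by positivity)
  refine ⟨N, fun n hn => ?_⟩
  have h1 := hN n hn
  rw [dist_eq_norm, ← inner_sub_right] at h1 ⊢
  rw [dist_eq_norm] at hd
  have e : inner ℂ x (p n - ψ) = inner ℂ (x - d) (p n - ψ) + inner ℂ d (p n - ψ) := by
    rw [← inner_add_left, sub_add_cancel]
  have h2 : ‖inner ℂ (x - d) (p n - ψ)‖ ≤ ε / 2 := by
    refine (norm_inner_le_norm _ _).trans ?_
    have h3 : ‖p n - ψ‖ ≤ C + ‖ψ‖ + 1 := by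
      linarith [norm_sub_le (p n) ψ, hp n]
    calc _ ≤ ε / 2 / (C + ‖ψ‖ + 1) * (C + ‖ψ‖ + 1) :=
          mul_le_mul hd.le h3 (norm_nonneg _) (by positivity)
      _ = ε / 2 := div_mul_cancel₀ _ hpos.ne'
  rw [e]
  exact (norm_add_le _ _).trans_lt (by linarith)

variable [CompleteSpace H]

theorem dense_of_orthogonal {D : Submodule ℂ H} (h : ∀ x, (∀ d ∈ D, inner ℂ d x = 0) → x = 0) :
    Dense (D : Set H) := by
  rw [Submodule.dense_iff_topologicalClosure_eq_top, Submodule.topologicalClosure_eq_top_iff,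
    Submodule.eq_bot_iff]
  exact fun x hx => h x fun d hd => (Submodule.mem_orthogonal D x).1 hx d hd

/-- Symmetry puts `T` below its adjoint, and `hmax` puts the domain of the adjoint inside that of
`T`. -/
theorem isSelfAdjoint_of_maximal {T : H →ₗ.[ℂ] H} (hd : Dense (T.domain : Set H))
    (hs : ∀ x y : T.domain, inner ℂ (T x) (y : H) = inner ℂ (x : H) (T y))
    (hmax : ∀ ψ η : H, (∀ φ : T.domain, inner ℂ (T φ) ψ = inner ℂ (φ : H) η) → ψ ∈ T.domain) :
    IsSelfAdjoint T := by
  rw [LinearPMap.isSelfAdjoint_def]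
  have h1 : T ≤ T.adjoint := LinearPMap.IsFormalAdjoint.le_adjoint hd fun x y => hs x y
  refine (LinearPMap.eq_of_le_of_domain_eq h1 (le_antisymm h1.1 fun y hy => ?_)).symm
  refine hmax y (T.adjoint ⟨y, hy⟩) fun φ => ?_
  have := congrArg (starRingEnd ℂ) (LinearPMap.adjoint_isFormalAdjoint hd ⟨y, hy⟩ φ)
  rw [inner_conj_symm, inner_conj_symm] at this
  exact this.symm

theorem isSelfAdjoint_vadd {T : H →ₗ.[ℂ] H} (hd : Dense (T.domain : Set H))
    (hs : ∀ x y : T.domain, inner ℂ (T x) (y : H) = inner ℂ (x : H) (T y))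
    (hmax : ∀ ψ η : H, (∀ φ : T.domain, inner ℂ (T φ) ψ = inner ℂ (φ : H) η) → ψ ∈ T.domain)
    {B : H →L[ℂ] H} (hB : ContinuousLinearMap.adjoint B = B) :
    IsSelfAdjoint ((B : H →ₗ[ℂ] H) +ᵥ T) := by
  have hB' : ∀ x y : H, inner ℂ (B x) y = inner ℂ x (B y) := fun x y => by
    conv_lhs => rw [← hB]
    exact ContinuousLinearMap.adjoint_inner_left B y x
  refine isSelfAdjoint_of_maximal hd (fun x y => ?_) fun ψ η h => hmax ψ (η - B ψ) fun φ => ?_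
  · change inner ℂ (B x + T x) (y : H) = inner ℂ (x : H) (B y + T y)
    rw [inner_add_left, inner_add_right, hB', hs]
  · have h1 : inner ℂ (B φ + T φ) ψ = inner ℂ (φ : H) η := h φ
    rw [inner_add_left, hB'] at h1
    rw [inner_sub_right, ← h1]
    ring

/-- A closed subspace of `H × H` contains the weak limits of its bounded sequences. -/
theorem mem_of_weak_limit {Γ : Submodule ℂ (H × H)} (hΓ : IsClosed (Γ : Set (H × H))) {D : Set H}
    (hD : Dense D) {p : ℕ → H × H} (hpΓ : ∀ n, p n ∈ Γ) {C : ℝ} (h1 : ∀ n, ‖(p n).1‖ ≤ C)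
    (h2 : ∀ n, ‖(p n).2‖ ≤ C) {ψ η : H}
    (hψ : ∀ d ∈ D, Filter.Tendsto (fun n => inner ℂ d (p n).1) Filter.atTop (nhds (inner ℂ d ψ)))
    (hη : ∀ d ∈ D, Filter.Tendsto (fun n => inner ℂ d (p n).2) Filter.atTop (nhds (inner ℂ d η))) :
    (ψ, η) ∈ Γ := by
  by_contra hn
  -- Were the pair outside `Γ`, Hahn–Banach would separate it from `Γ` strictly. By Riesz the
  -- functional is a sum of two inner products, so it passes to the weak limit, against the strict
  -- inequality.
  have hconv : Convex ℝ (Γ : Set (H × H)) := (Γ.restrictScalars ℝ).convex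
  obtain ⟨f, u, hfu, huf⟩ := RCLike.geometric_hahn_banach_closed_point (𝕜 := ℂ) hconv hΓ hn
  obtain ⟨x, hx⟩ := (InnerProductSpace.toDual ℂ H).surjective
    (f.comp (ContinuousLinearMap.inl ℂ H H))
  obtain ⟨y, hy⟩ := (InnerProductSpace.toDual ℂ H).surjective
    (f.comp (ContinuousLinearMap.inr ℂ H H))
  have hf : ∀ q : H × H, f q = inner ℂ x q.1 + inner ℂ y q.2 := by
    intro q
    have e1 := congrArg (fun L => L q.1) hx
    have e2 := congrArg (fun L => L q.2) hy
    simp only [InnerProductSpace.toDual_apply_apply, ContinuousLinearMap.comp_apply,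
      ContinuousLinearMap.inl_apply, ContinuousLinearMap.inr_apply] at e1 e2
    rw [e1, e2, ← map_add, Prod.mk_add_mk, add_zero, zero_add]
  have hlim : Filter.Tendsto (fun n => f (p n)) Filter.atTop (nhds (f (ψ, η))) := by
    simp only [hf]
    exact (tendsto_inner_of_dense hD h1 hψ x).add (tendsto_inner_of_dense hD h2 hη y)
  have hre := (Complex.continuous_re.tendsto _).comp hlim
  have := le_of_tendsto' hre fun n => (hfu (p n) (hpΓ n)).le
  exact absurd huf (not_lt.2 this)

end Unbounded

end TwistedDirac
end

/-! ### Partitions of unity and multiplication by real functions. -/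

noncomputable section

namespace TwistedDirac

namespace SpinStructure

section Density

variable {m : ℕ} {M : Type*} [TopologicalSpace M] [ChartedSpace (Coord m) M]
  [IsManifold (𝓡 (2 * m)) ∞ M] {Δ : DiracMatrices m} {g : Metric (m := m) M}
  (S : SpinStructure Δ g)

theorem frameDeriv_comp {F F' : Type*} [NormedAddCommGroup F] [NormedSpace ℝ F]
    [NormedAddCommGroup F'] [NormedSpace ℝ F'] {φ : F → F'} {h : M → F} {x : M}
    (hφ : DifferentiableAt ℝ φ (h x)) (hh : MDifferentiableAt (𝓡 (2 * m)) 𝓘(ℝ, F) h x) (i : ℕ)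
    (a : Fin (2 * m)) :
    S.frameDeriv i a (φ ∘ h) x = fderiv ℝ φ (h x) (S.frameDeriv i a h x) := by
  have h1 := mfderiv_comp (I'' := 𝓘(ℝ, F')) x hφ.mdifferentiableAt hh
  rw [mfderiv_eq_fderiv] at h1
  rw [frameDeriv, h1]
  rfl

/-- A smooth real function as an element of the algebra of smooth complex functions. -/
def _root_.TwistedDirac.realFunction (h : M → ℝ) (hh : ContMDiff (𝓡 (2 * m)) 𝓘(ℝ, ℝ) ∞ h) :
    smoothFunctions m M :=
  ⟨fun x => (h x : ℂ), (Complex.ofRealCLM.contDiff (n := ∞)).contMDiff.comp hh⟩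

theorem frameDeriv_real {h : M → ℝ} (hh : ContMDiff (𝓡 (2 * m)) 𝓘(ℝ, ℝ) ∞ h) (i : ℕ)
    (a : Fin (2 * m)) (x : M) :
    S.frameDeriv i a (fun x => (h x : ℂ)) x = ((S.frameDeriv i a h x : ℝ) : ℂ) := by
  have h1 := S.frameDeriv_comp (φ := Complex.ofRealCLM) (h := h) (x := x)
    Complex.ofRealCLM.differentiableAt (hh.mdifferentiableAt (by simp)) i a
  rw [ContinuousLinearMap.fderiv] at h1
  exact h1

/-- The element `(h, h)` of the algebra, for a smooth real function `h`. -/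
def _root_.TwistedDirac.diag (h : M → ℝ) (hh : ContMDiff (𝓡 (2 * m)) 𝓘(ℝ, ℝ) ∞ h) : Alg m M :=
  (realFunction h hh, realFunction h hh)

variable {h : M → ℝ} (hh : ContMDiff (𝓡 (2 * m)) 𝓘(ℝ, ℝ) ∞ h)

theorem piMat_diag (x : M) : piMat Δ (diag h hh) x = (h x : ℂ) • 1 := Δ.chiral_self _

theorem symbol_diag (i : ℕ) (x : M) :
    S.symbol i (diag h hh).1 (diag h hh).2 x =
      (-Complex.I) • ∑ a, ((S.frameDeriv i a h x : ℝ) : ℂ) • Δ.gamma a := by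
  simp only [symbol, diag, realFunction, S.frameDeriv_real hh, Δ.chiral_self, Matrix.mul_smul,
    mul_one]

theorem symbol_diag_conjTranspose (i : ℕ) (x : M) :
    (S.symbol i (diag h hh).1 (diag h hh).2 x)ᴴ = -S.symbol i (diag h hh).1 (diag h hh).2 x := by
  rw [symbol_diag, Matrix.conjTranspose_smul, Matrix.conjTranspose_sum]
  simp [Matrix.conjTranspose_smul, Δ.gamma_conjTranspose]

theorem frameDeriv_eq_zero_of_notMem {x : M} (hx : x ∉ tsupport h) (i : ℕ) (a : Fin (2 * m)) :
    S.frameDeriv i a h x = 0 := by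
  have h1 : h =ᶠ[nhds x] fun _ => 0 := notMem_tsupport_iff_eventuallyEq.1 hx
  rw [frameDeriv, h1.mfderiv_eq, show mfderiv (𝓡 (2 * m)) 𝓘(ℝ, ℝ) (fun _ : M => (0 : ℝ)) x = 0 from
    mfderiv_const]
  rfl

theorem sum_frameDeriv {s : Finset ℕ} {χ : ℕ → M → ℝ}
    (hχ : ∀ i, ContMDiff (𝓡 (2 * m)) 𝓘(ℝ, ℝ) ∞ (χ i)) (h1 : ∀ x, ∑ i ∈ s, χ i x = 1) (k : ℕ)
    (a : Fin (2 * m)) {x : M} (hx : x ∈ (S.chart k).source) :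
    ∑ i ∈ s, S.frameDeriv k a (χ i) x = 0 := by
  have hy := (S.chart k).map_source hx
  have h2 : ∀ i, S.frameDeriv k a (χ i) x =
      fderiv ℝ (χ i ∘ (S.chart k).symm) (S.chart k x) (S.coordFrame k k a (S.chart k x)) := by
    intro i
    rw [S.fderiv_comp_symm hy ((hχ i).mdifferentiableAt (by simp)), (S.chart k).left_inv hx]
  have h3 : ∀ i ∈ s, DifferentiableAt ℝ (χ i ∘ (S.chart k).symm) (S.chart k x) := fun i _ =>
    S.differentiableAt_comp_symm hy ((hχ i).mdifferentiableAt (by simp))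
  have h4 := fderiv_fun_sum (𝕜 := ℝ) h3
  have h5 : (fun y => ∑ i ∈ s, (χ i ∘ (S.chart k).symm) y) = fun _ => 1 := funext fun y => h1 _
  rw [h5, fderiv_fun_const] at h4
  simp only [h2]
  rw [← _root_.sum_apply, ← h4]
  rfl

theorem exists_partition [T2Space M] [CompactSpace M] : ∃ (s : Finset ℕ) (χ : ℕ → M → ℝ),
    (∀ i, ContMDiff (𝓡 (2 * m)) 𝓘(ℝ, ℝ) ∞ (χ i)) ∧ (∀ i, tsupport (χ i) ⊆ (S.chart i).source) ∧
      ∀ x, ∑ i ∈ s, χ i x = 1 := by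
  obtain ⟨f, hf⟩ := SmoothPartitionOfUnity.exists_isSubordinate (𝓡 (2 * m)) (s := Set.univ)
    isClosed_univ (fun i => (S.chart i).source) (fun i => (S.chart i).open_source)
    fun x _ => Set.mem_iUnion.2 (S.cover x)
  have hfin := f.locallyFinite.finite_nonempty_of_compact
  refine ⟨hfin.toFinset, fun i => f i, fun i => (f i).contMDiff, hf, fun x => ?_⟩
  rw [← f.sum_eq_one (Set.mem_univ x)]
  refine (finsum_eq_sum_of_support_subset _ fun i hi => ?_).symm
  rw [Set.Finite.coe_toFinset]
  exact ⟨x, hi⟩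

variable [MeasurableSpace M]

theorem isMul_zero : S.IsMul (0 : S.Hilb →L[ℂ] S.Hilb) fun _ => 0 := fun ψ => by
  simp only [act_zero]
  exact Lp.coeFn_zero _ _ _

theorem isMul_sum {ι : Type*} (s : Finset ι) {T : ι → S.Hilb →L[ℂ] S.Hilb}
    {Φ : ι → M → SpinorMatrix m} (hT : ∀ k, S.IsMul (T k) (Φ k)) :
    S.IsMul (∑ k ∈ s, T k) fun x => ∑ k ∈ s, Φ k x := by
  classical
  induction s using Finset.induction_on with
  | empty =>
    intro ψ
    simp only [Finset.sum_empty, act_zero]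
    exact Lp.coeFn_zero _ _ _
  | insert k s hk ih =>
    simp only [Finset.sum_insert hk]
    exact (hT k).add ih

variable [BorelSpace M] [CompactSpace M]

/-- The differentials of a partition of unity add up to zero, so localizing and summing leaves no
commutator term. -/
theorem sum_commutator {s : Finset ℕ} {χ : ℕ → M → ℝ}
    (hχ : ∀ i, ContMDiff (𝓡 (2 * m)) 𝓘(ℝ, ℝ) ∞ (χ i)) (h1 : ∀ x, ∑ i ∈ s, χ i x = 1) :
    ∑ i ∈ s, S.commutator (diag (χ i) (hχ i)) = 0 := by
  refine (S.isMul_sum s fun i => isMul_commutator (diag (χ i) (hχ i))).ext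
    (S.isMul_zero.congr fun x => ?_)
  simp only [symbol_diag]
  rw [← Finset.smul_sum, Finset.sum_comm]
  simp only [← Finset.sum_smul, ← Complex.ofReal_sum, S.sum_frameDeriv hχ h1 _ _ (S.mem_source_idx x)]
  simp

theorem sum_pi {s : Finset ℕ} {χ : ℕ → M → ℝ}
    (hχ : ∀ i, ContMDiff (𝓡 (2 * m)) 𝓘(ℝ, ℝ) ∞ (χ i)) (h1 : ∀ x, ∑ i ∈ s, χ i x = 1) :
    ∑ i ∈ s, S.pi (diag (χ i) (hχ i)) = 1 := by
  refine (S.isMul_sum s fun i => isMul_pi (diag (χ i) (hχ i))).ext (isMul_one.congr fun x => ?_)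
  simp only [piMat_diag]
  rw [← Finset.sum_smul, ← Complex.ofReal_sum, h1]
  simp

theorem adjoint_commutator_diag :
    ContinuousLinearMap.adjoint (S.commutator (diag h hh)) = (-1 : ℂ) • S.commutator (diag h hh) := by
  refine (isMul_commutator _).adjoint_eq (((isMul_commutator _).smul (-1 : ℂ)).congr fun x => ?_)
  rw [S.symbol_diag_conjTranspose hh, neg_one_smul]

theorem adjoint_pi_diag : ContinuousLinearMap.adjoint (S.pi (diag h hh)) = S.pi (diag h hh) := by
  refine (isMul_pi _).adjoint_eq ((isMul_pi _).congr fun x => ?_)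
  rw [piMat_diag, Matrix.conjTranspose_smul, DiracMatrices.star_ofReal, Matrix.conjTranspose_one]

end Density

end SpinStructure

end TwistedDirac
end

/-! ### Symmetry of the Dirac operator and density of the smooth spinors. -/

noncomputable section

namespace TwistedDirac

namespace SpinStructure

section Symmetric

variable {m : ℕ} {M : Type*} [TopologicalSpace M] [ChartedSpace (Coord m) M]
  [IsManifold (𝓡 (2 * m)) ∞ M] {Δ : DiracMatrices m} {g : Metric (m := m) M}
  (S : SpinStructure Δ g)

theorem pull_apply {i : ℕ} (ψ : M → Spinor m) {y : Coord m} (hy : y ∈ (S.chart i).target) :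
    S.pull i ψ y = S.rep ψ i ((S.chart i).symm y) := Set.indicator_of_mem hy _

theorem contDiffOn_pull {ψ : M → Spinor m} (hψ : S.IsSmoothSpinor ψ) (i : ℕ) :
    ContDiffOn ℝ ∞ (S.pull i ψ) (S.chart i).target := by
  have h := S.contDiffOn_comp_symm (i := i) (hψ i)
  rw [← coordDomain, S.coordDomain_self] at h
  exact h.congr fun y hy => S.pull_apply ψ hy

theorem rep_diracSection_pull {ψ : M → Spinor m} (hψ : S.IsSmoothSpinor ψ) {i : ℕ} {y : Coord m}
    (hy : y ∈ (S.chart i).target) :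
    S.rep (S.diracSection ψ) i ((S.chart i).symm y) =
      locDirac Δ (S.coordFrame i i) (S.pull i ψ) y := by
  have hx := (S.chart i).map_target hy
  rw [S.rep_diracSection hψ hx, ← S.locDirac_comp_symm ⟨hy, hx⟩ (hψ.mdifferentiableAt hx)]
  have h : (S.rep ψ i ∘ (S.chart i).symm) =ᶠ[nhds y] S.pull i ψ := by
    filter_upwards [(S.chart i).open_target.mem_nhds hy] with z hz
    exact (S.pull_apply ψ hz).symm
  simp only [locDirac, h.fderiv_eq, h.eq_of_nhds]

theorem isSmoothSpinor_add {ψ φ : M → Spinor m} (hψ : S.IsSmoothSpinor ψ)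
    (hφ : S.IsSmoothSpinor φ) : S.IsSmoothSpinor (ψ + φ) := fun i =>
  ((hψ i).add (hφ i)).congr fun x _ => by simp [rep]

theorem isSmoothSpinor_smul (c : ℂ) {ψ : M → Spinor m} (hψ : S.IsSmoothSpinor ψ) :
    S.IsSmoothSpinor (c • ψ) := fun i =>
  ((contDiff_const_smul (𝕜 := ℝ) (n := ∞) c).contMDiff.comp_contMDiffOn (hψ i)).congr fun x _ => by
    simp [rep]

variable [MeasurableSpace M]

/-- The classes of the smooth spinors. -/
def smoothSpinors : Submodule ℂ S.Hilb where
  carrier := {p | ∃ ψ : M → Spinor m, S.IsSmoothSpinor ψ ∧ p =ᵐ[S.vol] ψ}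
  zero_mem' := ⟨0, fun i => (contMDiffOn_const (c := (0 : Spinor m))).congr fun x _ => by
    simp [rep], Lp.coeFn_zero _ _ _⟩
  add_mem' := by
    rintro p q ⟨ψ, hψ, hp⟩ ⟨φ, hφ, hq⟩
    exact ⟨ψ + φ, S.isSmoothSpinor_add hψ hφ, (Lp.coeFn_add p q).trans (hp.add hq)⟩
  smul_mem' := by
    rintro c p ⟨ψ, hψ, hp⟩
    exact ⟨c • ψ, S.isSmoothSpinor_smul c hψ, (Lp.coeFn_smul c p).trans (hp.const_smul c)⟩

variable {S} [BorelSpace M] [CompactSpace M]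

theorem eq_toHilb {ψ : M → Spinor m} (hψ : S.IsSmoothSpinor ψ) {p : S.Hilb} (hp : p =ᵐ[S.vol] ψ) :
    p = toHilb hψ := Lp.ext (hp.trans (coeFn_toHilb hψ).symm)

theorem toHilb_mem {ψ : M → Spinor m} (hψ : S.IsSmoothSpinor ψ) : toHilb hψ ∈ S.smoothSpinors :=
  ⟨ψ, hψ, coeFn_toHilb hψ⟩

theorem inner_toHilb_left {ψ : M → Spinor m} (hψ : S.IsSmoothSpinor ψ) (p : S.Hilb) :
    inner ℂ (toHilb hψ) p = ∫ x, inner ℂ (ψ x) (p x) ∂S.vol := by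
  rw [inner_eq]
  refine integral_congr_ae ?_
  filter_upwards [coeFn_toHilb hψ] with x hx
  rw [hx]

theorem inner_toHilb {ψ φ : M → Spinor m} (hψ : S.IsSmoothSpinor ψ) (hφ : S.IsSmoothSpinor φ) :
    inner ℂ (toHilb hψ) (toHilb hφ) = ∫ x, inner ℂ (ψ x) (φ x) ∂S.vol := by
  rw [inner_toHilb_left]
  refine integral_congr_ae ?_
  filter_upwards [coeFn_toHilb hφ] with x hx
  rw [hx]

theorem IsSmoothSpinor.aestronglyMeasurable {ψ : M → Spinor m} (hψ : S.IsSmoothSpinor ψ) :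
    AEStronglyMeasurable ψ S.vol := (S.memLp_of_continuousOn_rep hψ.continuousOn_rep 2).1

/-- The case of a spinor supported in one chart, where both sides become the coordinate integrals of
`integral_locDirac_symm`. -/
theorem inner_diracSection_of_eq_zero [T2Space M] {ψ φ : M → Spinor m} (hψ : S.IsSmoothSpinor ψ)
    (hφ : S.IsSmoothSpinor φ) {i : ℕ} {K : Set M} (hK : IsClosed K) (hKs : K ⊆ (S.chart i).source)
    (h0 : ∀ x, x ∉ K → ψ x = 0) :
    inner ℂ (toHilb (S.isSmoothSpinor_diracSection hψ)) (toHilb hφ) =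
      inner ℂ (toHilb hψ) (toHilb (S.isSmoothSpinor_diracSection hφ)) := by
  have hD0 : ∀ x, x ∉ (S.chart i).source → S.diracSection ψ x = 0 := fun x hx =>
    S.diracSection_eq_zero (by
      filter_upwards [hK.isOpen_compl.mem_nhds fun h => hx (hKs h)] with z hz
      exact h0 z hz)
  have hDψ := S.isSmoothSpinor_diracSection hψ
  have hDφ := S.isSmoothSpinor_diracSection hφ
  rw [inner_toHilb, inner_toHilb,
    S.integral_inner_chart hDψ.aestronglyMeasurable hφ.aestronglyMeasurable
      fun x hx => by rw [hD0 x hx, inner_zero_left],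
    S.integral_inner_chart hψ.aestronglyMeasurable hDφ.aestronglyMeasurable
      fun x hx => by rw [h0 x fun h => hx (hKs h), inner_zero_left]]
  have hK' : IsCompact (S.chart i '' K) :=
    hK.isCompact.image_of_continuousOn ((S.chart i).continuousOn.mono hKs)
  have hKt : S.chart i '' K ⊆ S.coordDomain i i := by
    rw [S.coordDomain_self]
    rintro _ ⟨x, hx, rfl⟩
    exact (S.chart i).map_source (hKs hx)
  have hψp := S.contDiffOn_pull hψ i
  have hφp := S.contDiffOn_pull hφ i
  rw [← S.coordDomain_self] at hψp hφp
  have key := integral_locDirac_symm (Δ := Δ) (S.isFrameOn_coordFrame i i) hK' hKt hψp hφp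
    fun y hy => S.pull_eq_zero h0 hy
  rw [S.coordDomain_self] at key
  have hm := (S.chart i).open_target.measurableSet
  refine ((setIntegral_congr_fun hm fun y hy => ?_).trans key).trans
    (setIntegral_congr_fun hm fun y hy => ?_)
  · have hy' : y ∈ S.coordDomain i i := by rwa [S.coordDomain_self]
    simp only [S.rep_diracSection_pull hψ hy, S.volumeDensity_eq i hy', S.pull_apply φ hy]
  · have hy' : y ∈ S.coordDomain i i := by rwa [S.coordDomain_self]
    simp only [S.rep_diracSection_pull hφ hy, S.volumeDensity_eq i hy', S.pull_apply ψ hy]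

/-- The Dirac operator is symmetric on smooth spinors. -/
theorem inner_diracSection [T2Space M] {ψ φ : M → Spinor m} (hψ : S.IsSmoothSpinor ψ)
    (hφ : S.IsSmoothSpinor φ) :
    inner ℂ (toHilb (S.isSmoothSpinor_diracSection hψ)) (toHilb hφ) =
      inner ℂ (toHilb hψ) (toHilb (S.isSmoothSpinor_diracSection hφ)) := by
  obtain ⟨s, χ, hχ, hsub, h1⟩ := S.exists_partition
  -- Only `ψ` is localized. The Leibniz rule expands `D (χ_i ψ)`, and the commutators disappear in
  -- the sum.
  have h2 : ∀ i ∈ s, inner ℂ (S.pi (diag (χ i) (hχ i))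
      (toHilb (S.isSmoothSpinor_diracSection hψ)) + S.commutator (diag (χ i) (hχ i)) (toHilb hψ))
        (toHilb hφ) = inner ℂ (S.pi (diag (χ i) (hχ i)) (toHilb hψ))
          (toHilb (S.isSmoothSpinor_diracSection hφ)) := by
    intro i _
    rw [pi_toHilb _ hψ, ← inner_diracSection_of_eq_zero (S.isSmoothSpinor_piMat _ hψ) hφ
      (isClosed_tsupport (χ i)) (hsub i) fun x hx => ?_, dirac_pi_toHilb _ hψ]
    · rfl
    rw [piMat_diag, image_eq_zero_of_notMem_tsupport hx, Complex.ofReal_zero, zero_smul, act_zero]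
  have h3 := Finset.sum_congr rfl h2
  rw [← sum_inner, ← sum_inner, Finset.sum_add_distrib] at h3
  simp only [← _root_.sum_apply] at h3
  rwa [S.sum_pi hχ h1, S.sum_commutator hχ h1, _root_.zero_apply, add_zero] at h3

/-- A square integrable spinor that is orthogonal to all smooth spinors vanishes. -/
theorem eq_zero_of_forall_inner_eq_zero [T2Space M] {p : S.Hilb}
    (h : ∀ q ∈ S.smoothSpinors, inner ℂ q p = 0) : p = 0 := by
  have hp := Lp.memLp p
  have hpi : Integrable p S.vol := by
    have := S.isFiniteMeasure_vol
    exact hp.integrable (by norm_num)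
  have key : ∀ i, ∀ᵐ y ∂(volume : Measure (Coord m)), y ∈ (S.chart i).target →
      S.volumeDensity i y • S.rep p i ((S.chart i).symm y) = 0 := by
    intro i
    have hmt := (S.chart i).open_target.measurableSet
    have hmeas : AEStronglyMeasurable
        (fun y => S.volumeDensity i y • S.rep p i ((S.chart i).symm y))
        ((volume : Measure (Coord m)).restrict (S.chart i).target) :=
      ((S.contDiffOn_volumeDensity i).continuousOn.aestronglyMeasurable hmt).smul
        (S.aestronglyMeasurable_comp_symm (S.aestronglyMeasurable_rep hp.1 i))
    have hint : IntegrableOn (fun y => S.volumeDensity i y • S.rep p i ((S.chart i).symm y))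
        (S.chart i).target volume := by
      refine ⟨hmeas, ?_⟩
      have h1 := S.setLIntegral_vol (i := i) hp.1.enorm.restrict
      rw [hasFiniteIntegral_iff_enorm]
      refine lt_of_eq_of_lt ?_ (lt_of_le_of_lt (setLIntegral_le_lintegral (S.chart i).source _)
        hpi.2)
      rw [h1]
      refine setLIntegral_congr_fun hmt fun y hy => ?_
      simp only [enorm_smul]
      rw [Real.enorm_of_nonneg (S.volumeDensity_pos hy).le, ← ofReal_norm, ← ofReal_norm,
        S.norm_rep p ((S.chart i).map_target hy)]
    -- The fundamental lemma of the calculus of variations in the chart, with test spinors extending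
    -- `u v` for a scalar test function `u` and a constant vector `v`.
    refine (S.chart i).open_target.ae_eq_zero_of_integral_contDiff_smul_eq_zero
      hint.locallyIntegrableOn fun u hu huc hut => ?_
    have huo : ∀ y, y ∉ tsupport u → u y = 0 := fun y => image_eq_zero_of_notMem_tsupport
    have hui : Integrable
        (fun y => u y • S.volumeDensity i y • S.rep p i ((S.chart i).symm y)) volume := by
      obtain ⟨C, hC⟩ := huc.exists_bound_of_continuous hu.continuous
      have h1 : IntegrableOn
          (fun y => u y • S.volumeDensity i y • S.rep p i ((S.chart i).symm y))
          (S.chart i).target volume :=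
        hint.bdd_smul C hu.continuous.aestronglyMeasurable (Filter.Eventually.of_forall hC)
      exact h1.integrable_of_forall_notMem_eq_zero fun y hy => by
        rw [huo y fun h => hy (hut h), zero_smul]
    refine ext_inner_left ℂ fun v => ?_
    rw [inner_zero_right, ← integral_inner hui]
    have h0 : ∀ y, y ∉ tsupport u → u y • v = 0 := fun y hy => by rw [huo y hy, zero_smul]
    have hs := S.isSmoothSpinor_extend (u := fun y => u y • v) (hu.smul contDiff_const) huc hut h0
    have h2 := h _ (toHilb_mem hs)
    rw [inner_toHilb_left, S.integral_inner_chart hs.aestronglyMeasurable hp.1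
      fun x hx => by rw [S.extend_of_notMem _ hx, inner_zero_left]] at h2
    rw [← h2, ← setIntegral_eq_integral_of_forall_compl_eq_zero (s := (S.chart i).target)
      fun y hy => by rw [huo y fun h => hy (hut h), zero_smul, inner_zero_right]]
    refine setIntegral_congr_fun hmt fun y hy => ?_
    simp only [S.rep_extend_self _ ((S.chart i).map_target hy), (S.chart i).right_inv hy,
      ← Complex.coe_smul, inner_smul_left, inner_smul_right, Complex.conj_ofReal, smul_eq_mul]
    ring
  refine Lp.ext (Filter.EventuallyEq.trans (S.ae_of_forall_chart (p := fun x => p x = 0)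
    fun i => ?_) (Lp.coeFn_zero _ _ _).symm)
  have hos := (S.chart i).open_source.measurableSet
  have hmt := (S.chart i).open_target.measurableSet
  have h1 := S.setLIntegral_vol (i := i) hp.1.enorm.restrict
  have h2 : ∫⁻ x in (S.chart i).source, ‖p x‖ₑ ∂S.vol = 0 := by
    rw [h1, ← lintegral_zero (μ := volume.restrict (S.chart i).target)]
    refine lintegral_congr_ae ((ae_restrict_iff' hmt).2 ((key i).mono fun y hy hyt => ?_))
    have h3 := (smul_eq_zero.1 (hy hyt)).resolve_left (S.volumeDensity_pos hyt).ne'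
    have h4 : ‖p ((S.chart i).symm y)‖ = 0 := by
      rw [← S.norm_rep p ((S.chart i).map_target hyt), h3, norm_zero]
    simp only [← ofReal_norm, h4, ENNReal.ofReal_zero, mul_zero]
  rw [lintegral_eq_zero_iff' hp.1.enorm.restrict] at h2
  exact ((ae_restrict_iff' hos).1 h2).mono fun x hx hxs => enorm_eq_zero.1 (hx hxs)

theorem dense_smoothSpinors [T2Space M] : Dense (S.smoothSpinors : Set S.Hilb) :=
  dense_of_orthogonal fun _ h => eq_zero_of_forall_inner_eq_zero h

end Symmetric

end SpinStructure

end TwistedDirac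
end

/-! ### Weak solutions supported in a chart lie in the closed graph. -/

noncomputable section

namespace TwistedDirac

namespace SpinStructure

section Closure

variable {m : ℕ} {M : Type*} [TopologicalSpace M] [ChartedSpace (Coord m) M]
  [IsManifold (𝓡 (2 * m)) ∞ M] {Δ : DiracMatrices m} {g : Metric (m := m) M}
  (S : SpinStructure Δ g) [MeasurableSpace M]

/-- The graph of the Dirac operator on smooth spinors. -/
def smoothGraph : Set (S.Hilb × S.Hilb) :=
  {p | ∃ ψ : M → Spinor m, S.IsSmoothSpinor ψ ∧ p.1 =ᵐ[S.vol] ψ ∧ p.2 =ᵐ[S.vol] S.diracSection ψ}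

/-- The closure of the graph of the Dirac operator on smooth spinors. -/
def diracGraph : Submodule ℂ (S.Hilb × S.Hilb) :=
  (Submodule.span ℂ S.smoothGraph).topologicalClosure

theorem exists_lintegral_density_le {i : ℕ} {K : Set (Coord m)} (hK : IsCompact K)
    (hKt : K ⊆ (S.chart i).target) : ∃ W : ℝ, ∀ f : Coord m → Spinor m, (∀ y, y ∉ K → f y = 0) →
      ∫⁻ y in (S.chart i).target, ENNReal.ofReal (S.volumeDensity i y) * ‖f y‖ₑ ^ 2 ≤
        ENNReal.ofReal W * ∫⁻ y, ‖f y‖ₑ ^ 2 := by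
  obtain ⟨W, hW⟩ := hK.exists_bound_of_continuousOn
    ((S.contDiffOn_volumeDensity i).continuousOn.mono hKt)
  refine ⟨W, fun f hf => ?_⟩
  rw [← lintegral_const_mul' _ _ ENNReal.ofReal_ne_top]
  refine (lintegral_mono fun y => ?_).trans (setLIntegral_le_lintegral _ _)
  by_cases hy : y ∈ K
  · exact mul_le_mul_left (ENNReal.ofReal_le_ofReal ((le_abs_self _).trans (hW y hy))) _
  · simp [hf y hy]

variable {S} [BorelSpace M] [CompactSpace M]

theorem norm_toHilb_le {ψ : M → Spinor m} (hψ : S.IsSmoothSpinor ψ) {B : ℝ≥0∞} (hB : B ≠ ⊤)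
    (h : ∫⁻ x, ‖ψ x‖ₑ ^ 2 ∂S.vol ≤ B) : ‖toHilb hψ‖ ≤ (B ^ (1 / 2 : ℝ)).toReal := by
  rw [toHilb, Lp.norm_toLp]
  refine ENNReal.toReal_mono (ENNReal.rpow_ne_top_of_nonneg (by norm_num) hB) ?_
  rw [eLpNorm_eq_lintegral_rpow_enorm_toReal (by simp) (by simp)]
  simp only [ENNReal.toReal_ofNat, ENNReal.rpow_ofNat]
  gcongr

theorem toHilb_mem_diracGraph {ψ : M → Spinor m} (hψ : S.IsSmoothSpinor ψ) :
    (toHilb hψ, toHilb (S.isSmoothSpinor_diracSection hψ)) ∈ S.diracGraph :=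
  Submodule.le_topologicalClosure _ (Submodule.subset_span ⟨ψ, hψ, coeFn_toHilb hψ,
    coeFn_toHilb (S.isSmoothSpinor_diracSection hψ)⟩)

/-- A weak solution of `D ψ = η` with compact support in a chart belongs to the closure of the
graph of `D` on smooth spinors. -/
theorem mem_diracGraph_of_support [T2Space M] {ψ η : S.Hilb}
    (hw : ∀ φ (hφ : S.IsSmoothSpinor φ),
      inner ℂ (toHilb (S.isSmoothSpinor_diracSection hφ)) ψ = inner ℂ (toHilb hφ) η)
    {ψ' η' : M → Spinor m} (hψ : ψ =ᵐ[S.vol] ψ') (hη : η =ᵐ[S.vol] η') {i : ℕ} {K : Set M}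
    (hK : IsCompact K) (hKs : K ⊆ (S.chart i).source) (hψ0 : ∀ x, x ∉ K → ψ' x = 0)
    (hη0 : ∀ x, x ∉ K → η' x = 0) : (ψ, η) ∈ S.diracGraph := by
  have hmt := (S.chart i).open_target.measurableSet
  have hψm : MemLp ψ' 2 S.vol := (memLp_congr_ae hψ).1 (Lp.memLp ψ)
  have hηm : MemLp η' 2 S.vol := (memLp_congr_ae hη).1 (Lp.memLp η)
  have hK' : IsCompact (S.chart i '' K) :=
    hK.image_of_continuousOn ((S.chart i).continuousOn.mono hKs)
  have hKt : S.chart i '' K ⊆ (S.chart i).target := by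
    rintro _ ⟨x, hx, rfl⟩
    exact (S.chart i).map_source (hKs hx)
  have hu := S.memLp_pull hψm hK hKs hψ0
  have hh := S.memLp_pull hηm hK hKs hη0
  have hu0 : ∀ y, y ∉ S.chart i '' K → S.pull i ψ' y = 0 := fun y hy => S.pull_eq_zero hψ0 hy
  have hh0 : ∀ y, y ∉ S.chart i '' K → S.pull i η' y = 0 := fun y hy => S.pull_eq_zero hη0 hy
  have hE := S.isFrameOn_coordFrame i i
  have hdens : ∀ y ∈ (S.chart i).target, S.volumeDensity i y = frameDensity (S.coordFrame i i) y :=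
    fun y hy => S.volumeDensity_eq i (by rwa [S.coordDomain_self])
  have hinner : ∀ {φ : M → Spinor m} (hφ : S.IsSmoothSpinor φ) {p : S.Hilb} {p' : M → Spinor m},
      p =ᵐ[S.vol] p' → MemLp p' 2 S.vol → (∀ x, x ∉ K → p' x = 0) →
      inner ℂ (toHilb hφ) p = ∫ y in (S.chart i).target, S.volumeDensity i y •
        inner ℂ (S.rep φ i ((S.chart i).symm y)) (S.pull i p' y) := by
    intro φ hφ p p' hp hpm hp0
    rw [inner_toHilb_left]
    have h1 : ∫ x, inner ℂ (φ x) (p x) ∂S.vol = ∫ x, inner ℂ (φ x) (p' x) ∂S.vol :=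
      integral_congr_ae (hp.mono fun x hx => by simp only [hx])
    rw [h1, S.integral_inner_chart hφ.aestronglyMeasurable hpm.1
      fun x hx => by rw [hp0 x fun h => hx (hKs h), inner_zero_right]]
    refine setIntegral_congr_fun hmt fun y hy => ?_
    simp only [S.pull_apply p' hy]
  obtain ⟨L, C, Ψ, hL, hLt, hC, hΨ, hΨ0, hΨC, hDC, hlim⟩ := exists_weak_approximation (Δ := Δ) hE hK'
    (by rwa [S.coordDomain_self]) (integrable_of_memLp_two hu hK' hu0)
    (integrable_of_memLp_two hh hK' hh0) hu hh hu0 (by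
      intro φ hφ L hL hLU hφ0
      rw [S.coordDomain_self] at hLU ⊢
      have hs := S.isSmoothSpinor_extend hφ hL hLU hφ0
      have h1 := hw _ hs
      rw [hinner _ hψ hψm hψ0, hinner _ hη hηm hη0] at h1
      refine ((setIntegral_congr_fun hmt fun y hy => ?_).trans h1).trans
        (setIntegral_congr_fun hmt fun y hy => ?_)
      · simp only [S.rep_diracSection_extend hφ hL hLU hφ0 hy, hdens y hy]
      · simp only [S.rep_extend_self _ ((S.chart i).map_target hy), (S.chart i).right_inv hy,
          hdens y hy])
  rw [S.coordDomain_self] at hLt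
  have hs : ∀ n, S.IsSmoothSpinor (S.extend i (Ψ n)) := fun n =>
    S.isSmoothSpinor_extend (hΨ n) hL hLt (hΨ0 n)
  have hD0 : ∀ n y, y ∉ L → locDirac Δ (S.coordFrame i i) (Ψ n) y = 0 := by
    intro n y hy
    have h1 : Ψ n =ᶠ[nhds y] fun _ => 0 := by
      filter_upwards [hL.isClosed.isOpen_compl.mem_nhds hy] with z hz
      exact hΨ0 n z hz
    simp [locDirac, h1.fderiv_eq, h1.eq_of_nhds]
  obtain ⟨W, hW⟩ := S.exists_lintegral_density_le hL hLt
  have hB : ENNReal.ofReal W * C ≠ ⊤ := ENNReal.mul_ne_top ENNReal.ofReal_ne_top hC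
  have hn1 : ∀ n, ‖toHilb (hs n)‖ ≤ ((ENNReal.ofReal W * C) ^ (1 / 2 : ℝ)).toReal := by
    intro n
    refine norm_toHilb_le _ hB ?_
    rw [S.lintegral_sq_chart (hs n).aestronglyMeasurable fun x hx => S.extend_of_notMem _ hx]
    refine le_trans (le_of_eq (setLIntegral_congr_fun hmt fun y hy => ?_))
      ((hW (Ψ n) (hΨ0 n)).trans (mul_le_mul_right (hΨC n) _))
    simp only [S.rep_extend_self _ ((S.chart i).map_target hy), (S.chart i).right_inv hy]
  have hn2 : ∀ n, ‖toHilb (S.isSmoothSpinor_diracSection (hs n))‖ ≤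
      ((ENNReal.ofReal W * C) ^ (1 / 2 : ℝ)).toReal := by
    intro n
    refine norm_toHilb_le _ hB ?_
    rw [S.lintegral_sq_chart (S.isSmoothSpinor_diracSection (hs n)).aestronglyMeasurable
      fun x hx => S.diracSection_extend_of_notMem hL hLt (hΨ0 n) hx]
    refine le_trans (le_of_eq (setLIntegral_congr_fun hmt fun y hy => ?_))
      ((hW _ (hD0 n)).trans (mul_le_mul_right (hDC n) _))
    simp only [S.rep_diracSection_extend (hΨ n) hL hLt (hΨ0 n) hy]
  -- The local convergence is against continuous functions of compact support. The local expression
  -- of `φ` is multiplied by the density and by a cutoff `θ` equal to `1` on all the supports, which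
  -- does not change the integrals.
  have hconv : ∀ {φ : M → Spinor m} (hφ : S.IsSmoothSpinor φ),
      Filter.Tendsto (fun n => inner ℂ (toHilb hφ) (toHilb (hs n))) Filter.atTop
        (nhds (inner ℂ (toHilb hφ) ψ)) := by
    intro φ hφ
    obtain ⟨N, hN, hLN, hNt⟩ := exists_compact_between (hL.union hK') (S.chart i).open_target
      (Set.union_subset hLt hKt)
    obtain ⟨θ, hθ1, hθ0, -, -⟩ := exists_continuous_one_zero_of_isCompact (hL.union hK')
      isOpen_interior.isClosed_compl (Set.disjoint_compl_right_iff_subset.2 hLN)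
    have hG0 : ∀ y, y ∉ N → θ y • S.volumeDensity i y • S.pull i φ y = 0 := fun y hy => by
      rw [hθ0 fun h => hy (interior_subset h), Pi.zero_apply, zero_smul]
    have hGc : Continuous fun y => θ y • S.volumeDensity i y • S.pull i φ y := by
      refine continuous_of_eq_zero_off (S.chart i).open_target hN.isClosed hNt ?_ hG0
      exact θ.continuous.continuousOn.smul ((S.contDiffOn_volumeDensity i).continuousOn.smul
        (S.contDiffOn_pull hφ i).continuousOn)
    have hG : ∀ v : Coord m → Spinor m, (∀ y, y ∉ L ∪ S.chart i '' K → v y = 0) →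
        ∫ y, inner ℂ (v y) (θ y • S.volumeDensity i y • S.pull i φ y) =
          ∫ y in (S.chart i).target, S.volumeDensity i y • inner ℂ (v y) (S.pull i φ y) := by
      intro v hv
      rw [← setIntegral_eq_integral_of_forall_compl_eq_zero (s := (S.chart i).target) fun y hy => by
        rw [hv y fun h => hy (Set.union_subset hLt hKt h), inner_zero_left]]
      refine setIntegral_congr_fun hmt fun y hy => ?_
      by_cases hyL : y ∈ L ∪ S.chart i '' K
      · simp only [hθ1 hyL, Pi.one_apply, one_smul, ← Complex.coe_smul, inner_smul_right,
          smul_eq_mul]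
      · simp only [hv y hyL, inner_zero_left, smul_zero]
    have h1 := hlim _ hGc (HasCompactSupport.intro hN hG0)
    rw [hG _ fun y hy => hu0 y fun h => hy (Or.inr h)] at h1
    simp only [hG _ fun y hy => hΨ0 _ y fun h => hy (Or.inl h)] at h1
    have h2 := (Complex.continuous_conj.tendsto _).comp h1
    have h3 : ∀ v : Coord m → Spinor m, (starRingEnd ℂ) (∫ y in (S.chart i).target,
        S.volumeDensity i y • inner ℂ (v y) (S.pull i φ y)) = ∫ y in (S.chart i).target,
          S.volumeDensity i y • inner ℂ (S.rep φ i ((S.chart i).symm y)) (v y) := by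
      intro v
      rw [← integral_conj]
      refine setIntegral_congr_fun hmt fun y hy => ?_
      simp only [S.pull_apply φ hy, ← Complex.coe_smul, smul_eq_mul, map_mul, Complex.conj_ofReal,
        inner_conj_symm]
    rw [h3, ← hinner hφ hψ hψm hψ0] at h2
    refine h2.congr fun n => ?_
    rw [Function.comp_apply, h3, inner_toHilb, S.integral_inner_chart hφ.aestronglyMeasurable
      (hs n).aestronglyMeasurable fun x hx => by rw [S.extend_of_notMem _ hx, inner_zero_right]]
    refine setIntegral_congr_fun hmt fun y hy => ?_
    simp only [S.rep_extend_self _ ((S.chart i).map_target hy), (S.chart i).right_inv hy]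
  refine mem_of_weak_limit (Submodule.isClosed_topologicalClosure _) dense_smoothSpinors
    (p := fun n => (toHilb (hs n), toHilb (S.isSmoothSpinor_diracSection (hs n))))
    (fun n => toHilb_mem_diracGraph (hs n)) hn1 hn2 ?_ ?_
  · rintro d ⟨φ, hφ, hd⟩
    rw [eq_toHilb hφ hd]
    exact hconv hφ
  · rintro d ⟨φ, hφ, hd⟩
    -- The images under `D` converge weakly because symmetry moves `D` to the smooth test spinor,
    -- where the weak equation identifies the limit.
    rw [eq_toHilb hφ hd, ← hw φ hφ]
    exact (hconv (S.isSmoothSpinor_diracSection hφ)).congr fun n => inner_diracSection hφ (hs n)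

end Closure

end SpinStructure

end TwistedDirac
end

/-! ### Selfadjointness of the Dirac operator. -/

noncomputable section

namespace TwistedDirac

theorem prod_mem_closure_span {H : Type*} [NormedAddCommGroup H] [NormedSpace ℂ H]
    {s : Set (H × H)} {T U V : H →L[ℂ] H} (h : ∀ p ∈ s, (T p.1, U p.2 + V p.1) ∈ s) {p : H × H}
    (hp : p ∈ (Submodule.span ℂ s).topologicalClosure) :
    (T p.1, U p.2 + V p.1) ∈ (Submodule.span ℂ s).topologicalClosure :=
  map_mem_closure_span ((T.comp (ContinuousLinearMap.fst ℂ H H)).prod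
    (U.comp (ContinuousLinearMap.snd ℂ H H) + V.comp (ContinuousLinearMap.fst ℂ H H))) h hp

namespace SpinStructure

section SelfAdjoint

variable {m : ℕ} {M : Type*} [TopologicalSpace M] [ChartedSpace (Coord m) M]
  [IsManifold (𝓡 (2 * m)) ∞ M] {Δ : DiracMatrices m} {g : Metric (m := m) M}
  {S : SpinStructure Δ g} [MeasurableSpace M] [BorelSpace M] [CompactSpace M]

theorem smoothGraph_eq {p : S.Hilb × S.Hilb} (hp : p ∈ S.smoothGraph) :
    ∃ (ψ : M → Spinor m) (hψ : S.IsSmoothSpinor ψ),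
      p = (toHilb hψ, toHilb (S.isSmoothSpinor_diracSection hψ)) := by
  obtain ⟨ψ, hψ, h1, h2⟩ := hp
  exact ⟨ψ, hψ, Prod.ext (eq_toHilb hψ h1) (eq_toHilb (S.isSmoothSpinor_diracSection hψ) h2)⟩

theorem toHilb_mem_smoothGraph {ψ : M → Spinor m} (hψ : S.IsSmoothSpinor ψ) :
    (toHilb hψ, toHilb (S.isSmoothSpinor_diracSection hψ)) ∈ S.smoothGraph :=
  ⟨ψ, hψ, coeFn_toHilb hψ, coeFn_toHilb (S.isSmoothSpinor_diracSection hψ)⟩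

/-- The formal Leibniz rule on the closure of the graph of `D` on smooth spinors. -/
theorem pi_mem_diracGraph (a : Alg m M) {ψ η : S.Hilb} (h : (ψ, η) ∈ S.diracGraph) :
    (S.pi a ψ, S.pi (rho a) η + S.commutator a ψ) ∈ S.diracGraph := by
  refine prod_mem_closure_span (fun p hp => ?_) h
  obtain ⟨φ, hφ, rfl⟩ := smoothGraph_eq hp
  have h2 := toHilb_mem_smoothGraph (S.isSmoothSpinor_piMat a hφ)
  rw [dirac_pi_toHilb a hφ, ← pi_toHilb a hφ] at h2
  exact h2

variable [T2Space M]

theorem inner_symm_of_mem {p q : S.Hilb × S.Hilb} (hp : p ∈ S.diracGraph) (hq : q ∈ S.diracGraph) :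
    inner ℂ p.2 q.1 = inner ℂ p.1 q.2 := by
  refine symm_of_mem_closure_span (fun p hp q hq => ?_) hp hq
  obtain ⟨φ, hφ, rfl⟩ := smoothGraph_eq hp
  obtain ⟨ψ, hψ, rfl⟩ := smoothGraph_eq hq
  exact inner_diracSection hφ hψ

/-- Weak solutions of `D ψ = η` belong to the closure of the graph of `D` on smooth spinors. -/
theorem mem_diracGraph_of_weak {ψ η : S.Hilb} (hw : ∀ φ (hφ : S.IsSmoothSpinor φ),
      inner ℂ (toHilb (S.isSmoothSpinor_diracSection hφ)) ψ = inner ℂ (toHilb hφ) η) :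
    (ψ, η) ∈ S.diracGraph := by
  obtain ⟨s, χ, hχ, hsub, h1⟩ := S.exists_partition
  have key : ∀ i ∈ s, (S.pi (diag (χ i) (hχ i)) ψ,
      S.pi (diag (χ i) (hχ i)) η + S.commutator (diag (χ i) (hχ i)) ψ) ∈ S.diracGraph := by
    intro i _
    -- `χ_i ψ` solves weakly the equation with right-hand side `χ_i η + [D, χ_i] ψ`, because `χ_i`
    -- is selfadjoint and its commutator with `D` is skew. Both spinors are supported where `χ_i`
    -- is.
    refine mem_diracGraph_of_support (fun φ hφ => ?_)
      (ψ' := fun x => act (piMat Δ (diag (χ i) (hχ i)) x) (ψ x))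
      (η' := fun x => act (piMat Δ (diag (χ i) (hχ i)) x) (η x) +
        act (S.symbol (S.idx x) (diag (χ i) (hχ i)).1 (diag (χ i) (hχ i)).2 x) (ψ x))
      (isMul_pi _ ψ) ?_ (isClosed_tsupport (χ i)).isCompact (hsub i) (fun x hx => ?_) fun x hx => ?_
    · have h2 := hw _ (S.isSmoothSpinor_piMat (diag (χ i) (hχ i)) hφ)
      rw [dirac_pi_toHilb _ hφ, ← pi_toHilb _ hφ, inner_add_left] at h2
      have h3 : ∀ p q : S.Hilb, inner ℂ (S.pi (diag (χ i) (hχ i)) p) q =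
          inner ℂ p (S.pi (diag (χ i) (hχ i)) q) := fun p q => by
        rw [← ContinuousLinearMap.adjoint_inner_right, S.adjoint_pi_diag]
      have h4 : ∀ p q : S.Hilb, inner ℂ (S.commutator (diag (χ i) (hχ i)) p) q =
          -inner ℂ p (S.commutator (diag (χ i) (hχ i)) q) := fun p q => by
        rw [← ContinuousLinearMap.adjoint_inner_right, S.adjoint_commutator_diag,
          _root_.smul_apply, inner_smul_right, neg_one_mul]
      rw [h3, h4, ← sub_eq_add_neg] at h2
      rw [inner_add_right, ← sub_eq_iff_eq_add, ← h2]
      exact congrArg (· - _) (h3 _ _).symm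
    · filter_upwards [isMul_pi (diag (χ i) (hχ i)) η, isMul_commutator (diag (χ i) (hχ i)) ψ,
        Lp.coeFn_add (S.pi (diag (χ i) (hχ i)) η) (S.commutator (diag (χ i) (hχ i)) ψ)] with x e1 e2 e3
      rw [e3, Pi.add_apply, e1, e2]
    · rw [piMat_diag, image_eq_zero_of_notMem_tsupport hx, Complex.ofReal_zero, zero_smul, act_zero]
    · simp only [piMat_diag, image_eq_zero_of_notMem_tsupport hx, Complex.ofReal_zero, zero_smul,
        act_zero, symbol_diag, S.frameDeriv_eq_zero_of_notMem hx, Finset.sum_const_zero, smul_zero, add_zero]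
  have h2 := Submodule.sum_mem _ key
  have h3 : ∑ i ∈ s, (S.pi (diag (χ i) (hχ i)) ψ,
      S.pi (diag (χ i) (hχ i)) η + S.commutator (diag (χ i) (hχ i)) ψ) = (ψ, η) := by
    refine Prod.ext ?_ ?_
    · rw [Prod.fst_sum, ← _root_.sum_apply, S.sum_pi hχ h1]
      rfl
    · rw [Prod.snd_sum, Finset.sum_add_distrib, ← _root_.sum_apply, ← _root_.sum_apply,
        S.sum_pi hχ h1, S.sum_commutator hχ h1, _root_.zero_apply, add_zero]
      rfl
  rwa [h3] at h2

/-- The construction of an operator from a subspace is faithful only if the subspace is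
single-valued. If `(0, η)` lies in the closure, symmetry makes `η` orthogonal to all smooth spinors,
which are dense. -/
theorem graph_dirac : S.dirac.graph = S.diracGraph := by
  refine Submodule.toLinearPMap_graph_eq _ fun p hp h0 => ?_
  refine eq_zero_of_dense dense_smoothSpinors fun d hd => ?_
  obtain ⟨φ, hφ, hd⟩ := hd
  rw [eq_toHilb hφ hd]
  have := inner_symm_of_mem (toHilb_mem_diracGraph hφ) hp
  rw [← this, h0, inner_zero_right]

theorem dirac_mem_diracGraph (ψ : S.dirac.domain) : ((ψ : S.Hilb), S.dirac ψ) ∈ S.diracGraph := by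
  rw [← graph_dirac]
  exact LinearPMap.mem_graph _ ψ

theorem exists_dirac_eq {ψ η : S.Hilb} (h : (ψ, η) ∈ S.diracGraph) :
    ∃ hψ : ψ ∈ S.dirac.domain, S.dirac ⟨ψ, hψ⟩ = η := by
  rw [← graph_dirac] at h
  obtain ⟨y, h1, h2⟩ := (LinearPMap.mem_graph_iff _).1 h
  obtain rfl : (y : S.Hilb) = ψ := h1
  exact ⟨y.2, h2⟩

theorem isTwistedCommutator_commutator (a : Alg m M) :
    S.IsTwistedCommutator a (S.commutator a) := fun ψ => by
  obtain ⟨h, h1⟩ := exists_dirac_eq (pi_mem_diracGraph a (dirac_mem_diracGraph ψ))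
  exact ⟨h, by rw [h1, add_sub_cancel_left]⟩

theorem dense_domain_dirac : Dense (S.dirac.domain : Set S.Hilb) :=
  dense_smoothSpinors.mono fun p hp => by
    obtain ⟨ψ, hψ, hp⟩ := hp
    rw [eq_toHilb hψ hp]
    exact (exists_dirac_eq (toHilb_mem_diracGraph hψ)).1

/-- Bounded selfadjoint perturbations of the Dirac operator are selfadjoint. -/
theorem isSelfAdjoint_vadd_dirac {B : S.Hilb →L[ℂ] S.Hilb}
    (hB : ContinuousLinearMap.adjoint B = B) :
    IsSelfAdjoint ((B : S.Hilb →ₗ[ℂ] S.Hilb) +ᵥ S.dirac) := by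
  refine isSelfAdjoint_vadd dense_domain_dirac
    (fun x y => inner_symm_of_mem (dirac_mem_diracGraph x) (dirac_mem_diracGraph y))
    (fun ψ η h => (exists_dirac_eq (η := η) (mem_diracGraph_of_weak fun φ hφ => ?_)).1) hB
  obtain ⟨h1, h2⟩ := exists_dirac_eq (toHilb_mem_diracGraph hφ)
  rw [← h2]
  exact h ⟨_, h1⟩

end SelfAdjoint

end SpinStructure

end TwistedDirac
end

/-! ### A nonzero multiple of the Dirac operator is unbounded. -/

noncomputable section

namespace TwistedDirac

/-- A coordinate function times a bump function that equals `1` near `x`. Positive dimension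
provides the coordinate. -/
theorem exists_mfderiv_ne_zero {m : ℕ} [NeZero m] {M : Type*} [TopologicalSpace M] [T2Space M]
    [ChartedSpace (Coord m) M] [IsManifold (𝓡 (2 * m)) ∞ M] (x : M) :
    ∃ h : M → ℝ, ContMDiff (𝓡 (2 * m)) 𝓘(ℝ, ℝ) ∞ h ∧
      ∀ᶠ z in nhds x, mfderiv (𝓡 (2 * m)) 𝓘(ℝ, ℝ) h z ≠ 0 := by
  obtain ⟨f⟩ : Nonempty (SmoothBumpFunction (𝓡 (2 * m)) x) := inferInstance
  let p : Coord m →L[ℝ] ℝ := EuclideanSpace.proj 0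
  have hg : ContMDiffOn (𝓡 (2 * m)) 𝓘(ℝ, ℝ) ∞ (p ∘ chartAt (Coord m) x)
      (chartAt (Coord m) x).source := by
    have h1 : ContMDiffOn (𝓡 (2 * m)) 𝓘(ℝ, Coord m) ∞ (chartAt (Coord m) x)
      (chartAt (Coord m) x).source := contMDiffOn_chart
    exact p.contDiff.contMDiff.comp_contMDiffOn h1
  refine ⟨_, f.contMDiff_smul hg, ?_⟩
  filter_upwards [f.eventuallyEq_one.eventually_nhds,
    (chartAt (Coord m) x).open_source.mem_nhds (mem_chart_source _ x)] with z hz hzs h0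
  have hd : (chartAt (Coord m) x).MDifferentiable (𝓡 (2 * m)) (𝓡 (2 * m)) :=
    mdifferentiable_chart x
  have h1 : (fun z => f z • (p ∘ chartAt (Coord m) x) z) =ᶠ[nhds z] p ∘ chartAt (Coord m) x := by
    filter_upwards [hz] with w hw
    rw [hw, Pi.one_apply, one_smul]
  have h2 := mfderiv_comp (I'' := 𝓘(ℝ, ℝ)) z (p.differentiableAt.mdifferentiableAt)
    (hd.mdifferentiableAt hzs)
  rw [h1.mfderiv_eq, h2] at h0
  obtain ⟨v, hv⟩ := hd.mfderiv_surjective hzs (EuclideanSpace.single (0 : Fin (2 * m)) (1 : ℝ))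
  have h3 := congrArg (fun L => L v) h0
  rw [mfderiv_eq_fderiv, p.fderiv] at h3
  have h4 : p (mfderiv (𝓡 (2 * m)) (𝓡 (2 * m)) (chartAt (Coord m) x) z v) = 0 := h3
  have h5 : p (EuclideanSpace.single (0 : Fin (2 * m)) (1 : ℝ)) = 0 := (congrArg p hv).symm.trans h4
  simp [p] at h5

namespace SpinStructure

section Obstruction

variable {m : ℕ} {M : Type*} [TopologicalSpace M] [ChartedSpace (Coord m) M]
  [IsManifold (𝓡 (2 * m)) ∞ M] {Δ : DiracMatrices m} {g : Metric (m := m) M}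
  {S : SpinStructure Δ g}

theorem sum_frameDeriv_sq_ne_zero {h : M → ℝ} {i : ℕ} {x : M} (hx : x ∈ (S.chart i).source)
    (hd : mfderiv (𝓡 (2 * m)) 𝓘(ℝ, ℝ) h x ≠ 0) : ∑ a, S.frameDeriv i a h x ^ 2 ≠ 0 := by
  contrapose! hd
  have h0 : ∀ a, S.frameDeriv i a h x = 0 := fun a => by
    have := (Finset.sum_eq_zero_iff_of_nonneg fun a _ => sq_nonneg (S.frameDeriv i a h x)).1 hd a
      (Finset.mem_univ a)
    exact pow_eq_zero_iff two_ne_zero |>.1 this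
  ext v
  rw [← S.sum_inner_frame_smul hx v, map_sum]
  refine Finset.sum_eq_zero fun a _ => ?_
  rw [map_smul]
  exact (congrArg _ (h0 a)).trans (smul_zero (M := ℝ) (A := ℝ) _)

/-- The function `exp(i t h)`. -/
def _root_.TwistedDirac.phase (t : ℝ) (h : M → ℝ) (hh : ContMDiff (𝓡 (2 * m)) 𝓘(ℝ, ℝ) ∞ h) :
    smoothFunctions m M :=
  ⟨fun x => Complex.exp ((t * h x : ℝ) * Complex.I), by
    have h1 : ContDiff ℝ ∞ fun s : ℝ => Complex.exp ((t * s : ℝ) * Complex.I) :=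
      ((Complex.ofRealCLM.contDiff.comp (contDiff_const.mul contDiff_id)).mul contDiff_const).cexp
    exact h1.contMDiff.comp hh⟩

variable {h : M → ℝ} (hh : ContMDiff (𝓡 (2 * m)) 𝓘(ℝ, ℝ) ∞ h)

theorem frameDeriv_phase (t : ℝ) (i : ℕ) (a : Fin (2 * m)) (x : M) :
    S.frameDeriv i a (phase t h hh : M → ℂ) x =
      (phase t h hh : M → ℂ) x * (t * Complex.I) * ((S.frameDeriv i a h x : ℝ) : ℂ) := by
  have h1 : HasDerivAt (fun s : ℝ => Complex.exp ((t * s : ℝ) * Complex.I))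
      (Complex.exp ((t * h x : ℝ) * Complex.I) * (t * Complex.I)) (h x) := by
    have h2 : HasDerivAt (fun s : ℝ => ((t * s : ℝ) : ℂ)) (t : ℂ) (h x) := by
      simpa using ((hasDerivAt_id (h x)).const_mul t).ofReal_comp
    exact (h2.mul_const Complex.I).cexp
  have h3 := S.frameDeriv_comp (h := h) (x := x) h1.differentiableAt
    (hh.mdifferentiableAt (by simp)) i a
  refine h3.trans ?_
  rw [h1.hasFDerivAt.fderiv, ContinuousLinearMap.toSpanSingleton_apply, Complex.real_smul, mul_comm]
  rfl

/-- The element `(exp(i t h), exp(i t h))` of the algebra. -/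
def _root_.TwistedDirac.phasePair (t : ℝ) (h : M → ℝ) (hh : ContMDiff (𝓡 (2 * m)) 𝓘(ℝ, ℝ) ∞ h) :
    Alg m M := (phase t h hh, phase t h hh)

theorem symbol_phasePair (t : ℝ) (i : ℕ) (x : M) :
    S.symbol i (phasePair t h hh).1 (phasePair t h hh).2 x =
      ((phase t h hh : M → ℂ) x * (t * Complex.I)) • S.symbol i (diag h hh).1 (diag h hh).2 x := by
  rw [symbol_diag]
  simp only [symbol, phasePair, frameDeriv_phase, Δ.chiral_self, Matrix.mul_smul, mul_one]
  simp only [← smul_smul, ← Finset.smul_sum]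
  module

theorem piMat_phasePair (t : ℝ) (x : M) :
    piMat Δ (phasePair t h hh) x = (phase t h hh : M → ℂ) x • 1 := Δ.chiral_self _

theorem symbol_diag_sq (i : ℕ) (x : M) :
    S.symbol i (diag h hh).1 (diag h hh).2 x * S.symbol i (diag h hh).1 (diag h hh).2 x =
      (-((∑ a, S.frameDeriv i a h x ^ 2 : ℝ) : ℂ)) • 1 := by
  rw [symbol_diag, smul_mul_smul_comm, Δ.sum_smul_gamma_sq, smul_smul]
  simp

variable [MeasurableSpace M] [BorelSpace M] [CompactSpace M]

theorem norm_pi_phasePair (t : ℝ) (ψ : S.Hilb) : ‖S.pi (phasePair t h hh) ψ‖ = ‖ψ‖ := by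
  refine le_antisymm ?_ ?_ <;> refine Lp.norm_le_norm_of_ae_le ?_ <;>
  · filter_upwards [isMul_pi (phasePair t h hh) ψ] with x hx
    rw [hx, piMat_phasePair, act_smul, act_one, norm_smul]
    simp only [phase, Complex.norm_exp_ofReal_mul_I, one_mul, le_refl]

theorem commutator_phasePair (t : ℝ) : S.commutator (phasePair t h hh) =
    ((t : ℂ) * Complex.I) • (S.pi (phasePair t h hh) ∘L S.commutator (diag h hh)) := by
  refine (isMul_commutator _).ext ((((isMul_pi _).comp (isMul_commutator _)).smul _).congr
    fun x => ?_)
  rw [piMat_phasePair, symbol_phasePair, smul_mul_assoc, one_mul, smul_smul, mul_comm]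

theorem pi_phasePair_comm (t : ℝ) (c : Alg m M) : S.pi c ∘L S.pi (phasePair t h hh) =
    S.pi (phasePair t h hh) ∘L S.pi c := by
  refine ((isMul_pi _).comp (isMul_pi _)).ext (((isMul_pi _).comp (isMul_pi _)).congr fun x => ?_)
  rw [piMat_phasePair, Matrix.mul_smul, Matrix.smul_mul, mul_one, one_mul]

/-- A multiplication operator that vanishes has a symbol that vanishes almost everywhere. -/
theorem IsMul.ae_eq_zero {Φ : M → SpinorMatrix m} (hΦ : S.IsMul 0 Φ) :
    ∀ᵐ x ∂S.vol, Φ x = 0 := by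
  have := S.isFiniteMeasure_vol
  have h1 : ∀ k : Fin (2 ^ m), ∀ᵐ x ∂S.vol, act (Φ x) (EuclideanSpace.single k (1 : ℂ)) = 0 := by
    intro k
    have hm : MemLp (fun _ : M => EuclideanSpace.single k (1 : ℂ)) 2 S.vol := memLp_const _
    filter_upwards [hΦ hm.toLp, hm.coeFn_toLp, Lp.coeFn_zero (Spinor m) 2 S.vol] with x h1 h2 h3
    rw [← h2, ← h1, _root_.zero_apply, h3, Pi.zero_apply]
  filter_upwards [ae_all_iff.2 h1] with x hx
  ext k l
  have := congrArg (fun v : Spinor m => v k) (hx l)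
  simpa [act] using this

variable [T2Space M]

/-- For `U = π(exp(i t h))` the Leibniz rule gives `i t U π(c) [D, h]_ρ = Y U - U Y`. The right side
is bounded uniformly in `t` because `U` is isometric, and the left side grows linearly. -/
theorem pi_comp_commutator_eq_zero {c : Alg m M} {Y : S.Hilb →L[ℂ] S.Hilb}
    (hY : ∀ ψ : S.dirac.domain, S.pi c (S.dirac ψ) = Y ψ) :
    S.pi c ∘L S.commutator (diag h hh) = 0 := by
  have h1 : ∀ t : ℝ, ((t : ℂ) * Complex.I) •
      (S.pi (phasePair t h hh) ∘L S.pi c ∘L S.commutator (diag h hh)) =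
        Y ∘L S.pi (phasePair t h hh) - S.pi (phasePair t h hh) ∘L Y := by
    intro t
    refine DFunLike.coe_injective (Continuous.ext_on dense_domain_dirac
      (ContinuousLinearMap.continuous _) (ContinuousLinearMap.continuous _) fun φ hφ => ?_)
    have hcomm : ∀ ψ : S.Hilb, S.pi c (S.pi (phasePair t h hh) ψ) =
        S.pi (phasePair t h hh) (S.pi c ψ) := fun ψ =>
      congrArg (fun T => T ψ) (pi_phasePair_comm hh t c)
    obtain ⟨h2, h3⟩ := isTwistedCommutator_commutator (phasePair t h hh) ⟨φ, hφ⟩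
    have h4 := hY ⟨_, h2⟩
    have h5 : S.pi c (S.pi (rho (phasePair t h hh)) (S.dirac ⟨φ, hφ⟩)) =
        S.pi (phasePair t h hh) (Y φ) := (hcomm _).trans (congrArg _ (hY ⟨φ, hφ⟩))
    have h6 : S.pi c (((t : ℂ) * Complex.I) • S.pi (phasePair t h hh) (S.commutator (diag h hh) φ)) +
        S.pi (phasePair t h hh) (Y φ) = Y (S.pi (phasePair t h hh) φ) := by
      rw [← h5, ← map_add, ← h4, sub_eq_iff_eq_add.1 h3.symm, commutator_phasePair]
      rfl
    rw [map_smul, hcomm] at h6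
    exact eq_sub_of_add_eq h6
  refine ContinuousLinearMap.ext fun ψ => ?_
  by_contra hne
  have hpos := norm_pos_iff.2 hne
  have h2 : ∀ t : ℝ, |t| * ‖(S.pi c ∘L S.commutator (diag h hh)) ψ‖ ≤ 2 * (‖Y‖ * ‖ψ‖) := by
    intro t
    have h3 := congrArg (fun T => ‖T ψ‖) (h1 t)
    simp only [_root_.smul_apply, _root_.sub_apply, ContinuousLinearMap.comp_apply, norm_smul,
      norm_pi_phasePair, norm_mul, Complex.norm_real, Complex.norm_I, mul_one, Real.norm_eq_abs] at h3
    rw [ContinuousLinearMap.comp_apply, h3, two_mul]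
    refine (norm_sub_le _ _).trans (add_le_add ?_ ?_)
    · exact (Y.le_opNorm _).trans_eq (by rw [norm_pi_phasePair])
    · exact (norm_pi_phasePair hh t _).trans_le (Y.le_opNorm ψ)
  -- This `t` makes the left side exceed the bound by exactly one.
  have h3 := h2 ((2 * (‖Y‖ * ‖ψ‖) + 1) / ‖(S.pi c ∘L S.commutator (diag h hh)) ψ‖)
  rw [abs_of_nonneg (by positivity)] at h3
  rw [div_mul_cancel₀ _ hpos.ne'] at h3
  linarith

/-- Composing `π(c) [D, h]_ρ = 0` with the commutator once more gives `|dh|² π(c) = 0`. Near each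
point some `h` has a nonzero differential, so `c` vanishes almost everywhere there, and everywhere
by continuity since the volume charges open sets. -/
theorem eq_zero_of_pi_dirac_bounded [NeZero m] (hm : Even m) {c : Alg m M}
    {Y : S.Hilb →L[ℂ] S.Hilb} (hY : ∀ ψ : S.dirac.domain, S.pi c (S.dirac ψ) = Y ψ) : c = 0 := by
  have key : ∀ x, (c.1 : M → ℂ) x = 0 ∧ (c.2 : M → ℂ) x = 0 := by
    intro x
    obtain ⟨h, hh, hx⟩ := exists_mfderiv_ne_zero (m := m) x
    have h1 : S.IsMul (0 : S.Hilb →L[ℂ] S.Hilb) fun x =>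
        (-((∑ a, S.frameDeriv (S.idx x) a h x ^ 2 : ℝ) : ℂ)) • piMat Δ c x := by
      have h2 := ((isMul_pi c).comp (isMul_commutator (S := S) (diag h hh))).comp
        (isMul_commutator (S := S) (diag h hh))
      rw [pi_comp_commutator_eq_zero hh hY, ContinuousLinearMap.zero_comp] at h2
      refine h2.congr fun x => ?_
      rw [mul_assoc, symbol_diag_sq, Matrix.mul_smul, mul_one]
    have h2 : ∀ᵐ z ∂S.vol, mfderiv (𝓡 (2 * m)) 𝓘(ℝ, ℝ) h z ≠ 0 →
        (c.1 : M → ℂ) z = 0 ∧ (c.2 : M → ℂ) z = 0 := by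
      filter_upwards [h1.ae_eq_zero] with z hz hd
      refine Δ.chiral_eq_zero hm ((smul_eq_zero.1 hz).resolve_left ?_)
      rw [neg_eq_zero, Complex.ofReal_eq_zero]
      exact sum_frameDeriv_sq_ne_zero (S.mem_source_idx z) hd
    have h3 : Continuous (c.1 : M → ℂ) := ContMDiff.continuous c.1.2
    have h4 : Continuous (c.2 : M → ℂ) := ContMDiff.continuous c.2.2
    obtain ⟨N, hN, hNo, hxN⟩ := eventually_nhds_iff.1 hx
    by_contra hne
    have := S.isOpenPosMeasure_vol
    have ho : IsOpen (N ∩ {z | (c.1 : M → ℂ) z = 0 ∧ (c.2 : M → ℂ) z = 0}ᶜ) :=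
      hNo.inter ((isClosed_eq h3 continuous_const).inter
        (isClosed_eq h4 continuous_const)).isOpen_compl
    refine ho.measure_ne_zero S.vol ⟨x, hxN, hne⟩ ?_
    refine measure_mono_null ?_ h2
    rintro z ⟨hz1, hz2⟩ hz3
    exact hz2 (hz3 (hN z hz1))
  exact Prod.ext (Subtype.ext (funext fun x => (key x).1)) (Subtype.ext (funext fun x => (key x).2))

end Obstruction

end SpinStructure

end TwistedDirac
end

/-! ### Unitaries of the algebra, and operators `π(l) D π(r)` as fluctuations. -/

noncomputable section

namespace TwistedDirac

section Algebra

variable {m : ℕ} {M : Type*} [TopologicalSpace M] [ChartedSpace (Coord m) M]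

theorem mul_star_apply (f : smoothFunctions m M) (x : M) :
    ((f * star f : smoothFunctions m M) : M → ℂ) x = ((‖(f : M → ℂ) x‖ ^ 2 : ℝ) : ℂ) := by
  change (f : M → ℂ) x * (starRingEnd ℂ) ((f : M → ℂ) x) = _
  rw [Complex.mul_conj, Complex.normSq_eq_norm_sq]

theorem mem_unitaries_iff {a : Alg m M} : a ∈ unitaries m M ↔ a * star a = 1 := by
  rw [unitaries, Set.mem_ofPred_eq, mul_comm (star a), and_self]

theorem mem_twistedUnitaries_iff {a : Alg m M} : a ∈ twistedUnitaries m M ↔ a * plus a = 1 := by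
  rw [twistedUnitaries, Set.mem_ofPred_eq, mul_comm (plus a), and_self]

theorem smoothFunctions_ext {f h : smoothFunctions m M} (hfh : ∀ x, (f : M → ℂ) x = (h : M → ℂ) x) :
    f = h := Subtype.ext (funext hfh)

/-- `|f|²` is a nonnegative function of square one. -/
theorem mul_star_eq_one_of_sq {f : smoothFunctions m M} (h : f * star f * (f * star f) = 1) :
    f * star f = 1 := by
  refine smoothFunctions_ext fun x => ?_
  have h1 : ((f * star f : smoothFunctions m M) : M → ℂ) x *
      ((f * star f : smoothFunctions m M) : M → ℂ) x = 1 :=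
    congrArg (fun F : smoothFunctions m M => (F : M → ℂ) x) h
  rw [mul_star_apply] at h1 ⊢
  have h2 : (‖(f : M → ℂ) x‖ ^ 2) * ‖(f : M → ℂ) x‖ ^ 2 = 1 := by exact_mod_cast h1
  have h3 : ‖(f : M → ℂ) x‖ ^ 2 = 1 := by
    nlinarith [sq_nonneg ‖(f : M → ℂ) x‖]
  rw [h3, Complex.ofReal_one]
  rfl

/-- The absolute value of a function without zeros. -/
def absFunction [IsManifold (𝓡 (2 * m)) ∞ M] (f : smoothFunctions m M)
    (hf : ∀ x, (f : M → ℂ) x ≠ 0) : smoothFunctions m M :=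
  ⟨fun x => (‖(f : M → ℂ) x‖ : ℂ), fun x => by
    have h1 : ContDiffAt ℝ ∞ (fun z : ℂ => (‖z‖ : ℂ)) ((f : M → ℂ) x) :=
      Complex.ofRealCLM.contDiff.contDiffAt.comp _ (contDiffAt_norm ℝ (hf x))
    exact h1.contMDiffAt.comp x (f.2 x)⟩

/-- The right side says `|f| |g| = 1`. Then neither function has zeros, the absolute values are
smooth, and `(|f|, |g|)` is twisted unitary with unitary cofactor `(f |g|, g |f|)`. Conversely `u`
drops out of `a a*`, and the twisted unitarity of `v` remains. -/
theorem exists_unitary_mul_twistedUnitary_iff [IsManifold (𝓡 (2 * m)) ∞ M] {a : Alg m M} :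
    (∃ u ∈ unitaries m M, ∃ v ∈ twistedUnitaries m M, a = u * v) ↔
      a * star a * rho (a * star a) = 1 := by
  constructor
  · rintro ⟨u, hu, v, hv, rfl⟩
    rw [mem_unitaries_iff] at hu
    rw [mem_twistedUnitaries_iff] at hv
    have h1 : u * v * star (u * v) = v * star v := by
      rw [star_mul', mul_mul_mul_comm, hu, one_mul]
    have h2 : v * star v * rho (v * star v) = v * plus v * star (v * plus v) := by
      rw [star_mul', plus, star_star]
      change v * star v * (rho v * star (rho v)) = _
      ring
    rw [h1, h2, hv, star_one, mul_one]
  · intro h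
    have h1 : ∀ x, ‖(a.1 : M → ℂ) x‖ * ‖(a.2 : M → ℂ) x‖ = 1 := by
      intro x
      have h2 : ((a.1 * star a.1 : smoothFunctions m M) : M → ℂ) x *
          ((a.2 * star a.2 : smoothFunctions m M) : M → ℂ) x = 1 :=
        congrArg (fun F : Alg m M => (F.1 : M → ℂ) x) h
      rw [mul_star_apply, mul_star_apply] at h2
      have h3 : ‖(a.1 : M → ℂ) x‖ ^ 2 * ‖(a.2 : M → ℂ) x‖ ^ 2 = 1 := by exact_mod_cast h2
      rw [← mul_pow] at h3
      exact (pow_eq_one_iff_of_nonneg (by positivity) two_ne_zero).1 h3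
    have hf : ∀ x, (a.1 : M → ℂ) x ≠ 0 := fun x h0 => by simpa [h0] using h1 x
    have hg : ∀ x, (a.2 : M → ℂ) x ≠ 0 := fun x h0 => by simpa [h0] using h1 x
    have h2 : ∀ x, (‖(a.1 : M → ℂ) x‖ : ℂ) * (‖(a.2 : M → ℂ) x‖ : ℂ) = 1 := fun x => by
      exact_mod_cast h1 x
    refine ⟨(a.1 * absFunction a.2 hg, a.2 * absFunction a.1 hf), mem_unitaries_iff.2 ?_,
      (absFunction a.1 hf, absFunction a.2 hg), mem_twistedUnitaries_iff.2 ?_, ?_⟩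
    · refine Prod.ext (smoothFunctions_ext fun x => ?_) (smoothFunctions_ext fun x => ?_)
      · refine (mul_star_apply (a.1 * absFunction a.2 hg) x).trans ?_
        change ((‖(a.1 : M → ℂ) x * (‖(a.2 : M → ℂ) x‖ : ℂ)‖ ^ 2 : ℝ) : ℂ) = 1
        rw [norm_mul, Complex.norm_real, norm_norm, h1, one_pow, Complex.ofReal_one]
      · refine (mul_star_apply (a.2 * absFunction a.1 hf) x).trans ?_
        change ((‖(a.2 : M → ℂ) x * (‖(a.1 : M → ℂ) x‖ : ℂ)‖ ^ 2 : ℝ) : ℂ) = 1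
        rw [norm_mul, Complex.norm_real, norm_norm, mul_comm, h1, one_pow, Complex.ofReal_one]
    · refine Prod.ext (smoothFunctions_ext fun x => ?_) (smoothFunctions_ext fun x => ?_)
      · change (‖(a.1 : M → ℂ) x‖ : ℂ) * (starRingEnd ℂ) (‖(a.2 : M → ℂ) x‖ : ℂ) = 1
        rw [Complex.conj_ofReal, h2]
      · change (‖(a.2 : M → ℂ) x‖ : ℂ) * (starRingEnd ℂ) (‖(a.1 : M → ℂ) x‖ : ℂ) = 1
        rw [Complex.conj_ofReal, mul_comm, h2]
    · refine Prod.ext (smoothFunctions_ext fun x => ?_) (smoothFunctions_ext fun x => ?_)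
      · change (a.1 : M → ℂ) x = (a.1 : M → ℂ) x * (‖(a.2 : M → ℂ) x‖ : ℂ) * (‖(a.1 : M → ℂ) x‖ : ℂ)
        rw [mul_assoc, mul_comm (‖(a.2 : M → ℂ) x‖ : ℂ), h2, mul_one]
      · change (a.2 : M → ℂ) x = (a.2 : M → ℂ) x * (‖(a.1 : M → ℂ) x‖ : ℂ) * (‖(a.2 : M → ℂ) x‖ : ℂ)
        rw [mul_assoc, h2, mul_one]

end Algebra

namespace SpinStructure

section Fluctuation

variable {m : ℕ} {M : Type*} [TopologicalSpace M] [ChartedSpace (Coord m) M]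
  [IsManifold (𝓡 (2 * m)) ∞ M] {Δ : DiracMatrices m} {g : Metric (m := m) M}
  {S : SpinStructure Δ g}

theorem frameDeriv_star {F : M → ℂ} {x : M} (hF : MDifferentiableAt (𝓡 (2 * m)) 𝓘(ℝ, ℂ) F x)
    (i : ℕ) (a : Fin (2 * m)) :
    S.frameDeriv i a (fun z => star (F z)) x = star (S.frameDeriv i a F x) := by
  have h1 := S.frameDeriv_comp (φ := Complex.conjCLE.toContinuousLinearMap) (h := F) (x := x)
    Complex.conjCLE.toContinuousLinearMap.differentiableAt hF i a
  rw [ContinuousLinearMap.fderiv] at h1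
  exact h1

variable [MeasurableSpace M]

theorem conjJ_comp (T T' : S.Hilb →L[ℂ] S.Hilb) :
    S.conjJ (T ∘L T') = S.conjJ T ∘L S.conjJ T' :=
  ContinuousLinearMap.ext fun ψ => by simp [conjJ]

theorem conjJ_zero : S.conjJ (0 : S.Hilb →L[ℂ] S.Hilb) = 0 :=
  ContinuousLinearMap.ext fun ψ => by simp [conjJ]

variable [BorelSpace M] [CompactSpace M]

/-- The sign from `J` anticommuting with the Dirac matrices cancels the one from conjugating the
factor `-i`. This is the bounded counterpart of `J D = D J`. -/
theorem conjJ_commutator (hm : Even m) (a : Alg m M) :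
    S.conjJ (S.commutator a) = S.commutator (star a) := by
  refine (isMul_commutator a).conjJ.ext ((isMul_commutator (star a)).congr fun x => ?_)
  have h1 : ∀ c, S.frameDeriv (S.idx x) c ((star a).1 : M → ℂ) x =
      star (S.frameDeriv (S.idx x) c (a.1 : M → ℂ) x) := fun c =>
    frameDeriv_star (ContMDiff.mdifferentiable a.1.2 (by simp) x) _ _
  have h2 : ∀ c, S.frameDeriv (S.idx x) c ((star a).2 : M → ℂ) x =
      star (S.frameDeriv (S.idx x) c (a.2 : M → ℂ) x) := fun c =>
    frameDeriv_star (ContMDiff.mdifferentiable a.2.2 (by simp) x) _ _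
  have h3 : ∀ (c : Fin (2 * m)) (s t : ℂ), Δ.chargeConj * (Δ.gamma c * Δ.chiral s t).map star =
      -(Δ.gamma c * Δ.chiral (star s) (star t) * Δ.chargeConj) := fun c s t => by
    rw [DiracMatrices.map_star_mul, ← mul_assoc, Δ.chargeConj_gamma, neg_mul, mul_assoc, Δ.chargeConj_chiral hm,
      mul_assoc]
  simp only [symbol, h1, h2]
  rw [DiracMatrices.map_star_smul, DiracMatrices.map_star_sum, Matrix.mul_smul, Finset.mul_sum]
  simp only [h3]
  rw [Finset.sum_neg_distrib, ← Finset.sum_mul, smul_neg, neg_mul, Matrix.smul_mul, mul_assoc,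
    Δ.chargeConj_mul_star, mul_one]
  simp

theorem pi_add (a b : Alg m M) : S.pi (a + b) = S.pi a + S.pi b := by
  refine (isMul_pi _).ext (((isMul_pi a).add (isMul_pi b)).congr fun x => ?_)
  simp only [piMat, DiracMatrices.chiral]
  change _ = ((a.1 : M → ℂ) x + (b.1 : M → ℂ) x) • _ + ((a.2 : M → ℂ) x + (b.2 : M → ℂ) x) • _
  module

theorem pi_sub (a b : Alg m M) : S.pi (a - b) = S.pi a - S.pi b :=
  eq_sub_of_add_eq (by rw [← pi_add, sub_add_cancel])

variable [T2Space M]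

theorem dirac_pi (a : Alg m M) (ψ : S.dirac.domain) : ∃ h : S.pi a ψ ∈ S.dirac.domain,
    S.dirac ⟨S.pi a ψ, h⟩ = S.pi (rho a) (S.dirac ψ) + S.commutator a ψ := by
  obtain ⟨h, h1⟩ := isTwistedCommutator_commutator a ψ
  exact ⟨h, by rw [h1, add_sub_cancel]⟩

/-- If `L D R` is a bounded perturbation of `D` for `L = π(l)` and `R = π(r)`, then
`l ρ(r) = 1`. -/
theorem mul_rho_eq_one_of_sandwich_eq [NeZero m] (hm : Even m) {l r : Alg m M}
    {B : S.Hilb →L[ℂ] S.Hilb}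
    (h : S.sandwich (S.pi l) (S.pi r) = (B : S.Hilb →ₗ[ℂ] S.Hilb) +ᵥ S.dirac) :
    l * rho r = 1 := by
  -- On the domain of `D`, equating `π(l ρ(r)) D + π(l) [D, r]_ρ` with `D + B` expresses `π(l ρ(r) -
  -- 1) D` as the bounded operator `Y`.
  refine sub_eq_zero.1 (eq_zero_of_pi_dirac_bounded (S := S) hm (c := l * rho r - 1)
    (Y := B - S.pi l ∘L S.commutator r) fun ψ => ?_)
  have h1 : ((ψ : S.Hilb), B ψ + S.dirac ψ) ∈
      ((B : S.Hilb →ₗ[ℂ] S.Hilb) +ᵥ S.dirac).graph :=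
    LinearPMap.mem_graph ((B : S.Hilb →ₗ[ℂ] S.Hilb) +ᵥ S.dirac) ψ
  rw [← h] at h1
  obtain ⟨y, hy1, hy2⟩ := (LinearPMap.mem_graph_iff _).1 h1
  obtain ⟨h2, h3⟩ := dirac_pi r ψ
  have h4 : S.pi l (S.dirac ⟨S.pi r ψ, h2⟩) = B ψ + S.dirac ψ := by
    refine Eq.trans ?_ hy2
    obtain ⟨y, hy⟩ := y
    obtain rfl : y = (ψ : S.Hilb) := hy1
    rfl
  rw [h3, map_add] at h4
  rw [pi_sub, pi_mul hm, pi_one]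
  simp only [_root_.sub_apply, ContinuousLinearMap.comp_apply]
  rw [sub_eq_sub_iff_add_eq_add]
  exact h4

/-- The two natural domains agree because `π(l)` has the inverse `π(ρ(l))` and both preserve the
domain of `D`. On it the formula is the Leibniz rule. -/
theorem exists_sandwich_eq [NeZero m] (hm : Even m) {l : Alg m M} (hl : l * rho l = 1) :
    S.sandwich (S.pi l) (S.pi l) =
      ((S.pi l ∘L S.commutator l : S.Hilb →L[ℂ] S.Hilb) : S.Hilb →ₗ[ℂ] S.Hilb) +ᵥ S.dirac := by
  have hd : ∀ ψ : S.Hilb, S.pi l ψ ∈ S.dirac.domain ↔ ψ ∈ S.dirac.domain := by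
    refine fun ψ => ⟨fun h => ?_, fun h => (dirac_pi l ⟨ψ, h⟩).1⟩
    obtain ⟨h1, -⟩ := dirac_pi (rho l) ⟨_, h⟩
    have h2 : S.pi (rho l) (S.pi l ψ) = ψ := by
      rw [← ContinuousLinearMap.comp_apply, ← pi_mul hm, mul_comm, hl, pi_one]
      rfl
    rwa [← h2]
  refine LinearPMap.ext (Submodule.ext hd) fun ψ h1 h2 => ?_
  obtain ⟨h3, h4⟩ := dirac_pi l ⟨ψ, h2⟩
  have h5 : S.pi l (S.dirac ⟨S.pi l ψ, h3⟩) =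
      S.pi l (S.commutator l ψ) + S.dirac ⟨ψ, h2⟩ := by
    rw [h4, map_add, ← ContinuousLinearMap.comp_apply, ← pi_mul hm, hl, pi_one, add_comm]
    rfl
  exact h5

theorem inner_sandwich {l : Alg m M} (hl : ContinuousLinearMap.adjoint (S.pi l) = S.pi l)
    {ψ φ : S.Hilb} (hψ : S.pi l ψ ∈ S.dirac.domain) (hφ : S.pi l φ ∈ S.dirac.domain) :
    inner ℂ (S.pi l (S.dirac ⟨_, hψ⟩)) φ = inner ℂ ψ (S.pi l (S.dirac ⟨_, hφ⟩)) := by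
  have h : ∀ p q : S.Hilb, inner ℂ (S.pi l p) q = inner ℂ p (S.pi l q) := fun p q => by
    rw [← ContinuousLinearMap.adjoint_inner_right, hl]
  rw [h]
  exact (inner_symm_of_mem (dirac_mem_diracGraph ⟨_, hψ⟩) (dirac_mem_diracGraph ⟨_, hφ⟩)).trans
    (h _ _)

/-- On the domain of `D` the operator is `π(l) D π(l) - D`, a difference of two symmetric operators.
A bounded operator symmetric on a dense domain is selfadjoint. -/
theorem adjoint_pi_comp_commutator [NeZero m] (hm : Even m) {l : Alg m M} (hs : star l = l)
    (hl : l * rho l = 1) : ContinuousLinearMap.adjoint (S.pi l ∘L S.commutator l) =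
      S.pi l ∘L S.commutator l := by
  have hsa : ContinuousLinearMap.adjoint (S.pi l) = S.pi l := by rw [pi_adjoint hm, hs]
  have hB : ∀ ψ : S.dirac.domain, ∃ h : S.pi l ψ ∈ S.dirac.domain,
      S.pi l (S.dirac ⟨_, h⟩) = S.dirac ψ + (S.pi l ∘L S.commutator l) ψ := by
    intro ψ
    obtain ⟨h, h1⟩ := dirac_pi l ψ
    refine ⟨h, ?_⟩
    rw [h1, map_add, ← ContinuousLinearMap.comp_apply (S.pi l) (S.pi (rho l)), ← pi_mul hm, hl,
      pi_one]
    rfl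
  refine DFunLike.coe_injective (Continuous.ext_on dense_domain_dirac
    (ContinuousLinearMap.continuous _) (ContinuousLinearMap.continuous _) fun φ hφ => ?_)
  refine sub_eq_zero.1 (eq_zero_of_dense dense_domain_dirac fun ψ hψ => ?_)
  rw [inner_sub_right, ContinuousLinearMap.adjoint_inner_right, sub_eq_zero]
  obtain ⟨h1, h2⟩ := hB ⟨ψ, hψ⟩
  obtain ⟨h3, h4⟩ := hB ⟨φ, hφ⟩
  have h5 := inner_sandwich hsa h1 h3
  rw [h2, h4, inner_add_left, inner_add_right] at h5
  have h6 : inner ℂ (S.dirac ⟨ψ, hψ⟩) φ = inner ℂ ψ (S.dirac ⟨φ, hφ⟩) :=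
    inner_symm_of_mem (dirac_mem_diracGraph ⟨ψ, hψ⟩) (dirac_mem_diracGraph ⟨φ, hφ⟩)
  rw [h6] at h5
  exact add_left_cancel h5

/-- For a selfadjoint `l` with `l ρ(l) = 1`, the operator `π(l) D π(l)` is a twisted fluctuation. -/
theorem isTwistedFluctuation_sandwich [NeZero m] (hm : Even m) {l : Alg m M} (hs : star l = l)
    (hl : l * rho l = 1) : S.IsTwistedFluctuation (S.sandwich (S.pi l) (S.pi l)) := by
  -- Since `l` is selfadjoint the one-form is invariant under `J`, so the factor `1/2` makes `A + J
  -- A J⁻¹` equal to `π(l) [D, l]_ρ`.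
  have h1 : S.conjJ (S.pi ((1 / 2 : ℂ) • l) ∘L S.commutator l) =
      S.pi ((1 / 2 : ℂ) • l) ∘L S.commutator l := by
    rw [conjJ_comp, conjJ_pi hm, conjJ_commutator hm, star_smul, hs]
    simp
  have h2 : S.pi ((1 / 2 : ℂ) • l) ∘L S.commutator l +
      S.conjJ (S.pi ((1 / 2 : ℂ) • l) ∘L S.commutator l) = S.pi l ∘L S.commutator l := by
    rw [h1, ← ContinuousLinearMap.add_comp, ← pi_add, ← add_smul]
    norm_num
  refine ⟨S.pi ((1 / 2 : ℂ) • l) ∘L S.commutator l, ⟨1, fun _ => (1 / 2 : ℂ) • l, fun _ => l,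
    fun _ => S.commutator l, fun _ => isTwistedCommutator_commutator l, by simp⟩, ?_, ?_⟩
  · rw [twistedDirac, h2]
    exact isSelfAdjoint_vadd_dirac (adjoint_pi_comp_commutator hm hs hl)
  · rw [twistedDirac, h2, exists_sandwich_eq hm hl]

/-- The unperturbed operator `D`, with the empty sum as one-form. -/
theorem isTwistedFluctuation_sandwich_one : S.IsTwistedFluctuation (S.sandwich 1 1) := by
  refine ⟨0, ⟨0, finZeroElim, finZeroElim, finZeroElim, fun i => i.elim0, by simp⟩, ?_, ?_⟩
  · exact isSelfAdjoint_vadd_dirac (by simp [conjJ_zero])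
  · refine LinearPMap.ext rfl fun ψ h1 h2 => ?_
    have h3 : S.dirac ⟨ψ, h2⟩ = (0 + S.conjJ 0) ψ + S.dirac ⟨ψ, h2⟩ := by simp [conjJ_zero]
    exact h3

end Fluctuation

end SpinStructure

end TwistedDirac
end

/-! ### The two equivalences. -/

theorem mainTheorem9 (m : ℕ) [NeZero m] (hKO : 2 * m % 8 = 0 ∨ 2 * m % 8 = 4)
    (Δ : TwistedDirac.DiracMatrices m)
    {M : Type*} [TopologicalSpace M] [T2Space M] [CompactSpace M]
    [ChartedSpace (TwistedDirac.Coord m) M] [IsManifold (𝓡 (2 * m)) ∞ M]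
    [MeasurableSpace M] [BorelSpace M]
    (g : TwistedDirac.Metric (m := m) M) (S : TwistedDirac.SpinStructure Δ g)
    (a : TwistedDirac.Alg m M) :
    (S.IsTwistedFluctuation (S.sandwich (S.Ad a) (S.plusOp (S.Ad a))) ↔
      a ∈ TwistedDirac.unitaries m M) ∧
    (S.IsTwistedFluctuation (S.sandwich (S.Ad a) (ContinuousLinearMap.adjoint (S.Ad a))) ↔
      ∃ u ∈ TwistedDirac.unitaries m M, ∃ v ∈ TwistedDirac.twistedUnitaries m M, a = u * v) := by
  have hm : Even m := by
    rw [Nat.even_iff]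
    omega
  have hs : star (a * star a) = a * star a := by rw [star_mul, star_star]
  rw [TwistedDirac.SpinStructure.Ad_eq hm, TwistedDirac.SpinStructure.plusOp_pi hm,
    TwistedDirac.SpinStructure.pi_adjoint hm, hs, TwistedDirac.exists_unitary_mul_twistedUnitary_iff,
    TwistedDirac.mem_unitaries_iff]
  refine ⟨⟨?_, fun h => ?_⟩, ?_, TwistedDirac.SpinStructure.isTwistedFluctuation_sandwich hm hs⟩
  -- Here `l = h` and `r = ρ(h)`, so the necessary condition `l ρ(r) = 1` is `h² = 1`.
  · rintro ⟨A, -, -, hA⟩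
    have h1 : a * star a * (a * star a) = 1 := by
      have h2 := TwistedDirac.SpinStructure.mul_rho_eq_one_of_sandwich_eq hm hA
      have h3 : TwistedDirac.rho (TwistedDirac.plus (a * star a)) = star (a * star a) := rfl
      rwa [h3, hs] at h2
    exact Prod.ext (TwistedDirac.mul_star_eq_one_of_sq (congrArg Prod.fst h1))
      (TwistedDirac.mul_star_eq_one_of_sq (congrArg Prod.snd h1))
  · rw [h, show TwistedDirac.plus (1 : TwistedDirac.Alg m M) = 1 from star_one _,
      TwistedDirac.SpinStructure.pi_one]
    exact TwistedDirac.SpinStructure.isTwistedFluctuation_sandwich_one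
  -- Here `l = r = h`, and the condition is `h ρ(h) = 1`.
  · rintro ⟨A, -, -, hA⟩
    exact TwistedDirac.SpinStructure.mul_rho_eq_one_of_sandwich_eq hm hA
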